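/- For $\sigma\ge 0$ let $H^\sigma(\mathbb R)$ be the $L^2$-based Sobolev space with norm $\|f\|_{H^\sigma(\mathbb R)}^2=\frac1{2\pi}\int_{\mathbb R}(1+\tau^2)^\sigma|\hat f(\tau)|^2\,d\tau$, where $\hat f(\tau)=\int_{\mathbb R}e^{-i\tau t}f(t)\,dt$, and for an interval $I\subset\mathbb R$ let $H^\sigma(I)$ be the space of restrictions to $I$ of elements of $H^\sigma(\mathbb R)$, with norm $\|g\|_{H^\sigma(I)}=\inf\{\|f\|_{H^\sigma(\mathbb R)}: f|_I=g\}$. For $T'>0$ consider the problem $$iz_t+\partial_x^4z=0\ \ (x>0,\ 0<t<T'),\qquad z(x,0)=0,\qquad z(0,t)=h_0(t),\qquad z_x(0,t)=h_1(t).\tag{P}$$ A solution of (P) is a function $z\in C([0,T'];L^2(\mathbb R_+))\cap C([0,\infty);L^2(0,T'))$ with weak derivative $z_x\in C([0,\infty);L^2(0,T'))$ which satisfies the equation in the sense of distributions on $\mathbb R_+\times(0,T')$, the initial condition in $L^2(\mathbb R_+)$ and the boundary conditions in $L^2(0,T')$. **Lemma (boundary data-to-solution operator).** Let $s\ge 0$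 with $s\ne 4j+\frac12$ and $s\neq 4j+\frac32$ for all integers $j\ge0$. There is a constant $C$, depending only on $s$, such that the following holds for every $T'>0$. Let $h_0\in H^{\frac{2s+3}8}(\mathbb R)$ and $h_1\in H^{\frac{2s+1}8}(\mathbb R)$ vanish on $\mathbb R\setminus(0,T')$ and satisfy the compatibility conditions: for every integer $j\ge 0$, $\partial_t^kh_0(0)=0$ for $0\le k\le j$ if $s\in(\frac12+4j,\frac12+4(j+1))$, and $\partial_t^kh_1(0)=0$ for $0\le k\le j$ if $s\in(\frac32+4j,\frac32+4(j+1))$. Then (P) has one and only one solution $z=S_b([h_0,h_1])$, and $$z\in C([0,T'];H^s(\mathbb R_+))\cap C([0,\infty);H^{\frac{2s+3}8}(0,T')),\qquad z_x\in C([0,\infty);H^{\frac{2s+1}8}(0,T')),$$ $$\sup_{t\in[0,T']}\|z(\cdot,t)\|_{H^s(\mathbb R_+)}+\sup_{x\ge0}\|z(x,\cdot)\|_{H^{\frac{2s+3}8}(0,T')}\le C\Big(\|h_0\|_{H^{\frac{2s+3}8}(\mathbb R)}+\big(1+T'^{1/2}\big)\|h_1\|_{H^{\frac{2s+1}8}(\mathbb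 R)}\Big).$$ -/

import Mathlib

open MeasureTheory Set Filter Topology
open scoped ENNReal NNReal FourierTransform ContDiff

noncomputable section

/-- The norm of `H^σ(ℝ)` (for `σ ≥ 0`) on the elements of `L²(ℝ)`, with value `∞` off `H^σ(ℝ)`:
the square root of `∫ (1 + τ²)^σ |f̂(τ)|² dτ / (2π)`, where `f̂(τ) = ∫ e^{-iτt} f(t) dt` and
`τ = 2πξ`. Here `𝓕` is the Fourier transform on `L²(ℝ)` with kernel `e^{-2πiξt}`.
For `σ = 0` this is the `L²` norm. -/
def sobolevLineENorm (σ : ℝ) (f : Lp ℂ 2 (volume : Measure ℝ)) : ℝ≥0∞ :=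
  eLpNorm (fun ξ : ℝ =>
    (((1 + (2 * Real.pi * ξ) ^ 2) ^ (σ / 2) : ℝ) : ℂ) *
      (𝓕 f : Lp ℂ 2 (volume : Measure ℝ)) ξ) 2 volume

/-- The restriction norm of `H^σ(I)` (for `σ ≥ 0`): the infimum of the `H^σ(ℝ)` norms of all
extensions of `g` from `I` to `ℝ`; it is `∞` exactly when `g` (as a class of functions on `I`)
does not belong to `H^σ(I)`. For `I = univ` it is the norm of `H^σ(ℝ)`. -/
def sobolevENorm (σ : ℝ) (I : Set ℝ) (g : ℝ → ℂ) : ℝ≥0∞ :=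
  ⨅ (f : Lp ℂ 2 (volume : Measure ℝ)) (_ : f =ᵐ[volume.restrict I] g), sobolevLineENorm σ f

/-- `a ↦ u a` belongs to `C(J; H^σ(I))`. -/
def ContinuousInSobolev (J : Set ℝ) (σ : ℝ) (I : Set ℝ) (u : ℝ → ℝ → ℂ) : Prop :=
  ∀ a ∈ J, sobolevENorm σ I (u a) < ⊤ ∧
    Tendsto (fun b => sobolevENorm σ I (fun y => u b y - u a y)) (𝓝[J] a) (𝓝 0)

/-- The open strip `ℝ₊ × (0,T)` of points `(x,t)`. -/
def halfStrip (T : ℝ) : Set (ℝ × ℝ) := Ioi 0 ×ˢ Ioo 0 T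

/-- Test functions `φ ∈ C_c^∞(Ω)`. -/
def IsTestFunctionOn (Ω : Set (ℝ × ℝ)) (φ : ℝ × ℝ → ℂ) : Prop :=
  ContDiff ℝ ∞ φ ∧ HasCompactSupport φ ∧ tsupport φ ⊆ Ω

/-- `z = z(x,t)`, with weak `x`-derivative `zx`, solves
`i z_t + z_xxxx = 0` in `ℝ₊ × (0,T)`, `z(x,0) = 0`, `z(0,t) = h₀(t)`, `z_x(0,t) = h₁(t)`.
The equation holds in the sense of distributions. The initial condition is that of
`z ∈ C([0,T]; L²(ℝ₊))` at `t = 0`, and the boundary conditions are those of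
`z, z_x ∈ C([0,∞); L²(0,T))` at `x = 0` (`L²` is the case of order `0` of `H^σ`). -/
structure IsHalfLineSolution (T : ℝ) (h₀ h₁ : ℝ → ℂ) (z zx : ℝ → ℝ → ℂ) : Prop where
  measurable : AEStronglyMeasurable (fun p : ℝ × ℝ => z p.1 p.2) (volume.restrict (halfStrip T))
  measurable_dx :
    AEStronglyMeasurable (fun p : ℝ × ℝ => zx p.1 p.2) (volume.restrict (halfStrip T))
  continuous_time : ContinuousInSobolev (Icc 0 T) 0 (Ioi 0) (fun t x => z x t)
  continuous_space : ContinuousInSobolev (Ici 0) 0 (Ioo 0 T) z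
  continuous_space_dx : ContinuousInSobolev (Ici 0) 0 (Ioo 0 T) zx
  weak_dx : ∀ φ : ℝ × ℝ → ℂ, IsTestFunctionOn (halfStrip T) φ →
    ∫ p in halfStrip T, z p.1 p.2 * deriv (fun y => φ (y, p.2)) p.1 =
      -∫ p in halfStrip T, zx p.1 p.2 * φ p
  equation : ∀ φ : ℝ × ℝ → ℂ, IsTestFunctionOn (halfStrip T) φ →
    ∫ p in halfStrip T, z p.1 p.2 *
      (-Complex.I * deriv (fun τ => φ (p.1, τ)) p.2 +
        iteratedDeriv 4 (fun y => φ (y, p.2)) p.1) = 0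
  initial : ∀ᵐ x ∂(volume.restrict (Ioi (0 : ℝ))), z x 0 = 0
  dirichlet : ∀ᵐ t ∂(volume.restrict (Ioo 0 T)), z 0 t = h₀ t
  neumann : ∀ᵐ t ∂(volume.restrict (Ioo 0 T)), zx 0 t = h₁ t

/-- `∂_t^k h(0) = 0`, read on the `C^k` representative of `h`. It is used only for
`h ∈ H^σ(ℝ)` with `σ > k + 1/2`, where that representative exists; it is always unique. -/
def DerivVanishesAtZero (k : ℕ) (h : ℝ → ℂ) : Prop :=
  ∀ g : ℝ → ℂ, ContDiff ℝ k g → g =ᵐ[volume] h → iteratedDeriv k g 0 = 0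

/-- The compatibility conditions at the corner `(x,t) = (0,0)` for zero initial data:
`∂_t^k h₀(0) = 0` for `0 ≤ k ≤ j` if `s ∈ (1/2 + 4j, 1/2 + 4(j+1))`, and
`∂_t^k h₁(0) = 0` for `0 ≤ k ≤ j` if `s ∈ (3/2 + 4j, 3/2 + 4(j+1))`. -/
def CornerCompatible (s : ℝ) (h₀ h₁ : ℝ → ℂ) : Prop :=
  (∀ j : ℕ, s ∈ Ioo (1 / 2 + 4 * (j : ℝ)) (1 / 2 + 4 * ((j : ℝ) + 1)) →
    ∀ k ≤ j, DerivVanishesAtZero k h₀) ∧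
  (∀ j : ℕ, s ∈ Ioo (3 / 2 + 4 * (j : ℝ)) (3 / 2 + 4 * ((j : ℝ) + 1)) →
    ∀ k ≤ j, DerivVanishesAtZero k h₁)

end

/-! ### The Fourier transform on L² and weighted norms on the Fourier side -/

noncomputable section

/-! Existence is by Fourier transform in time. At frequency τ = 2πξ the exponential e^{iτt - rx}
solves the equation when r⁴ = τ. With μ = |τ|^{1/4}, the roots with Re r ≥ 0 are μ and iμ for τ > 0,
and e^{-iπ/4}μ and e^{iπ/4}μ for τ < 0. The two boundary values fix the two amplitudes through a 2 ×
2 system, and the solution is a sum of four waves.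

At fixed x each wave is a Fourier multiplier of modulus at most 1 applied to its amplitude, which
gives the trace bounds and continuity in x. At fixed t the substitution τ = μ⁴ costs a Jacobian μ³,
so s derivatives in x correspond to the weight μ^{s+3/2}, that is to order (2s+3)/8 in t. For r = iμ
this is a change of variables (`weightedENorm_oscillatoryOperator_le`). For decaying roots e^{-rx}
is continued past x = 0 with enough smoothness, and Schur's test bounds the resulting integral
operator (`lintegral_extensionKernel_sq_le`). The Neumann amplitude carries a factor 1/μ, singular
but square integrable at τ = 0; there the transform of h₁ is at most T^{1/2}‖h₁‖ in L², the source
of 1 + T^{1/2}.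

The initial condition is causality. The data live on (0,T), so their Laplace transforms are entire,
and the roots used on the imaginary axis are the boundary values of ρ and iρ for one root ρ analytic
in the right half-plane. Cauchy's theorem (`integral_imaginary_axis_eq_zero`) makes the solution
vanish for t < 0, hence at t = 0 by continuity in time.

Uniqueness is an energy argument. A difference W of two solutions is too rough in x for Green's
formula, but its second antiderivative V in time satisfies V_xxxx = -iV_t with a right side
continuous in x. So V is C⁴ in x, with V = V_x = 0 at x = 0. The clamped operator ∂⁴ is symmetric,
so ‖V(t)‖ is constant, and it vanishes at t = 0. -/

theorem Integrable.fourierInv_toLp_ae_eq {g : ℝ → ℂ} (hg : Integrable g) (hg2 : MemLp g 2) :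
    (𝓕⁻ (hg2.toLp g) : Lp ℂ 2 (volume : Measure ℝ)) =ᵐ[volume] 𝓕⁻ g := by
  have hcont : Continuous (𝓕⁻ g) := by
    rw [Real.fourierInv_eq_fourier_comp_neg]
    exact VectorFourier.fourierIntegral_continuous Real.continuous_fourierChar
      (innerSL ℝ).continuous₂ hg.comp_neg
  have hloc : LocallyIntegrable
      (fun x => (𝓕⁻ (hg2.toLp g) : Lp ℂ 2 (volume : Measure ℝ)) x - 𝓕⁻ g x) :=
    ((Lp.memLp _).locallyIntegrable (by norm_num)).sub hcont.locallyIntegrable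
  -- Two locally integrable functions agree once they agree against test functions. The transform is
  -- moved onto the Schwartz function: for the L² side by the definition of the transform of a
  -- tempered distribution, for the integral formula by Fubini.
  have key := ae_eq_zero_of_integral_contDiff_smul_eq_zero hloc ?_
  · filter_upwards [key] with x hx using sub_eq_zero.1 hx
  intro φ hφ hφc
  have hφ₁ : HasCompactSupport (Complex.ofRealCLM ∘ φ) := hφc.comp_left rfl
  have hφ₂ : ContDiff ℝ ∞ (Complex.ofRealCLM ∘ φ) := by fun_prop
  set ψ : SchwartzMap ℝ ℂ := hφ₁.toSchwartzMap hφ₂ with hψ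
  have e1 : ∫ x, ψ x • (𝓕⁻ (hg2.toLp g) : Lp ℂ 2 (volume : Measure ℝ)) x = ∫ x, ψ x • 𝓕⁻ g x := by
    rw [← Lp.toTemperedDistribution_apply, ← Lp.fourierInv_toTemperedDistribution_eq,
      TemperedDistribution.fourierInv_apply, Lp.toTemperedDistribution_apply]
    have h1 : ∫ x, (𝓕⁻ ψ) x • (hg2.toLp g) x = ∫ x, (𝓕⁻ (ψ : ℝ → ℂ)) x • g x := by
      apply integral_congr_ae
      filter_upwards [hg2.coeFn_toLp] with x hx
      rw [hx, SchwartzMap.fourierInv_coe]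
    rw [h1]
    have := VectorFourier.integral_fourierIntegral_smul_eq_flip (𝕜 := ℝ) (μ := volume)
      (ν := volume) (L := -innerₗ ℝ) (f := (ψ : ℝ → ℂ)) (g := g) Real.continuous_fourierChar
      (by simpa using! (continuous_fst.inner continuous_snd).neg) ψ.integrable hg
    have hfl : (-innerₗ ℝ : ℝ →ₗ[ℝ] ℝ →ₗ[ℝ] ℝ).flip = -innerₗ ℝ := by
      ext; simp
    rw [hfl] at this
    exact this
  have i1 : Integrable (fun x => φ x • (𝓕⁻ (hg2.toLp g) : Lp ℂ 2 (volume : Measure ℝ)) x) :=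
    ((Lp.memLp _).locallyIntegrable (by norm_num)).integrable_smul_left_of_hasCompactSupport
      hφ.continuous hφc
  have i2 : Integrable (fun x => φ x • 𝓕⁻ g x) :=
    hcont.locallyIntegrable.integrable_smul_left_of_hasCompactSupport hφ.continuous hφc
  simp_rw [smul_sub]
  rw [integral_sub i1 i2, sub_eq_zero]
  simpa [hψ] using! e1

theorem Integrable.fourier_toLp_ae_eq {g : ℝ → ℂ} (hg : Integrable g) (hg2 : MemLp g 2) :
    (𝓕 (hg2.toLp g) : Lp ℂ 2 (volume : Measure ℝ)) =ᵐ[volume] 𝓕 g := by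
  have hcont : Continuous (𝓕 g) := 
    VectorFourier.fourierIntegral_continuous Real.continuous_fourierChar
      (innerSL ℝ).continuous₂ hg
  have hloc : LocallyIntegrable
      (fun x => (𝓕 (hg2.toLp g) : Lp ℂ 2 (volume : Measure ℝ)) x - 𝓕 g x) :=
    ((Lp.memLp _).locallyIntegrable (by norm_num)).sub hcont.locallyIntegrable
  have key := ae_eq_zero_of_integral_contDiff_smul_eq_zero hloc ?_
  · filter_upwards [key] with x hx using sub_eq_zero.1 hx
  intro φ hφ hφc
  have hφ₁ : HasCompactSupport (Complex.ofRealCLM ∘ φ) := hφc.comp_left rfl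
  have hφ₂ : ContDiff ℝ ∞ (Complex.ofRealCLM ∘ φ) := by fun_prop
  set ψ : SchwartzMap ℝ ℂ := hφ₁.toSchwartzMap hφ₂ with hψ
  have e1 : ∫ x, ψ x • (𝓕 (hg2.toLp g) : Lp ℂ 2 (volume : Measure ℝ)) x = ∫ x, ψ x • 𝓕 g x := by
    rw [← Lp.toTemperedDistribution_apply, ← Lp.fourier_toTemperedDistribution_eq,
      TemperedDistribution.fourier_apply, Lp.toTemperedDistribution_apply]
    have h1 : ∫ x, (𝓕 ψ) x • (hg2.toLp g) x = ∫ x, (𝓕 (ψ : ℝ → ℂ)) x • g x := by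
      apply integral_congr_ae
      filter_upwards [hg2.coeFn_toLp] with x hx
      rw [hx, SchwartzMap.fourier_coe]
    rw [h1]
    have := VectorFourier.integral_fourierIntegral_smul_eq_flip (𝕜 := ℝ) (μ := volume)
      (ν := volume) (L := innerₗ ℝ) (f := (ψ : ℝ → ℂ)) (g := g) Real.continuous_fourierChar
      (by simpa using! (continuous_fst.inner continuous_snd)) ψ.integrable hg
    rw [flip_innerₗ] at this
    exact this
  have i1 : Integrable (fun x => φ x • (𝓕 (hg2.toLp g) : Lp ℂ 2 (volume : Measure ℝ)) x) :=
    ((Lp.memLp _).locallyIntegrable (by norm_num)).integrable_smul_left_of_hasCompactSupport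
      hφ.continuous hφc
  have i2 : Integrable (fun x => φ x • 𝓕 g x) :=
    hcont.locallyIntegrable.integrable_smul_left_of_hasCompactSupport hφ.continuous hφc
  simp_rw [smul_sub]
  rw [integral_sub i1 i2, sub_eq_zero]
  simpa [hψ] using! e1

/-- Every test function is 𝓕ψ for a Schwartz ψ, and ∫ 𝓕ψ · f = ∫ ψ · 𝓕f = 0. -/
theorem Integrable.ae_eq_zero_of_fourier_eq_zero {f : ℝ → ℂ} (hf : Integrable f)
    (h : ∀ ξ, 𝓕 f ξ = 0) : f =ᵐ[volume] 0 := by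
  apply ae_eq_zero_of_integral_contDiff_smul_eq_zero hf.locallyIntegrable
  intro φ hφ hφc
  have hφ₁ : HasCompactSupport (Complex.ofRealCLM ∘ φ) := hφc.comp_left rfl
  have hφ₂ : ContDiff ℝ ∞ (Complex.ofRealCLM ∘ φ) := by fun_prop
  set ψ : SchwartzMap ℝ ℂ := 𝓕⁻ (hφ₁.toSchwartzMap hφ₂) with hψ
  have e : 𝓕 ψ = hφ₁.toSchwartzMap hφ₂ := by simp [hψ]
  have := VectorFourier.integral_fourierIntegral_smul_eq_flip (𝕜 := ℝ) (μ := volume)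
      (ν := volume) (L := innerₗ ℝ) (f := (ψ : ℝ → ℂ)) (g := f) Real.continuous_fourierChar
      (by simpa using! (continuous_fst.inner continuous_snd)) ψ.integrable hf
  rw [flip_innerₗ] at this
  have h2 : ∫ x, (𝓕 (ψ : ℝ → ℂ)) x • f x = ∫ x, ψ x • 𝓕 f x := this
  rw [← SchwartzMap.fourier_coe, e] at h2
  simpa [h] using! h2

/-- The symbol `(1 + τ²)^(σ/2)`, `τ = 2πξ`, of the Sobolev norm of order `σ`. -/
def sobolevWeight (σ ξ : ℝ) : ℝ := (1 + (2 * Real.pi * ξ) ^ 2) ^ (σ / 2)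

/-- The `H^σ` norm computed on the Fourier side. -/
def weightedENorm (σ : ℝ) (G : ℝ → ℂ) : ℝ≥0∞ :=
  eLpNorm (fun ξ => (sobolevWeight σ ξ : ℂ) * G ξ) 2 volume

theorem one_le_sobolevWeight {σ : ℝ} (hσ : 0 ≤ σ) (ξ : ℝ) : 1 ≤ sobolevWeight σ ξ :=
  Real.one_le_rpow (by nlinarith [sq_nonneg (2 * Real.pi * ξ)]) (by linarith)

theorem sobolevWeight_pos (σ ξ : ℝ) : 0 < sobolevWeight σ ξ := by
  unfold sobolevWeight; positivity

theorem continuous_sobolevWeight (σ : ℝ) : Continuous (sobolevWeight σ) := by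
  unfold sobolevWeight
  refine Continuous.rpow_const (by fun_prop) (fun x => Or.inl (by positivity))

theorem sobolevLineENorm_eq (σ : ℝ) (f : Lp ℂ 2 (volume : Measure ℝ)) :
    sobolevLineENorm σ f = weightedENorm σ (𝓕 f : Lp ℂ 2 (volume : Measure ℝ)) := rfl

theorem weightedENorm_congr {σ : ℝ} {F G : ℝ → ℂ} (h : F =ᵐ[volume] G) :
    weightedENorm σ F = weightedENorm σ G := by
  apply eLpNorm_congr_ae
  filter_upwards [h] with x hx
  rw [hx]

theorem weightedENorm_mono {σ : ℝ} {F G : ℝ → ℂ} (h : ∀ᵐ ξ, ‖F ξ‖ ≤ ‖G ξ‖) :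
    weightedENorm σ F ≤ weightedENorm σ G := by
  apply eLpNorm_mono_ae
  filter_upwards [h] with x hx
  rw [norm_mul, norm_mul]
  gcongr

theorem weightedENorm_le_mul {σ : ℝ} {F G : ℝ → ℂ} {c : ℝ≥0} (h : ∀ᵐ ξ, ‖F ξ‖ ≤ c * ‖G ξ‖) :
    weightedENorm σ F ≤ c * weightedENorm σ G := by
  refine eLpNorm_le_nnreal_smul_eLpNorm_of_ae_le_mul ?_ 2
  filter_upwards [h] with x hx
  rw [← NNReal.coe_le_coe]
  push_cast
  rw [norm_mul, norm_mul]
  calc _ ≤ ‖(sobolevWeight σ x : ℂ)‖ * (c * ‖G x‖) := by gcongr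
    _ = _ := by ring

theorem aestronglyMeasurable_sobolevWeight_mul (σ : ℝ) {F : ℝ → ℂ}
    (hF : AEStronglyMeasurable F volume) :
    AEStronglyMeasurable (fun ξ => (sobolevWeight σ ξ : ℂ) * F ξ) volume :=
  (Complex.continuous_ofReal.comp (continuous_sobolevWeight σ)).aestronglyMeasurable.mul hF

theorem weightedENorm_add_le {σ : ℝ} {F G : ℝ → ℂ} (hF : AEStronglyMeasurable F volume)
    (hG : AEStronglyMeasurable G volume) :
    weightedENorm σ (fun ξ => F ξ + G ξ) ≤ weightedENorm σ F + weightedENorm σ G := by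
  refine le_trans (le_of_eq ?_) (eLpNorm_add_le (aestronglyMeasurable_sobolevWeight_mul σ hF)
    (aestronglyMeasurable_sobolevWeight_mul σ hG) (by norm_num))
  unfold weightedENorm
  congr 1
  ext ξ
  simp [mul_add]

theorem eLpNorm_le_weightedENorm {σ : ℝ} (hσ : 0 ≤ σ) (F : ℝ → ℂ) :
    eLpNorm F 2 volume ≤ weightedENorm σ F := by
  apply eLpNorm_mono
  intro ξ
  rw [norm_mul, Complex.norm_real, Real.norm_of_nonneg (sobolevWeight_pos σ ξ).le]
  exact le_mul_of_one_le_left (norm_nonneg _) (one_le_sobolevWeight hσ ξ)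

theorem memLp_of_weightedENorm_lt_top {σ : ℝ} (hσ : 0 ≤ σ) {F : ℝ → ℂ}
    (hF : AEStronglyMeasurable F volume) (h : weightedENorm σ F < ⊤) : MemLp F 2 :=
  ⟨hF, (eLpNorm_le_weightedENorm hσ F).trans_lt h⟩

open Classical in
/-- The inverse Fourier transform of a square integrable function (junk value `0`). -/
def invFourierL2 (G : ℝ → ℂ) : Lp ℂ 2 (volume : Measure ℝ) :=
  if h : MemLp G 2 then 𝓕⁻ (h.toLp G) else 0

theorem invFourierL2_of_memLp {G : ℝ → ℂ} (h : MemLp G 2) : invFourierL2 G = 𝓕⁻ (h.toLp G) :=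
  dif_pos h

theorem fourier_invFourierL2 {G : ℝ → ℂ} (h : MemLp G 2) :
    (𝓕 (invFourierL2 G) : Lp ℂ 2 (volume : Measure ℝ)) =ᵐ[volume] G := by
  rw [invFourierL2_of_memLp h, FourierTransform.fourier_fourierInv_eq]
  exact h.coeFn_toLp

theorem sobolevLineENorm_invFourierL2 (σ : ℝ) {G : ℝ → ℂ} (h : MemLp G 2) :
    sobolevLineENorm σ (invFourierL2 G) = weightedENorm σ G :=
  weightedENorm_congr (fourier_invFourierL2 h)

theorem invFourierL2_ae_eq {G : ℝ → ℂ} (h1 : Integrable G) (h : MemLp G 2) :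
    invFourierL2 G =ᵐ[volume] 𝓕⁻ G := by
  rw [invFourierL2_of_memLp h]
  exact Integrable.fourierInv_toLp_ae_eq h1 h

theorem invFourierL2_congr {G G' : ℝ → ℂ} (h : MemLp G 2) (hG : G =ᵐ[volume] G') :
    invFourierL2 G = invFourierL2 G' := by
  rw [invFourierL2_of_memLp h, invFourierL2_of_memLp ((memLp_congr_ae hG).1 h)]
  congr 1
  exact (MemLp.toLp_eq_toLp_iff h _).2 hG

theorem invFourierL2_fourier (f : Lp ℂ 2 (volume : Measure ℝ)) :
    invFourierL2 (𝓕 f : Lp ℂ 2 (volume : Measure ℝ)) = f := by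
  rw [invFourierL2_of_memLp (Lp.memLp _), Lp.toLp_coeFn, FourierTransform.fourierInv_fourier_eq]

theorem invFourierL2_add {G G' : ℝ → ℂ} (h : MemLp G 2) (h' : MemLp G' 2) :
    invFourierL2 (fun ξ => G ξ + G' ξ) = invFourierL2 G + invFourierL2 G' := by
  rw [invFourierL2_of_memLp h, invFourierL2_of_memLp h',
    invFourierL2_of_memLp (show MemLp (fun ξ => G ξ + G' ξ) 2 from h.add h'),
    ← FourierTransform.fourierInv_add]
  rfl

theorem invFourierL2_sub {G G' : ℝ → ℂ} (h : MemLp G 2) (h' : MemLp G' 2) :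
    invFourierL2 (fun ξ => G ξ - G' ξ) = invFourierL2 G - invFourierL2 G' := by
  have := invFourierL2_add (h.sub h') h'
  rw [eq_sub_iff_add_eq]
  simp only [Pi.sub_apply, sub_add_cancel] at this
  exact this.symm

theorem eLpNorm_invFourierL2 {G : ℝ → ℂ} (h : MemLp G 2) :
    eLpNorm (invFourierL2 G) 2 volume = eLpNorm G 2 volume := by
  rw [invFourierL2_of_memLp h]
  have : ‖(𝓕⁻ (h.toLp G) : Lp ℂ 2 (volume : Measure ℝ))‖ = ‖h.toLp G‖ := by
    exact ((Lp.fourierTransformₗᵢ ℝ ℂ).symm.norm_map (h.toLp G))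
  rw [Lp.norm_def, Lp.norm_def, ENNReal.toReal_eq_toReal_iff' (Lp.eLpNorm_ne_top _)
    (Lp.eLpNorm_ne_top _)] at this
  rw [this]
  exact eLpNorm_congr_ae h.coeFn_toLp

theorem sobolevENorm_le {σ : ℝ} {I : Set ℝ} {g : ℝ → ℂ} (f : Lp ℂ 2 (volume : Measure ℝ))
    (h : f =ᵐ[volume.restrict I] g) : sobolevENorm σ I g ≤ sobolevLineENorm σ f :=
  iInf₂_le f h

theorem sobolevENorm_le_weightedENorm {σ : ℝ} {I : Set ℝ} {g G : ℝ → ℂ} (hG : MemLp G 2)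
    (h : invFourierL2 G =ᵐ[volume.restrict I] g) : sobolevENorm σ I g ≤ weightedENorm σ G := by
  rw [← sobolevLineENorm_invFourierL2 σ hG]
  exact sobolevENorm_le _ h

theorem eLpNorm_le_sobolevLineENorm {σ : ℝ} (hσ : 0 ≤ σ) (f : Lp ℂ 2 (volume : Measure ℝ)) :
    eLpNorm f 2 volume ≤ sobolevLineENorm σ f := by
  have := eLpNorm_invFourierL2 (Lp.memLp (𝓕 f : Lp ℂ 2 (volume : Measure ℝ)))
  rw [invFourierL2_fourier] at this
  rw [this]
  exact eLpNorm_le_weightedENorm hσ _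

theorem eLpNorm_restrict_le_sobolevENorm {σ : ℝ} (hσ : 0 ≤ σ) {I : Set ℝ} (g : ℝ → ℂ) :
    eLpNorm g 2 (volume.restrict I) ≤ sobolevENorm σ I g := by
  refine le_iInf₂ fun f hf => ?_
  rw [← eLpNorm_congr_ae hf]
  exact (eLpNorm_mono_measure _ Measure.restrict_le_self).trans (eLpNorm_le_sobolevLineENorm hσ f)

theorem exists_ae_eq_of_sobolevENorm_lt_top {σ : ℝ} {I : Set ℝ} {g : ℝ → ℂ}
    (h : sobolevENorm σ I g < ⊤) :
    ∃ f : Lp ℂ 2 (volume : Measure ℝ), f =ᵐ[volume.restrict I] g ∧ sobolevLineENorm σ f < ⊤ := by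
  simp only [sobolevENorm, iInf_lt_iff] at h
  obtain ⟨f, hf, h⟩ := h
  exact ⟨f, hf, h⟩

theorem memLp_of_sobolevENorm_lt_top {σ : ℝ} (hσ : 0 ≤ σ) {I : Set ℝ} {g : ℝ → ℂ}
    (h : sobolevENorm σ I g < ⊤) : MemLp g 2 (volume.restrict I) := by
  obtain ⟨f, hf, -⟩ := exists_ae_eq_of_sobolevENorm_lt_top h
  exact ⟨((Lp.aestronglyMeasurable f).mono_measure Measure.restrict_le_self).congr hf,
    (eLpNorm_restrict_le_sobolevENorm hσ g).trans_lt h⟩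

theorem sobolevENorm_univ {σ : ℝ} {g : ℝ → ℂ} (f : Lp ℂ 2 (volume : Measure ℝ))
    (h : f =ᵐ[volume] g) : sobolevENorm σ univ g = sobolevLineENorm σ f := by
  apply le_antisymm (sobolevENorm_le f (by simpa using h))
  refine le_iInf₂ fun f' hf' => ?_
  rw [Measure.restrict_univ] at hf'
  rw [Lp.ext (hf'.trans h.symm)]

/-- The restriction norm is an infimum over extensions, so one family of extensions that is
continuous in the weighted norm suffices. -/
theorem continuousInSobolev_of_weightedENorm {σ : ℝ} (hσ : 0 ≤ σ) {J I : Set ℝ}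
    {u G : ℝ → ℝ → ℂ} (hm : ∀ a ∈ J, AEStronglyMeasurable (G a) volume)
    (hfin : ∀ a ∈ J, weightedENorm σ (G a) < ⊤)
    (hu : ∀ a ∈ J, invFourierL2 (G a) =ᵐ[volume.restrict I] u a)
    (hlim : ∀ a ∈ J, Tendsto (fun b => weightedENorm σ (fun ξ => G b ξ - G a ξ)) (𝓝[J] a) (𝓝 0)) :
    ContinuousInSobolev J σ I u := by
  have hL : ∀ a ∈ J, MemLp (G a) 2 := fun a ha =>
    memLp_of_weightedENorm_lt_top hσ (hm a ha) (hfin a ha)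
  intro a ha
  refine ⟨(sobolevENorm_le_weightedENorm (hL a ha) (hu a ha)).trans_lt (hfin a ha), ?_⟩
  refine tendsto_of_tendsto_of_tendsto_of_le_of_le' tendsto_const_nhds (hlim a ha)
    (Eventually.of_forall fun _ => bot_le) ?_
  filter_upwards [self_mem_nhdsWithin] with b hb
  refine sobolevENorm_le_weightedENorm ((hL b hb).sub (hL a ha)) ?_
  rw [invFourierL2_sub (hL b hb) (hL a ha)]
  filter_upwards [hu a ha, hu b hb, ae_restrict_of_ae (Lp.coeFn_sub (invFourierL2 (G b))
    (invFourierL2 (G a)))] with x h1 h2 h3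
  rw [h3, Pi.sub_apply, h1, h2]

/-- Dominated convergence: bounded multipliers that converge pointwise converge strongly. It serves
for the frequency cutoffs and for the continuity of the waves in x and in t. -/
theorem tendsto_weightedENorm_mul_sub {σ : ℝ} {F : ℝ → ℂ} (hF : AEStronglyMeasurable F volume)
    (hfin : weightedENorm σ F < ⊤) {ι : Type*} {l : Filter ι} [l.IsCountablyGenerated]
    {m : ι → ℝ → ℂ} {m₀ : ℝ → ℂ} {K : ℝ≥0}
    (hm : ∀ᶠ b in l, AEStronglyMeasurable (m b) volume)
    (hm0 : AEStronglyMeasurable m₀ volume)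
    (hK : ∀ᶠ b in l, ∀ ξ, ‖m b ξ - m₀ ξ‖ ≤ K)
    (hlim : ∀ᵐ ξ, Tendsto (fun b => m b ξ) l (𝓝 (m₀ ξ))) :
    Tendsto (fun b => weightedENorm σ (fun ξ => m b ξ * F ξ - m₀ ξ * F ξ)) l (𝓝 0) := by
  have h2 : ∀ b, weightedENorm σ (fun ξ => m b ξ * F ξ - m₀ ξ * F ξ) =
      (∫⁻ ξ, ‖(sobolevWeight σ ξ : ℂ) * (m b ξ * F ξ - m₀ ξ * F ξ)‖ₑ ^ (2 : ℝ)) ^ (1 / 2 : ℝ) := by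
    intro b
    unfold weightedENorm
    rw [eLpNorm_eq_lintegral_rpow_enorm_toReal (by norm_num) (by norm_num)]
    simp
  simp_rw [h2]
  rw [show (0 : ℝ≥0∞) = 0 ^ (1 / 2 : ℝ) by simp]
  apply (ENNReal.continuous_rpow_const.tendsto _).comp
  rw [show (0 : ℝ≥0∞) = ∫⁻ _ : ℝ, 0 by simp]
  have hfin' : ∫⁻ ξ, ‖(sobolevWeight σ ξ : ℂ) * F ξ‖ₑ ^ (2 : ℝ) < ⊤ := by
    have := lintegral_rpow_enorm_lt_top_of_eLpNorm_lt_top (by norm_num) (by norm_num) hfin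
    simpa using this
  -- Dominated convergence needs a sequence whose terms all satisfy the bound; as the bound and the
  -- measurability hold only eventually, the first N terms are dropped.
  refine tendsto_of_seq_tendsto fun u hu => ?_
  obtain ⟨N, hN⟩ := eventually_atTop.1 ((hu.eventually hm).and (hu.eventually hK))
  rw [← tendsto_add_atTop_iff_nat N]
  refine tendsto_lintegral_of_dominated_convergence'
    (fun ξ => (K : ℝ≥0∞) ^ (2 : ℝ) * ‖(sobolevWeight σ ξ : ℂ) * F ξ‖ₑ ^ (2 : ℝ)) ?_ ?_ ?_ ?_
  · intro n
    exact ((aestronglyMeasurable_sobolevWeight_mul σ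
      ((((hN (n + N) (by omega)).1).mul hF).sub (hm0.mul hF))).enorm.pow_const _)
  · intro n
    refine Eventually.of_forall fun ξ => ?_
    have hb := (hN (n + N) (by omega)).2 ξ
    dsimp only [Function.comp]
    rw [← ENNReal.mul_rpow_of_nonneg _ _ (by norm_num)]
    gcongr
    rw [← sub_mul, mul_left_comm, enorm_mul]
    gcongr
    exact ENNReal.coe_le_coe.2 (show ‖m (u (n + N)) ξ - m₀ ξ‖₊ ≤ K from hb)
  · rw [lintegral_const_mul' _ _ (by simp)]
    exact (ENNReal.mul_lt_top (by simp) hfin').ne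
  · filter_upwards [hlim] with ξ hξ
    rw [tendsto_add_atTop_iff_nat (f := fun n => ‖(sobolevWeight σ ξ : ℂ) *
      (m (u n) ξ * F ξ - m₀ ξ * F ξ)‖ₑ ^ (2 : ℝ)) N]
    have h3 : Tendsto (fun b => (sobolevWeight σ ξ : ℂ) * (m b ξ * F ξ - m₀ ξ * F ξ)) l (𝓝 0) := by
      have : Tendsto (fun b => (sobolevWeight σ ξ : ℂ) * (m b ξ * F ξ - m₀ ξ * F ξ)) l
        (𝓝 ((sobolevWeight σ ξ : ℂ) * (m₀ ξ * F ξ - m₀ ξ * F ξ))) :=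
        ((hξ.mul_const _).sub_const _).const_mul _
      simpa using this
    have h4 := ((ENNReal.continuous_rpow_const (y := (2 : ℝ))).tendsto _ |>.comp
      (h3.enorm)).comp hu
    simpa [Function.comp_def] using! h4

end

/-! ### The substitution τ = μ⁴ and Schur's test -/

noncomputable section

/-- The modulus `|τ|^(1/4)`, `τ = 2πξ`, of the characteristic roots. -/
def rootModulus (ξ : ℝ) : ℝ := (2 * Real.pi * |ξ|) ^ (1 / 4 : ℝ)

theorem rootModulus_nonneg (ξ : ℝ) : 0 ≤ rootModulus ξ := by
  unfold rootModulus; positivity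

theorem rootModulus_pos {ξ : ℝ} (h : ξ ≠ 0) : 0 < rootModulus ξ := by
  have := abs_pos.2 h
  unfold rootModulus; positivity

theorem rootModulus_neg (ξ : ℝ) : rootModulus (-ξ) = rootModulus ξ := by
  simp [rootModulus]

theorem rootModulus_pow_four (ξ : ℝ) : rootModulus ξ ^ 4 = 2 * Real.pi * |ξ| := by
  unfold rootModulus
  rw [← Real.rpow_natCast, ← Real.rpow_mul (by positivity)]
  norm_num

theorem continuous_rootModulus : Continuous rootModulus := by
  unfold rootModulus
  exact Continuous.rpow_const (by fun_prop) (fun x => Or.inr (by norm_num))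

theorem rootModulus_quartic {η : ℝ} (hη : 0 ≤ η) :
    rootModulus ((2 * Real.pi) ^ 3 * η ^ 4) = 2 * Real.pi * η := by
  unfold rootModulus
  rw [abs_of_nonneg (by positivity), show 2 * Real.pi * ((2 * Real.pi) ^ 3 * η ^ 4) =
    (2 * Real.pi * η) ^ 4 by ring, ← Real.rpow_natCast, ← Real.rpow_mul (by positivity)]
  norm_num

theorem image_quartic_Ioi : (fun η : ℝ => (2 * Real.pi) ^ 3 * η ^ 4) '' Ioi 0 = Ioi 0 := by
  ext ξ
  simp only [mem_image, mem_Ioi]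
  constructor
  · rintro ⟨η, hη, rfl⟩
    positivity
  · intro h
    refine ⟨rootModulus ξ / (2 * Real.pi), div_pos (rootModulus_pos h.ne') (by positivity), ?_⟩
    rw [div_pow, rootModulus_pow_four, abs_of_pos h]
    field_simp

theorem injOn_quartic_Ioi : InjOn (fun η : ℝ => (2 * Real.pi) ^ 3 * η ^ 4) (Ioi 0) := by
  intro a ha b hb h
  have h1 := rootModulus_quartic (le_of_lt ha)
  have h2 := rootModulus_quartic (le_of_lt hb)
  simp only at h
  rw [h, h2] at h1
  have : (2 * Real.pi) ≠ 0 := by positivity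
  exact (mul_left_cancel₀ this h1).symm

theorem hasDerivWithinAt_quartic (η : ℝ) (t : Set ℝ) :
    HasDerivWithinAt (fun η : ℝ => (2 * Real.pi) ^ 3 * η ^ 4)
      (4 * (2 * Real.pi) ^ 3 * η ^ 3) t η := by
  refine (((hasDerivAt_pow 4 η).const_mul ((2 * Real.pi) ^ 3)).congr_deriv ?_).hasDerivWithinAt
  norm_num
  ring

/-- In the variable η with ξ = (2π)³η⁴ the root modulus becomes 2πη, so that e^{-iμ(ξ)x} turns into
a Fourier character in x. -/
theorem lintegral_Ioi_quartic (Φ : ℝ → ℝ≥0∞) :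
    ∫⁻ ξ in Ioi (0 : ℝ), Φ ξ = ∫⁻ η in Ioi (0 : ℝ),
      ENNReal.ofReal (4 * (2 * Real.pi) ^ 3 * η ^ 3) * Φ ((2 * Real.pi) ^ 3 * η ^ 4) := by
  conv_lhs => rw [← image_quartic_Ioi]
  rw [lintegral_image_eq_lintegral_abs_deriv_mul measurableSet_Ioi
    (fun η _ => hasDerivWithinAt_quartic η _) injOn_quartic_Ioi]
  refine setLIntegral_congr_fun measurableSet_Ioi fun η hη => ?_
  have : (0 : ℝ) < η := hη
  rw [abs_of_nonneg (by positivity)]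

theorem integral_Ioi_quartic (Φ : ℝ → ℂ) :
    ∫ ξ in Ioi (0 : ℝ), Φ ξ = ∫ η in Ioi (0 : ℝ),
      ((4 * (2 * Real.pi) ^ 3 * η ^ 3 : ℝ) : ℂ) * Φ ((2 * Real.pi) ^ 3 * η ^ 4) := by
  conv_lhs => rw [← image_quartic_Ioi]
  rw [integral_image_eq_integral_abs_deriv_smul measurableSet_Ioi
    (fun η _ => hasDerivWithinAt_quartic η _) injOn_quartic_Ioi]
  refine setIntegral_congr_fun measurableSet_Ioi fun η hη => ?_
  have : (0 : ℝ) < η := hη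
  rw [abs_of_nonneg (by positivity), Complex.real_smul]

/-- Schur's test for nonnegative kernels. -/
theorem lintegral_schur_sq_le {α β : Type*} [MeasurableSpace α] [MeasurableSpace β]
    {μ : Measure α} {ν : Measure β} [SFinite μ] [SFinite ν] {k : β → α → ℝ≥0∞}
    (hk : Measurable (Function.uncurry k)) {p f : α → ℝ≥0∞} (hp : Measurable p)
    (hf : Measurable f) {q : β → ℝ≥0∞} (hq : Measurable q) (hp0 : ∀ᵐ a ∂μ, p a ≠ 0)
    (hpt : ∀ᵐ a ∂μ, p a ≠ ⊤) {C : ℝ≥0∞}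
    (h1 : ∀ᵐ b ∂ν, ∫⁻ a, k b a * p a ∂μ ≤ C * q b)
    (h2 : ∀ᵐ a ∂μ, ∫⁻ b, k b a * q b ∂ν ≤ C * p a) :
    ∫⁻ b, (∫⁻ a, k b a * f a ∂μ) ^ 2 ∂ν ≤ C ^ 2 * ∫⁻ a, f a ^ 2 ∂μ := by
  have hkb : ∀ b, Measurable (k b) := fun b => hk.comp measurable_prodMk_left
  have hg : Measurable fun a => f a ^ 2 * (p a)⁻¹ := (hf.pow_const 2).mul hp.inv
  have hkg : ∀ b, Measurable fun a => k b a * (f a ^ 2 * (p a)⁻¹) := fun b => (hkb b).mul hg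
  have hqkg : Measurable fun z : β × α => q z.1 * (k z.1 z.2 * (f z.2 ^ 2 * (p z.2)⁻¹)) :=
    (hq.comp measurable_fst).mul (hk.mul (hg.comp measurable_snd))
  have cs : ∀ b, (∫⁻ a, k b a * f a ∂μ) ^ 2 ≤
      (∫⁻ a, k b a * p a ∂μ) * ∫⁻ a, k b a * (f a ^ 2 * (p a)⁻¹) ∂μ := by
    intro b
    -- Cauchy–Schwarz for the splitting kf = (kp)^{1/2} (kf²/p)^{1/2}.
    have := ENNReal.lintegral_mul_le_Lp_mul_Lq μ (p := 2) (q := 2)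
      (by rw [Real.holderConjugate_iff]; norm_num)
      (f := fun a => (k b a * p a) ^ (1 / 2 : ℝ))
      (g := fun a => (k b a * (f a ^ 2 * (p a)⁻¹)) ^ (1 / 2 : ℝ))
      (((hkb b).mul hp).pow_const _).aemeasurable
      ((hkg b).pow_const _).aemeasurable
    have e1 : ∫⁻ a, ((fun a => (k b a * p a) ^ (1 / 2 : ℝ)) *
        (fun a => (k b a * (f a ^ 2 * (p a)⁻¹)) ^ (1 / 2 : ℝ))) a ∂μ = ∫⁻ a, k b a * f a ∂μ := by
      apply lintegral_congr_ae
      filter_upwards [hp0, hpt] with a ha hb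
      simp only [Pi.mul_apply]
      rw [← ENNReal.mul_rpow_of_nonneg _ _ (by norm_num)]
      rw [show k b a * p a * (k b a * (f a ^ 2 * (p a)⁻¹)) =
        (k b a * f a) ^ 2 * (p a * (p a)⁻¹) by ring, ENNReal.mul_inv_cancel ha hb, mul_one,
        ← ENNReal.rpow_natCast, ← ENNReal.rpow_mul]
      norm_num
    rw [e1] at this
    simp only [← ENNReal.rpow_mul] at this
    norm_num at this
    calc _ ≤ ((∫⁻ a, k b a * p a ∂μ) ^ (1 / 2 : ℝ) *
        (∫⁻ a, k b a * (f a ^ 2 * (p a)⁻¹) ∂μ) ^ (1 / 2 : ℝ)) ^ 2 := by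
          gcongr
      _ = _ := by
        rw [mul_pow, ← ENNReal.rpow_natCast, ← ENNReal.rpow_natCast, ← ENNReal.rpow_mul,
          ← ENNReal.rpow_mul]
        norm_num
  calc ∫⁻ b, (∫⁻ a, k b a * f a ∂μ) ^ 2 ∂ν
      ≤ ∫⁻ b, C * ∫⁻ a, q b * (k b a * (f a ^ 2 * (p a)⁻¹)) ∂μ ∂ν := by
        apply lintegral_mono_ae
        filter_upwards [h1] with b hb
        rw [lintegral_const_mul _ (hkg b), ← mul_assoc]
        exact (cs b).trans (by gcongr)
    _ = C * ∫⁻ b, ∫⁻ a, q b * (k b a * (f a ^ 2 * (p a)⁻¹)) ∂μ ∂ν := by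
        rw [lintegral_const_mul]
        exact hqkg.lintegral_prod_right'
    _ = C * ∫⁻ a, ∫⁻ b, q b * (k b a * (f a ^ 2 * (p a)⁻¹)) ∂ν ∂μ := by
        rw [lintegral_lintegral_swap]
        exact hqkg.aemeasurable
    _ ≤ C * ∫⁻ a, C * f a ^ 2 ∂μ := by
        gcongr 1
        apply lintegral_mono_ae
        filter_upwards [h2, hp0, hpt] with a ha h0 ht
        calc ∫⁻ b, q b * (k b a * (f a ^ 2 * (p a)⁻¹)) ∂ν
            = (∫⁻ b, k b a * q b ∂ν) * (f a ^ 2 * (p a)⁻¹) := by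
              rw [← lintegral_mul_const]
              · congr with b; ring
              · exact (hk.comp measurable_prodMk_right).mul hq
          _ ≤ C * p a * (f a ^ 2 * (p a)⁻¹) := by gcongr
          _ = C * f a ^ 2 * (p a * (p a)⁻¹) := by ring
          _ = C * f a ^ 2 := by rw [ENNReal.mul_inv_cancel h0 ht, mul_one]
    _ = C ^ 2 * ∫⁻ a, f a ^ 2 ∂μ := by
        rw [lintegral_const_mul _ (hf.pow_const 2)]; ring

/-- The exact value is πh^{-1/2}. Dropping κ from the denominator for κ ≤ h and h for κ > h bounds
each piece by 2h^{-1/2}. Both Schur conditions for the extension operator reduce to this integral.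
-/
theorem lintegral_Ioi_rpow_div_add_le {h : ℝ} (hh : 0 < h) :
    ∫⁻ κ in Ioi (0 : ℝ), ENNReal.ofReal (κ ^ (-1 / 2 : ℝ) / (κ + h)) ≤
      ENNReal.ofReal (4 * h ^ (-1 / 2 : ℝ)) := by
  rw [← Ioc_union_Ioi_eq_Ioi hh.le, lintegral_union measurableSet_Ioi (by
    rw [Set.disjoint_left]; rintro x hx hx'; exact absurd hx.2 (not_le.2 hx'))]
  have a1 : ∫⁻ κ in Ioc (0 : ℝ) h, ENNReal.ofReal (κ ^ (-1 / 2 : ℝ) / (κ + h)) ≤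
      ENNReal.ofReal (2 * h ^ (-1 / 2 : ℝ)) := by
    have hi : IntegrableOn (fun κ : ℝ => κ ^ (-1 / 2 : ℝ) * h⁻¹) (Ioc 0 h) := by
      have := (intervalIntegral.intervalIntegrable_rpow' (a := 0) (b := h) (r := -1 / 2)
        (by norm_num)).mul_const h⁻¹
      rwa [intervalIntegrable_iff_integrableOn_Ioc_of_le hh.le] at this
    calc _ ≤ ∫⁻ κ in Ioc (0 : ℝ) h, ENNReal.ofReal (κ ^ (-1 / 2 : ℝ) * h⁻¹) := by
          refine setLIntegral_mono' measurableSet_Ioc fun κ hκ => ENNReal.ofReal_le_ofReal ?_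
          have := hκ.1
          rw [div_eq_mul_inv]
          gcongr
          linarith
      _ = ENNReal.ofReal (∫ κ in Ioc (0 : ℝ) h, κ ^ (-1 / 2 : ℝ) * h⁻¹) := by
          rw [ofReal_integral_eq_lintegral_ofReal hi]
          filter_upwards [ae_restrict_mem measurableSet_Ioc] with κ hκ
          have := hκ.1
          simp only [Pi.zero_apply]; positivity
      _ = _ := by
          congr 1
          rw [← intervalIntegral.integral_of_le hh.le, intervalIntegral.integral_mul_const,
            integral_rpow (by left; norm_num)]
          norm_num
          rw [show (-(1 / 2) : ℝ) = 1 / 2 - 1 by norm_num, Real.rpow_sub hh, Real.rpow_one]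
          field_simp
  have a2 : ∫⁻ κ in Ioi h, ENNReal.ofReal (κ ^ (-1 / 2 : ℝ) / (κ + h)) ≤
      ENNReal.ofReal (2 * h ^ (-1 / 2 : ℝ)) := by
    have hi : IntegrableOn (fun κ : ℝ => κ ^ (-3 / 2 : ℝ)) (Ioi h) :=
      integrableOn_Ioi_rpow_of_lt (by norm_num) hh
    calc _ ≤ ∫⁻ κ in Ioi h, ENNReal.ofReal (κ ^ (-3 / 2 : ℝ)) := by
          refine setLIntegral_mono' measurableSet_Ioi fun κ hκ => ENNReal.ofReal_le_ofReal ?_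
          have hκ' : h < κ := hκ
          have : 0 < κ := hh.trans hκ'
          rw [show (-3 / 2 : ℝ) = -1 / 2 - 1 by norm_num, Real.rpow_sub this, Real.rpow_one]
          gcongr
          linarith
      _ = ENNReal.ofReal (∫ κ in Ioi h, κ ^ (-3 / 2 : ℝ)) := by
          rw [ofReal_integral_eq_lintegral_ofReal hi]
          filter_upwards [ae_restrict_mem measurableSet_Ioi] with κ hκ
          have : 0 < κ := hh.trans hκ
          simp only [Pi.zero_apply]; positivity
      _ = _ := by
          congr 1
          rw [integral_Ioi_rpow_of_lt (by norm_num) hh]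
          norm_num
          ring
  refine (add_le_add a1 a2).trans (le_of_eq ?_)
  rw [← ENNReal.ofReal_add (by positivity) (by positivity)]
  congr 1; ring

end

/-! ### Continuation of a decaying exponential to the whole line -/

noncomputable section

theorem norm_pow_mul_cexp (r : ℂ) (k : ℕ) {u : ℝ} (hu : 0 ≤ u) :
    ‖(u : ℂ) ^ k * Complex.exp (-r * u)‖ = u ^ k * Real.exp (-r.re * u) := by
  rw [norm_mul, norm_pow, Complex.norm_real, Real.norm_of_nonneg hu, Complex.norm_exp]
  simp

theorem integrableOn_pow_mul_cexp {r : ℂ} (hr : 0 < r.re) (k : ℕ) :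
    IntegrableOn (fun u : ℝ => (u : ℂ) ^ k * Complex.exp (-r * u)) (Ioi 0) := by
  have h := integrableOn_rpow_mul_exp_neg_mul_rpow (s := k) (p := 1) (b := r.re)
    (by have : (0 : ℝ) ≤ k := by positivity
        linarith) zero_lt_one hr
  refine Integrable.mono' h (Continuous.aestronglyMeasurable (by fun_prop)) ?_
  filter_upwards [ae_restrict_mem measurableSet_Ioi] with u hu
  rw [norm_pow_mul_cexp r k (le_of_lt hu), Real.rpow_natCast, Real.rpow_one]

/-- The Laplace transform of a monomial at a complex rate; each induction step is one integration by
parts. -/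
theorem integral_pow_mul_cexp {r : ℂ} (hr : 0 < r.re) (k : ℕ) :
    ∫ u in Ioi (0 : ℝ), (u : ℂ) ^ k * Complex.exp (-r * u) = k.factorial / r ^ (k + 1) := by
  have hr0 : r ≠ 0 := by rintro rfl; simp at hr
  induction k with
  | zero =>
    have := integral_exp_mul_complex_Ioi (a := -r) (by simpa using hr) 0
    simp only [pow_zero, one_mul, this]
    simp
  | succ k ih =>
    have hder : ∀ u ∈ Ioi (0 : ℝ), HasDerivAt
        (fun u : ℝ => -((u : ℂ) ^ (k + 1) * Complex.exp (-r * u)) / r)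
        ((u : ℂ) ^ (k + 1) * Complex.exp (-r * u) -
          (k + 1) / r * ((u : ℂ) ^ k * Complex.exp (-r * u))) u := by
      intro u _
      have h1 : HasDerivAt (fun u : ℝ => (u : ℂ)) 1 u := Complex.ofRealCLM.hasDerivAt
      have h2 := ((h1.pow (k + 1)).mul ((h1.const_mul (-r)).cexp)).neg.div_const r
      refine h2.congr_deriv ?_
      simp
      field_simp
      ring
    have hlim : Tendsto (fun u : ℝ => -((u : ℂ) ^ (k + 1) * Complex.exp (-r * u)) / r) atTop
        (𝓝 0) := by
      have h0 : Tendsto (fun u : ℝ => (u : ℂ) ^ (k + 1) * Complex.exp (-r * u)) atTop (𝓝 0) := by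
        rw [tendsto_zero_iff_norm_tendsto_zero]
        have := (Real.tendsto_pow_mul_exp_neg_atTop_nhds_zero (k + 1)).comp
          (tendsto_id.const_mul_atTop hr)
        have h3 := this.const_mul ((r.re)⁻¹ ^ (k + 1))
        rw [mul_zero] at h3
        refine h3.congr' ?_
        filter_upwards [eventually_ge_atTop 0] with u hu
        rw [norm_pow_mul_cexp r (k + 1) hu]
        simp only [Function.comp, id]
        rw [mul_pow, inv_pow, neg_mul]
        field_simp
      simpa using h0.neg.div_const r
    have hint := integral_Ioi_of_hasDerivAt_of_tendsto (a := 0)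
      (Continuous.continuousWithinAt (by fun_prop)) hder
      ((integrableOn_pow_mul_cexp hr (k + 1)).sub
        ((integrableOn_pow_mul_cexp hr k).const_mul _)) hlim
    rw [integral_sub (integrableOn_pow_mul_cexp hr (k + 1))
      ((integrableOn_pow_mul_cexp hr k).const_mul _), integral_const_mul, ih] at hint
    simp only [Complex.ofReal_zero, ne_eq, Nat.add_eq_zero_iff, one_ne_zero, and_false,
      not_false_eq_true, zero_pow, zero_mul, neg_zero, zero_div, sub_zero] at hint
    rw [sub_eq_zero.1 hint, Nat.factorial_succ]
    push_cast
    field_simp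
    ring

/-- The symbol of an extension to the line of the exponential `e^{-cu}`, `u ≥ 0`. -/
def extensionSymbol (c : ℂ) (M : ℕ) (ν : ℝ) : ℂ :=
  ((1 + c) / (1 - 2 * Real.pi * Complex.I * ν)) ^ M / (c + 2 * Real.pi * Complex.I * ν)

/-- The extension to the line of `e^{-cu}`, `u ≥ 0`, by `e^u` times a Taylor polynomial. -/
def expExtension (c : ℂ) (M : ℕ) (u : ℝ) : ℂ :=
  if 0 ≤ u then Complex.exp (-c * u) else
    Complex.exp u * ∑ j ∈ Finset.range M, ((1 + c) * (-u)) ^ j / j.factorial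

theorem continuous_expExtension (c : ℂ) {M : ℕ} (hM : 0 < M) : Continuous (expExtension c M) := by
  unfold expExtension
  refine Continuous.if_le (by fun_prop) (by fun_prop) continuous_const continuous_id ?_
  rintro u rfl
  -- At u = 0 only the term j = 0 survives, so M > 0 is exactly what makes the two pieces match
  -- there.
  rw [Finset.sum_eq_single_of_mem 0 (Finset.mem_range.2 hM)]
  · simp
  · intro j _ hj
    simp [hj]

theorem one_sub_ne_zero' (ν : ℝ) : (1 - 2 * Real.pi * Complex.I * ν : ℂ) ≠ 0 := by
  intro h
  have := congrArg Complex.re h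
  simp at this

theorem add_imag_ne_zero {c : ℂ} (hc : 0 < c.re) (ν : ℝ) :
    (c + 2 * Real.pi * Complex.I * ν : ℂ) ≠ 0 := by
  intro h
  have := congrArg Complex.re h
  simp at this
  linarith

/-- The polynomial on the left is the Taylor polynomial of e^{-(1+c)u} of degree below M, so the two
pieces agree to order M at 0. With p = 2πiν and q = (1+c)/(1-p), the right half-line contributes
1/(c+p) and the left one the geometric sum ∑ q^j/(1-p) = (q^M - 1)/(c+p); only q^M/(c+p) remains. -/
theorem hasSum_expExtension_parts {c : ℂ} (hc : 0 < c.re) (M : ℕ) (ν : ℝ) :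
    Integrable (fun u : ℝ => Complex.exp (-2 * Real.pi * Complex.I * u * ν) * expExtension c M u) ∧
    ∫ u : ℝ, Complex.exp (-2 * Real.pi * Complex.I * u * ν) * expExtension c M u =
      extensionSymbol c M ν := by
  set p : ℂ := 2 * Real.pi * Complex.I * ν with hp
  have hre : (c + p).re = c.re := by simp [hp]
  have hre1 : (1 - p).re = 1 := by simp [hp]
  have hcp : c + p ≠ 0 := add_imag_ne_zero hc ν
  have h1p : 1 - p ≠ 0 := one_sub_ne_zero' ν
  have e1 : EqOn (fun u : ℝ => Complex.exp (-2 * Real.pi * Complex.I * u * ν) * expExtension c M u)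
      (fun u : ℝ => (u : ℂ) ^ 0 * Complex.exp (-(c + p) * u)) (Ioi 0) := by
    intro u hu
    have hu' : (0 : ℝ) ≤ u := le_of_lt (mem_Ioi.1 hu)
    simp only [expExtension, if_pos hu', pow_zero, one_mul]
    rw [← Complex.exp_add]
    congr 1
    rw [hp]; ring
  have e2 : EqOn (fun u : ℝ => Complex.exp (-2 * Real.pi * Complex.I * (-u : ℝ) * ν) *
      expExtension c M (-u))
      (fun u : ℝ => ∑ j ∈ Finset.range M, (1 + c) ^ j / j.factorial *
        ((u : ℂ) ^ j * Complex.exp (-(1 - p) * u))) (Ioi 0) := by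
    intro u hu
    have hu' : ¬ 0 ≤ -u := by
      have : (0 : ℝ) < u := hu
      linarith
    simp only [expExtension, if_neg hu']
    rw [← mul_assoc, ← Complex.exp_add, Finset.mul_sum]
    refine Finset.sum_congr rfl fun j _ => ?_
    rw [mul_pow]
    push_cast
    rw [show (-2 * Real.pi * Complex.I * -(u : ℂ) * ν + -(u : ℂ)) = -(1 - p) * u by rw [hp]; ring]
    ring
  have i1 := (integrableOn_congr_fun e1 measurableSet_Ioi).2
    (integrableOn_pow_mul_cexp (r := c + p) (by rw [hre]; exact hc) 0)
  have i2' : ∀ j ∈ Finset.range M, Integrable (fun u : ℝ => (1 + c) ^ j / j.factorial *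
        ((u : ℂ) ^ j * Complex.exp (-(1 - p) * u))) (volume.restrict (Ioi 0)) := fun j _ =>
    (integrableOn_pow_mul_cexp (r := 1 - p) (by rw [hre1]; exact one_pos) j).const_mul _
  have i2 := (integrableOn_congr_fun e2 measurableSet_Ioi).2 (integrable_finsetSum _ i2')
  have i3 : IntegrableOn (fun u : ℝ => Complex.exp (-2 * Real.pi * Complex.I * u * ν) *
      expExtension c M u) (Iic 0) := by
    rw [← integrableOn_Ici_iff_integrableOn_Ioi] at i2
    have := i2.comp_neg
    simpa using this
  constructor
  · rw [← integrableOn_univ, ← Iic_union_Ioi (a := (0 : ℝ))]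
    exact i3.union i1
  · rw [← intervalIntegral.integral_Iic_add_Ioi (b := (0:ℝ)) i3 i1,
      setIntegral_congr_fun measurableSet_Ioi e1,
      integral_pow_mul_cexp (r := c + p) (by rw [hre]; exact hc) 0]
    have h4 := integral_comp_neg_Ioi (0 : ℝ)
      (fun u : ℝ => Complex.exp (-2 * Real.pi * Complex.I * u * ν) * expExtension c M u)
    rw [neg_zero] at h4
    rw [← h4, setIntegral_congr_fun measurableSet_Ioi e2, integral_finsetSum _ i2']
    simp_rw [integral_const_mul]
    have h5 : ∀ j ∈ Finset.range M, (1 + c) ^ j / (j.factorial : ℂ) *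
        ∫ u in Ioi (0 : ℝ), (u : ℂ) ^ j * Complex.exp (-(1 - p) * u) =
        ((1 + c) / (1 - p)) ^ j / (1 - p) := by
      intro j _
      rw [integral_pow_mul_cexp (r := 1 - p) (by rw [hre1]; exact one_pos) j, div_pow]
      have : (j.factorial : ℂ) ≠ 0 := by exact_mod_cast j.factorial_ne_zero
      field_simp
      ring
    rw [Finset.sum_congr rfl h5, ← Finset.sum_div]
    have hq : (1 + c) / (1 - p) ≠ 1 := by
      intro h
      rw [div_eq_one_iff_eq h1p] at h
      apply hcp
      linear_combination h
    rw [geom_sum_eq hq]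
    unfold extensionSymbol
    have hq' : (1 + c) / (1 - p) - 1 = (c + p) / (1 - p) := by
      field_simp; ring
    rw [hq', ← hp]
    simp
    field_simp
    ring

theorem continuous_extensionSymbol {c : ℂ} (hc : 0 < c.re) (M : ℕ) :
    Continuous (extensionSymbol c M) := by
  unfold extensionSymbol
  exact ((continuous_const.div (by fun_prop) one_sub_ne_zero').pow M).div (by fun_prop)
    (add_imag_ne_zero hc)

/-- The M-th power decays like |ν|^{-M} and the last denominator adds one more order; it stays away
from 0 because Re c > 0. -/
theorem norm_extensionSymbol_le {c : ℂ} (hc : 0 < c.re) (M : ℕ) :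
    ∃ K : ℝ, 0 < K ∧ ∀ ν : ℝ, ‖extensionSymbol c M ν‖ ≤ K / (1 + |ν|) ^ (M + 1) := by
  refine ⟨(2 * (1 + ‖c‖)) ^ M * (1 + (1 + ‖c‖) / c.re), by positivity, fun ν => ?_⟩
  have hp : ‖(2 * Real.pi * Complex.I * ν : ℂ)‖ = 2 * Real.pi * |ν| := by
    simp [abs_of_pos Real.pi_pos]
  have hpi := Real.pi_gt_three
  have ha := abs_nonneg ν
  have b1 : (1 + |ν|) / 2 ≤ ‖(1 - 2 * Real.pi * Complex.I * ν : ℂ)‖ := by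
    have h1 : 1 ≤ ‖(1 - 2 * Real.pi * Complex.I * ν : ℂ)‖ := by
      have := Complex.abs_re_le_norm (1 - 2 * Real.pi * Complex.I * ν : ℂ)
      simpa using this
    have h2 : 2 * Real.pi * |ν| - 1 ≤ ‖(1 - 2 * Real.pi * Complex.I * ν : ℂ)‖ := by
      have := norm_sub_norm_le (2 * Real.pi * Complex.I * ν : ℂ) 1
      rw [norm_sub_rev, hp, norm_one] at this
      exact this
    nlinarith
  have b2 : (1 + |ν|) ≤ (1 + (1 + ‖c‖) / c.re) * ‖(c + 2 * Real.pi * Complex.I * ν : ℂ)‖ := by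
    have h1 : c.re ≤ ‖(c + 2 * Real.pi * Complex.I * ν : ℂ)‖ := by
      have := Complex.abs_re_le_norm (c + 2 * Real.pi * Complex.I * ν : ℂ)
      have h := (le_abs_self _).trans this
      simpa using h
    have h2 : 2 * Real.pi * |ν| - ‖c‖ ≤ ‖(c + 2 * Real.pi * Complex.I * ν : ℂ)‖ := by
      have := norm_sub_norm_le (2 * Real.pi * Complex.I * ν : ℂ) (-c)
      rw [norm_neg, hp, sub_neg_eq_add, add_comm (2 * _ * _ * _ : ℂ)] at this
      exact this
    have h3 : 1 + ‖c‖ ≤ (1 + ‖c‖) / c.re * ‖(c + 2 * Real.pi * Complex.I * ν : ℂ)‖ := by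
      rw [div_mul_eq_mul_div, le_div_iff₀ hc]
      gcongr
    nlinarith
  have b3 : ‖1 + c‖ ≤ 1 + ‖c‖ := (norm_add_le _ _).trans (by simp)
  have p2 : 0 < ‖(c + 2 * Real.pi * Complex.I * ν : ℂ)‖ := norm_pos_iff.2 (add_imag_ne_zero hc ν)
  unfold extensionSymbol
  rw [norm_div, norm_pow, norm_div, pow_succ, ← div_div]
  rw [mul_div_right_comm, mul_div_assoc, ← div_pow]
  have q1 : ‖1 + c‖ / ‖(1 - 2 * Real.pi * Complex.I * ν : ℂ)‖ ≤ 2 * (1 + ‖c‖) / (1 + |ν|) := by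
    rw [div_le_div_iff₀ (norm_pos_iff.2 (one_sub_ne_zero' ν)) (by positivity)]
    nlinarith [norm_nonneg c]
  have q2 : 1 / ‖(c + 2 * Real.pi * Complex.I * ν : ℂ)‖ ≤ (1 + (1 + ‖c‖) / c.re) / (1 + |ν|) := by
    rw [div_le_div_iff₀ p2 (by positivity)]
    linarith
  rw [div_eq_mul_one_div]
  gcongr

theorem integrable_extensionSymbol {c : ℂ} (hc : 0 < c.re) {M : ℕ} (hM : 0 < M) :
    Integrable (extensionSymbol c M) := by
  obtain ⟨K, hK, hb⟩ := norm_extensionSymbol_le hc M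
  refine Integrable.mono' (integrable_inv_one_add_sq.const_mul K)
    (continuous_extensionSymbol hc M).aestronglyMeasurable (Eventually.of_forall fun ν => ?_)
  refine (hb ν).trans ?_
  rw [div_eq_mul_inv]
  gcongr
  have ha := abs_nonneg ν
  calc 1 + ν ^ 2 ≤ (1 + |ν|) ^ 2 := by nlinarith [sq_abs ν]
    _ ≤ (1 + |ν|) ^ (M + 1) := pow_le_pow_right₀ (by linarith) (by omega)

/-- Only the fixed slope c is extended. The exponential e^{-cμx} is reached by the scaling u = μx,
so that one symbol serves all frequencies. -/
theorem fourierInv_extensionSymbol {c : ℂ} (hc : 0 < c.re) {M : ℕ} (hM : 0 < M) {u : ℝ}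
    (hu : 0 ≤ u) : ∫ ν : ℝ, Complex.exp (2 * Real.pi * Complex.I * (ν * u)) * extensionSymbol c M ν =
      Complex.exp (-c * u) := by
  have hi : Integrable (expExtension c M) := by
    simpa using (hasSum_expExtension_parts hc M 0).1
  have hF : 𝓕 (expExtension c M) = extensionSymbol c M := by
    ext ν
    rw [Real.fourier_real_eq_integral_exp_smul, ← (hasSum_expExtension_parts hc M ν).2]
    congr with x
    rw [smul_eq_mul]
    congr 2
    push_cast; ring
  have := (continuous_expExtension c hM).fourierInv_fourier_eq hi
    (by rw [hF]; exact integrable_extensionSymbol hc hM)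
  have h2 := congrFun this u
  rw [hF, Real.fourierInv_eq'] at h2
  rw [show Complex.exp (-c * u) = expExtension c M u by simp [expExtension, hu], ← h2]
  congr with ν
  rw [smul_eq_mul]
  congr 2
  simp
  ring

end

/-! ### Decaying modes: from order (2s+3)/8 in time to order s in space -/

noncomputable section

theorem weightedENorm_sq (σ : ℝ) (F : ℝ → ℂ) :
    weightedENorm σ F ^ 2 = ∫⁻ ξ, ‖(sobolevWeight σ ξ : ℂ) * F ξ‖ₑ ^ 2 := by
  have := eLpNorm_nnreal_pow_eq_lintegral (f := fun ξ => (sobolevWeight σ ξ : ℂ) * F ξ)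
    (μ := volume) (p := 2) (by norm_num)
  simp only [NNReal.coe_ofNat, ENNReal.coe_ofNat] at this
  unfold weightedENorm
  exact_mod_cast this

theorem lintegral_even {f : ℝ → ℝ≥0∞} (hf : ∀ x, f (-x) = f x) :
    ∫⁻ x, f x = 2 * ∫⁻ x in Ioi (0 : ℝ), f x := by
  rw [← lintegral_add_compl f (measurableSet_Ioi (a := (0 : ℝ))), two_mul]
  congr 1
  rw [compl_Ioi, ← Measure.restrict_congr_set (Iio_ae_eq_Iic (μ := volume) (a := (0 : ℝ)))]
  have := (Measure.measurePreserving_neg (volume : Measure ℝ)).setLIntegral_comp_preimage_emb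
    (MeasurableEquiv.neg ℝ).measurableEmbedding f (Iio 0)
  simp only [hf] at this
  rw [← this]
  congr 2
  ext x
  simp

/-- The kernel dominating the extension operator between the weighted spaces. -/
def dominatingKernel (η ξ : ℝ) : ℝ :=
  rootModulus ξ ^ (-3 / 2 : ℝ) / (rootModulus ξ + |η|)

theorem measurable_dominatingKernel : Measurable (fun z : ℝ × ℝ => dominatingKernel z.1 z.2) := by
  unfold dominatingKernel
  have := continuous_rootModulus.measurable
  fun_prop

/-- The Schur weights are μ^{-2} in ξ and |η|^{-1/2} in η. With dξ ~ y³dy the powers combine to y^{3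
- 3/2 - 2} = y^{-1/2}, which is the integral of `lintegral_Ioi_rpow_div_add_le`. -/
theorem lintegral_dominatingKernel_left {η : ℝ} (hη : η ≠ 0) :
    ∫⁻ ξ in Ioi (0 : ℝ), ENNReal.ofReal (dominatingKernel η ξ) *
      ENNReal.ofReal (rootModulus ξ ^ (-2 : ℝ)) ≤ 16 * ENNReal.ofReal (|η| ^ (-1 / 2 : ℝ)) := by
  rw [lintegral_Ioi_quartic]
  have hη' := abs_pos.2 hη
  calc _ ≤ ∫⁻ y in Ioi (0 : ℝ), 4 * ENNReal.ofReal (y ^ (-1 / 2 : ℝ) / (y + |η|)) := by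
        refine setLIntegral_mono' measurableSet_Ioi fun y hy => ?_
        have hy : (0 : ℝ) < y := hy
        have h2 : y ≤ 2 * Real.pi * y := by nlinarith [Real.pi_gt_three]
        have h0 : 0 < 2 * Real.pi * y := by positivity
        unfold dominatingKernel
        rw [rootModulus_quartic hy.le, ← ENNReal.ofReal_mul (by positivity),
          ← ENNReal.ofReal_mul (by positivity), show (4 : ℝ≥0∞) = ENNReal.ofReal 4 by simp,
          ← ENNReal.ofReal_mul (by positivity)]
        apply ENNReal.ofReal_le_ofReal
        have e : 4 * (2 * Real.pi) ^ 3 * y ^ 3 * ((2 * Real.pi * y) ^ (-3 / 2 : ℝ) /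
            (2 * Real.pi * y + |η|) * (2 * Real.pi * y) ^ (-2 : ℝ)) =
            4 * ((2 * Real.pi * y) ^ (-1 / 2 : ℝ) / (2 * Real.pi * y + |η|)) := by
          have : (2 * Real.pi * y) ^ (3 : ℝ) * ((2 * Real.pi * y) ^ (-3 / 2 : ℝ) *
              (2 * Real.pi * y) ^ (-2 : ℝ)) = (2 * Real.pi * y) ^ (-1 / 2 : ℝ) := by
            rw [← Real.rpow_add h0, ← Real.rpow_add h0]
            norm_num
          rw [← this, show (2 * Real.pi * y) ^ (3 : ℝ) = (2 * Real.pi * y) ^ (3 : ℕ) by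
            rw [← Real.rpow_natCast]; norm_num]
          ring
        rw [e]
        -- The remaining factors 2π are discarded using 2π ≥ 1.
        gcongr 4 * (?_ / ?_)
        · exact Real.rpow_le_rpow_of_nonpos hy h2 (by norm_num)
        · linarith
    _ ≤ 4 * ENNReal.ofReal (4 * |η| ^ (-1 / 2 : ℝ)) := by
        rw [lintegral_const_mul _ (by fun_prop)]
        gcongr
        exact lintegral_Ioi_rpow_div_add_le hη'
    _ = _ := by
        rw [ENNReal.ofReal_mul (by norm_num), ← mul_assoc]
        norm_num

theorem lintegral_dominatingKernel_right {ξ : ℝ} (hξ : 0 < ξ) :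
    ∫⁻ η : ℝ, ENNReal.ofReal (dominatingKernel η ξ) * ENNReal.ofReal (|η| ^ (-1 / 2 : ℝ)) ≤
      16 * ENNReal.ofReal (rootModulus ξ ^ (-2 : ℝ)) := by
  have hm := rootModulus_pos hξ.ne'
  rw [lintegral_even (by intro η; simp [dominatingKernel])]
  calc _ = 2 * ∫⁻ η in Ioi (0 : ℝ), ENNReal.ofReal (rootModulus ξ ^ (-3 / 2 : ℝ)) *
        ENNReal.ofReal (η ^ (-1 / 2 : ℝ) / (η + rootModulus ξ)) := by
        congr 1
        refine setLIntegral_congr_fun measurableSet_Ioi fun η hη => ?_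
        have hη : (0 : ℝ) < η := hη
        simp only [dominatingKernel]
        rw [← ENNReal.ofReal_mul (by positivity), ← ENNReal.ofReal_mul (by positivity),
          abs_of_pos hη, add_comm η]
        congr 1
        ring
    _ ≤ 2 * (ENNReal.ofReal (rootModulus ξ ^ (-3 / 2 : ℝ)) *
        ENNReal.ofReal (4 * rootModulus ξ ^ (-1 / 2 : ℝ))) := by
        rw [lintegral_const_mul _ (by fun_prop)]
        gcongr
        exact lintegral_Ioi_rpow_div_add_le hm
    _ = 8 * ENNReal.ofReal (rootModulus ξ ^ (-2 : ℝ)) := by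
        rw [← ENNReal.ofReal_mul (by positivity), mul_left_comm, ← Real.rpow_add hm,
          ENNReal.ofReal_mul (by norm_num), ← mul_assoc]
        norm_num
    _ ≤ _ := by gcongr; norm_num

/-- This is where the order (2s+3)/8 arises: s + 3/2 = 4 · (2s+3)/8, with 3/2 coming from the square
root of the Jacobian μ³. Since μ⁸ = τ², the claim is a power of (1+μ)⁸ ≤ 2⁷(1+μ⁸). -/
theorem one_add_rootModulus_rpow_le {s : ℝ} (hs : 0 ≤ s) (ξ : ℝ) :
    (1 + rootModulus ξ) ^ (s + 3 / 2) ≤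
      128 ^ ((2 * s + 3) / 16) * sobolevWeight ((2 * s + 3) / 8) ξ := by
  have hm := rootModulus_nonneg ξ
  unfold sobolevWeight
  rw [show (2 * s + 3) / 8 / 2 = (2 * s + 3) / 16 by ring,
    ← Real.mul_rpow (by norm_num) (by positivity),
    show s + 3 / 2 = (8 : ℕ) * ((2 * s + 3) / 16) by push_cast; ring,
    Real.rpow_mul (by positivity), Real.rpow_natCast]
  apply Real.rpow_le_rpow (by positivity) _ (by positivity)
  have h1 := add_pow_le zero_le_one hm 8
  have h2 : rootModulus ξ ^ 8 = (2 * Real.pi * ξ) ^ 2 := by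
    rw [show rootModulus ξ ^ 8 = (rootModulus ξ ^ 4) ^ 2 by ring, rootModulus_pow_four, mul_pow,
      sq_abs, ← mul_pow]
  rw [h2] at h1
  norm_num at h1 ⊢
  exact h1

theorem sobolevWeight_le_rpow {s : ℝ} (hs : 0 ≤ s) (η : ℝ) :
    sobolevWeight s η ≤ (2 * Real.pi) ^ s * (1 + |η|) ^ s := by
  unfold sobolevWeight
  rw [← Real.mul_rpow (by positivity) (by positivity)]
  have : (2 * Real.pi * (1 + |η|)) ^ s = ((2 * Real.pi * (1 + |η|)) ^ 2) ^ (s / 2) := by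
    rw [← Real.rpow_natCast, ← Real.rpow_mul (by positivity)]
    congr 1; push_cast; ring
  rw [this]
  apply Real.rpow_le_rpow (by positivity) _ (by positivity)
  have h1 : 1 ≤ 2 * Real.pi := by linarith [Real.pi_gt_three]
  have := abs_nonneg η
  calc 1 + (2 * Real.pi * η) ^ 2 ≤ (2 * Real.pi) ^ 2 + (2 * Real.pi * |η|) ^ 2 := by
        rw [mul_pow _ |η|, sq_abs, ← mul_pow]
        gcongr
        nlinarith
    _ ≤ _ := by nlinarith [mul_nonneg (sq_nonneg (2 * Real.pi)) this]

/-- By 1 + |η| ≤ (1+μ)(1+|η|/μ), s of the orders of decay of the symbol absorb the weight in η and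
one more produces 1/(μ+|η|). What is left, (1+μ)^s ≤ μ^{-3/2}(1+μ)^{s+3/2}, is paid for by the
weight in ξ. -/
theorem weighted_extensionKernel_le {s : ℝ} (hs : 0 ≤ s) {c : ℂ} (hc : 0 < c.re) {M : ℕ}
    (hM : s ≤ M) : ∃ C : ℝ≥0, ∀ η ξ : ℝ, 0 < ξ →
      sobolevWeight s η * ‖extensionSymbol c M (η / rootModulus ξ) / rootModulus ξ‖ ≤
        C * (dominatingKernel η ξ * sobolevWeight ((2 * s + 3) / 8) ξ) := by
  obtain ⟨K, hK, hb⟩ := norm_extensionSymbol_le hc M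
  refine ⟨((2 * Real.pi) ^ s * K * 128 ^ ((2 * s + 3) / 16)).toNNReal, fun η ξ hξ => ?_⟩
  have hm := rootModulus_pos hξ.ne'
  set m := rootModulus ξ with hm_def
  have hν : |η / m| = |η| / m := by rw [abs_div, abs_of_pos hm]
  have hη := abs_nonneg η
  have h1 : ‖extensionSymbol c M (η / m)‖ ≤ K / (1 + |η| / m) ^ (s + 1) := by
    refine (hb _).trans ?_
    rw [hν]
    gcongr
    rw [← Real.rpow_natCast]
    apply Real.rpow_le_rpow_of_exponent_le
    · linarith [div_nonneg hη hm.le]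
    · push_cast; linarith
  have h2 : (1 + |η|) ^ s ≤ (1 + m) ^ s * (1 + |η| / m) ^ s := by
    rw [← Real.mul_rpow (by positivity) (by positivity)]
    apply Real.rpow_le_rpow (by positivity) _ hs
    have : (1 + m) * (1 + |η| / m) = 1 + |η| + m + |η| / m := by field_simp; ring
    rw [this]
    linarith [div_nonneg hη hm.le]
  have h3 : (1 + m) ^ s ≤ m ^ (-3 / 2 : ℝ) *
      (128 ^ ((2 * s + 3) / 16) * sobolevWeight ((2 * s + 3) / 8) ξ) := by
    refine le_trans ?_ (mul_le_mul_of_nonneg_left (one_add_rootModulus_rpow_le hs ξ)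
      (by positivity))
    rw [← hm_def, Real.rpow_add (by positivity)]
    have : 1 ≤ m ^ (-3 / 2 : ℝ) * (1 + m) ^ (3 / 2 : ℝ) := by
      rw [show (-3 / 2 : ℝ) = -(3 / 2) by norm_num, Real.rpow_neg hm.le,
        inv_mul_eq_div, one_le_div (by positivity)]
      exact Real.rpow_le_rpow hm.le (by linarith) (by norm_num)
    nlinarith [show 0 < (1 + m) ^ s by positivity]
  rw [norm_div, Complex.norm_real, Real.norm_of_nonneg hm.le]
  have h4 : (1 + |η| / m) ^ (s + 1) = (1 + |η| / m) ^ s * (1 + |η| / m) := by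
    rw [Real.rpow_add (by positivity), Real.rpow_one]
  have h5 : (1 + |η| / m) * m = m + |η| := by field_simp
  calc sobolevWeight s η * (‖extensionSymbol c M (η / m)‖ / m)
      ≤ ((2 * Real.pi) ^ s * ((1 + m) ^ s * (1 + |η| / m) ^ s)) *
          (K / (1 + |η| / m) ^ (s + 1) / m) := by
        gcongr
        exact (sobolevWeight_le_rpow hs η).trans (by gcongr)
    _ = (2 * Real.pi) ^ s * K * ((1 + m) ^ s / (m + |η|)) := by
        rw [h4, ← h5]
        have : (1 + |η| / m) ^ s ≠ 0 := by positivity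
        field_simp
    _ ≤ (2 * Real.pi) ^ s * K * (m ^ (-3 / 2 : ℝ) *
      (128 ^ ((2 * s + 3) / 16) * sobolevWeight ((2 * s + 3) / 8) ξ) / (m + |η|)) := by gcongr
    _ = _ := by
        rw [Real.coe_toNNReal _ (by positivity)]
        simp only [dominatingKernel, ← hm_def]
        ring

/-- The Fourier side of an extension to the line of `x ↦ ∫_{ξ>0} e^{-cμ(ξ)x} F(ξ) dξ`, `x > 0`. -/
def extensionOperator (c : ℂ) (M : ℕ) (F : ℝ → ℂ) (η : ℝ) : ℂ :=
  ∫ ξ in Ioi (0 : ℝ), extensionSymbol c M (η / rootModulus ξ) / rootModulus ξ * F ξ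

theorem measurable_extensionKernel {c : ℂ} (hc : 0 < c.re) (M : ℕ) :
    Measurable fun z : ℝ × ℝ =>
      extensionSymbol c M (z.1 / rootModulus z.2) / (rootModulus z.2 : ℂ) := by
  have h1 := continuous_rootModulus.measurable
  have h2 := (continuous_extensionSymbol hc M).measurable
  fun_prop

/-- The absolute values are kept inside the integral, so the same Schur estimate gives both the
bound on the operator and the almost everywhere convergence of its defining integral. -/
theorem lintegral_extensionKernel_sq_le {s : ℝ} (hs : 0 ≤ s) {c : ℂ} (hc : 0 < c.re) {M : ℕ}
    (hM : s ≤ M) : ∃ C : ℝ≥0, ∀ F : ℝ → ℂ, Measurable F →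
      ∫⁻ η, (ENNReal.ofReal (sobolevWeight s η) * ∫⁻ ξ in Ioi (0 : ℝ),
        ‖extensionSymbol c M (η / rootModulus ξ) / rootModulus ξ * F ξ‖ₑ) ^ 2 ≤
        C ^ 2 * weightedENorm ((2 * s + 3) / 8) F ^ 2 := by
  obtain ⟨C, hC⟩ := weighted_extensionKernel_le hs hc hM
  refine ⟨C * 16, fun F hF => ?_⟩
  have hw : Measurable fun ξ => ‖(sobolevWeight ((2 * s + 3) / 8) ξ : ℂ) * F ξ‖ₑ :=
    ((Complex.measurable_ofReal.comp (continuous_sobolevWeight _).measurable).mul hF).enorm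
  have schur := lintegral_schur_sq_le (μ := volume.restrict (Ioi (0 : ℝ))) (ν := volume)
    (k := fun η ξ => ENNReal.ofReal (dominatingKernel η ξ))
    (p := fun ξ => ENNReal.ofReal (rootModulus ξ ^ (-2 : ℝ)))
    (f := fun ξ => ‖(sobolevWeight ((2 * s + 3) / 8) ξ : ℂ) * F ξ‖ₑ)
    (q := fun η => ENNReal.ofReal (|η| ^ (-1 / 2 : ℝ)))
    measurable_dominatingKernel.ennreal_ofReal
    (by have := continuous_rootModulus.measurable; fun_prop) hw (by fun_prop)
    (by filter_upwards [ae_restrict_mem measurableSet_Ioi] with ξ hξ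
        have hξ : (0 : ℝ) < ξ := hξ
        have := rootModulus_pos hξ.ne'
        simp only [ne_eq, ENNReal.ofReal_eq_zero, not_le]
        positivity)
    (by simp) (C := 16)
    (by filter_upwards [compl_mem_ae_iff.2 (measure_singleton (0 : ℝ))] with η hη
        exact lintegral_dominatingKernel_left hη)
    (by filter_upwards [ae_restrict_mem measurableSet_Ioi] with ξ hξ
        exact lintegral_dominatingKernel_right hξ)
  calc _ ≤ ∫⁻ η, (C * ∫⁻ ξ in Ioi (0 : ℝ), ENNReal.ofReal (dominatingKernel η ξ) *
        ‖(sobolevWeight ((2 * s + 3) / 8) ξ : ℂ) * F ξ‖ₑ) ^ 2 := by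
        refine lintegral_mono fun η => ?_
        refine pow_le_pow_left' ?_ 2
        rw [← lintegral_const_mul' _ _ ENNReal.ofReal_ne_top,
          ← lintegral_const_mul' _ _ ENNReal.coe_ne_top]
        refine setLIntegral_mono' measurableSet_Ioi fun ξ hξ => ?_
        have h := hC η ξ hξ
        rw [enorm_mul, enorm_mul, ← mul_assoc, ← mul_assoc, ← mul_assoc]
        refine mul_le_mul' ?_ le_rfl
        rw [← ofReal_norm, ← ofReal_norm, Complex.norm_real,
          Real.norm_of_nonneg (sobolevWeight_pos _ _).le,
          ← ENNReal.ofReal_mul (sobolevWeight_pos _ _).le, mul_assoc,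
          ← ENNReal.ofReal_mul (by unfold dominatingKernel; have := rootModulus_nonneg ξ; positivity),
          ← ENNReal.ofReal_coe_nnreal, ← ENNReal.ofReal_mul (by positivity)]
        exact ENNReal.ofReal_le_ofReal h
    _ = (C : ℝ≥0∞) ^ 2 * ∫⁻ η, (∫⁻ ξ in Ioi (0 : ℝ), ENNReal.ofReal (dominatingKernel η ξ) *
        ‖(sobolevWeight ((2 * s + 3) / 8) ξ : ℂ) * F ξ‖ₑ) ^ 2 := by
        simp_rw [mul_pow]
        rw [lintegral_const_mul' _ _ (by simp)]
    _ ≤ (C : ℝ≥0∞) ^ 2 * (16 ^ 2 * ∫⁻ ξ in Ioi (0 : ℝ),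
        ‖(sobolevWeight ((2 * s + 3) / 8) ξ : ℂ) * F ξ‖ₑ ^ 2) := by gcongr
    _ ≤ (C : ℝ≥0∞) ^ 2 * (16 ^ 2 * weightedENorm ((2 * s + 3) / 8) F ^ 2) := by
        rw [weightedENorm_sq]
        gcongr
        exact Measure.restrict_le_self
    _ = _ := by push_cast; ring

theorem measurable_extensionOperator {c : ℂ} (hc : 0 < c.re) (M : ℕ) {F : ℝ → ℂ}
    (hF : Measurable F) : Measurable (extensionOperator c M F) :=
  (StronglyMeasurable.integral_prod_right (ν := volume.restrict (Ioi (0 : ℝ)))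
    (f := fun η ξ => extensionSymbol c M (η / rootModulus ξ) / rootModulus ξ * F ξ)
    ((measurable_extensionKernel hc M).mul (hF.comp measurable_snd)).stronglyMeasurable).measurable

theorem weightedENorm_extensionOperator_le {s : ℝ} (hs : 0 ≤ s) {c : ℂ} (hc : 0 < c.re) {M : ℕ}
    (hM : s ≤ M) : ∃ C : ℝ≥0, ∀ F : ℝ → ℂ, Measurable F →
      weightedENorm s (extensionOperator c M F) ≤ C * weightedENorm ((2 * s + 3) / 8) F := by
  obtain ⟨C, hC⟩ := lintegral_extensionKernel_sq_le hs hc hM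
  refine ⟨C, fun F hF => ?_⟩
  rw [← ENNReal.pow_le_pow_left_iff (n := 2) (by norm_num), mul_pow]
  refine le_trans ?_ (hC F hF)
  rw [weightedENorm_sq]
  gcongr with η
  rw [enorm_mul]
  gcongr
  · rw [← ofReal_norm, Complex.norm_real, Real.norm_of_nonneg (sobolevWeight_pos _ _).le]
  · exact enorm_integral_le_lintegral_enorm _

/-- A divergent Bochner integral has the value 0, so the operator is additive only where its
integral converges. -/
theorem integrable_extensionKernel_mul {s : ℝ} (hs : 0 ≤ s) {c : ℂ} (hc : 0 < c.re) {M : ℕ}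
    (hM : s ≤ M) {F : ℝ → ℂ} (hF : Measurable F) (hfin : weightedENorm ((2 * s + 3) / 8) F < ⊤) :
    ∀ᵐ η : ℝ, IntegrableOn
      (fun ξ => extensionSymbol c M (η / rootModulus ξ) / rootModulus ξ * F ξ) (Ioi 0) := by
  obtain ⟨C, hC⟩ := lintegral_extensionKernel_sq_le hs hc hM
  have hlt := (hC F hF).trans_lt (ENNReal.mul_lt_top (by simp) (ENNReal.pow_lt_top hfin))
  have hmeas : Measurable fun z : ℝ × ℝ =>
      extensionSymbol c M (z.1 / rootModulus z.2) / rootModulus z.2 * F z.2 :=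
    (measurable_extensionKernel hc M).mul (hF.comp measurable_snd)
  have := ae_lt_top' (((continuous_sobolevWeight s).measurable.ennreal_ofReal.mul
    (hmeas.enorm.lintegral_prod_right' (ν := volume.restrict (Ioi (0 : ℝ))))).pow_const
      2).aemeasurable hlt.ne
  filter_upwards [this] with η hη
  refine ⟨(hmeas.comp measurable_prodMk_left).aestronglyMeasurable, ?_⟩
  by_contra h
  rw [HasFiniteIntegral, not_lt, top_le_iff] at h
  simp only [Pi.mul_apply] at hη
  rw [h, ENNReal.mul_top (by simpa using sobolevWeight_pos s η)] at hη
  simp at hη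

/-- Fubini, then the scaling η = μν and Fourier inversion for the extended exponential. Fubini needs
F integrable, which is why waves are first truncated in frequency. -/
theorem invFourierL2_extensionOperator {c : ℂ} (hc : 0 < c.re) {M : ℕ}
    (hM : 0 < M) {F : ℝ → ℂ} (hF : Measurable F) (hi : Integrable F)
    (hL : MemLp (extensionOperator c M F) 2) :
    ∀ᵐ x ∂(volume.restrict (Ioi (0 : ℝ))), invFourierL2 (extensionOperator c M F) x =
      ∫ ξ in Ioi (0 : ℝ), Complex.exp (-c * rootModulus ξ * x) * F ξ := by
  have hk := integrable_extensionSymbol hc hM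
  have hmeas : Measurable fun z : ℝ × ℝ =>
      extensionSymbol c M (z.1 / rootModulus z.2) / rootModulus z.2 * F z.2 :=
    (measurable_extensionKernel hc M).mul (hF.comp measurable_snd)
  have hprod : Integrable (fun z : ℝ × ℝ =>
      extensionSymbol c M (z.1 / rootModulus z.2) / rootModulus z.2 * F z.2)
      ((volume : Measure ℝ).prod (volume.restrict (Ioi (0 : ℝ)))) := by
    rw [integrable_prod_iff' hmeas.aestronglyMeasurable]
    constructor
    · filter_upwards [ae_restrict_mem measurableSet_Ioi] with ξ hξ
      have hm := rootModulus_pos (ne_of_gt hξ)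
      exact ((hk.comp_div hm.ne').div_const _).mul_const _
    -- The scaled kernel has the same L¹ norm in η for every ξ > 0.
    · refine ((hi.norm.const_mul (∫ ν, ‖extensionSymbol c M ν‖)).restrict
        (s := Ioi (0 : ℝ))).congr ?_
      filter_upwards [ae_restrict_mem measurableSet_Ioi] with ξ hξ
      have hm := rootModulus_pos (ne_of_gt hξ)
      simp only [norm_mul, norm_div, Complex.norm_real, Real.norm_of_nonneg hm.le]
      rw [integral_mul_const, integral_div, Measure.integral_comp_div
        (fun y => ‖extensionSymbol c M y‖) (rootModulus ξ), abs_of_pos hm, smul_eq_mul]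
      field_simp
  have hV : Integrable (extensionOperator c M F) := hprod.integral_prod_left
  filter_upwards [ae_restrict_of_ae (invFourierL2_ae_eq hV hL),
    ae_restrict_mem measurableSet_Ioi] with x hx hx0
  rw [hx, Real.fourierInv_eq']
  have hx0 : (0 : ℝ) < x := hx0
  have hexp : Integrable (fun z : ℝ × ℝ => Complex.exp (2 * Real.pi * Complex.I * (z.1 * x)) *
      (extensionSymbol c M (z.1 / rootModulus z.2) / rootModulus z.2 * F z.2))
      ((volume : Measure ℝ).prod (volume.restrict (Ioi (0 : ℝ)))) := by
    refine hprod.bdd_mul (c := 1) (Continuous.aestronglyMeasurable (by fun_prop))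
      (Eventually.of_forall fun z => ?_)
    rw [Complex.norm_exp]
    simp
  calc _ = ∫ η : ℝ, ∫ ξ in Ioi (0 : ℝ), Complex.exp (2 * Real.pi * Complex.I * (η * x)) *
      (extensionSymbol c M (η / rootModulus ξ) / rootModulus ξ * F ξ) := by
        congr with η
        rw [integral_const_mul, smul_eq_mul]
        congr 2
        simp; ring
    _ = ∫ ξ in Ioi (0 : ℝ), ∫ η : ℝ, Complex.exp (2 * Real.pi * Complex.I * (η * x)) *
      (extensionSymbol c M (η / rootModulus ξ) / rootModulus ξ * F ξ) :=
        integral_integral_swap hexp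
    _ = _ := by
        refine setIntegral_congr_fun measurableSet_Ioi fun ξ hξ => ?_
        have hm := rootModulus_pos (ne_of_gt hξ)
        have h1 := Measure.integral_comp_div (fun ν : ℝ => Complex.exp (2 * Real.pi * Complex.I *
          (ν * (rootModulus ξ * x : ℝ))) * extensionSymbol c M ν) (rootModulus ξ)
        rw [fourierInv_extensionSymbol hc hM (by positivity), abs_of_pos hm] at h1
        have h2 : ∀ η : ℝ, Complex.exp (2 * Real.pi * Complex.I * (η * x)) *
          (extensionSymbol c M (η / rootModulus ξ) / rootModulus ξ * F ξ) =
          (Complex.exp (2 * Real.pi * Complex.I * ((η / rootModulus ξ : ℝ) *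
            (rootModulus ξ * x : ℝ))) * extensionSymbol c M (η / rootModulus ξ)) *
            (F ξ / rootModulus ξ) := by
          intro η
          have hm' : (rootModulus ξ : ℂ) ≠ 0 := by exact_mod_cast hm.ne'
          push_cast
          rw [show (η : ℂ) / rootModulus ξ * (rootModulus ξ * x) = η * x by field_simp]
          field_simp
        simp_rw [h2]
        rw [integral_mul_const, h1, Complex.real_smul]
        have hm' : (rootModulus ξ : ℂ) ≠ 0 := by exact_mod_cast hm.ne'
        push_cast
        rw [show -c * (rootModulus ξ * x) = -c * rootModulus ξ * x by ring]
        field_simp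

end

/-! ### Oscillating modes, and extension operators for both signs of frequency -/

noncomputable section

theorem lintegral_Iio_eq (f : ℝ → ℝ≥0∞) :
    ∫⁻ x in Iio (0 : ℝ), f x = ∫⁻ x in Ioi (0 : ℝ), f (-x) := by
  have := (Measure.measurePreserving_neg (volume : Measure ℝ)).setLIntegral_comp_preimage_emb
    (MeasurableEquiv.neg ℝ).measurableEmbedding f (Iio 0)
  rw [← this]
  congr 2
  ext x
  simp

/-- The Fourier side of the function `x ↦ ∫_{ξ>0} e^{-iμ(ξ)x} F(ξ) dξ` on the line. -/
def oscillatoryOperator (F : ℝ → ℂ) : ℝ → ℂ :=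
  (Iio 0).indicator fun η => ((4 * (2 * Real.pi) ^ 3 * (-η) ^ 3 : ℝ) : ℂ) *
    F ((2 * Real.pi) ^ 3 * (-η) ^ 4)

theorem measurable_oscillatoryOperator {F : ℝ → ℂ} (hF : Measurable F) :
    Measurable (oscillatoryOperator F) := by
  unfold oscillatoryOperator
  exact Measurable.indicator (by fun_prop) measurableSet_Iio

theorem weightedENorm_oscillatoryOperator_le {s : ℝ} (hs : 0 ≤ s) :
    ∃ C : ℝ≥0, ∀ F : ℝ → ℂ, 
      weightedENorm s (oscillatoryOperator F) ≤ C * weightedENorm ((2 * s + 3) / 8) F := by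
  -- The factor 2 is the square root of the 4 in the Jacobian 4m³, m = 2πη; the power of 128 is the
  -- constant of `one_add_rootModulus_rpow_le`.
  refine ⟨(2 * 128 ^ ((2 * s + 3) / 16) : ℝ).toNNReal, fun F => ?_⟩
  rw [← ENNReal.pow_le_pow_left_iff (n := 2) (by norm_num), mul_pow, weightedENorm_sq,
    weightedENorm_sq]
  calc ∫⁻ η, ‖(sobolevWeight s η : ℂ) * oscillatoryOperator F η‖ₑ ^ 2
      = ∫⁻ η in Iio (0 : ℝ), ‖(sobolevWeight s η : ℂ) * (((4 * (2 * Real.pi) ^ 3 * (-η) ^ 3 : ℝ) : ℂ)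
          * F ((2 * Real.pi) ^ 3 * (-η) ^ 4))‖ₑ ^ 2 := by
        rw [← lintegral_indicator measurableSet_Iio]
        congr with η
        unfold oscillatoryOperator
        by_cases h : η ∈ Iio (0 : ℝ) <;> simp [h]
    _ = ∫⁻ η in Ioi (0 : ℝ), ‖(sobolevWeight s (-η) : ℂ) * (((4 * (2 * Real.pi) ^ 3 * η ^ 3 : ℝ) : ℂ)
          * F ((2 * Real.pi) ^ 3 * η ^ 4))‖ₑ ^ 2 := by
        rw [lintegral_Iio_eq]; simp
    _ ≤ ∫⁻ η in Ioi (0 : ℝ), ENNReal.ofReal (4 * (2 * Real.pi) ^ 3 * η ^ 3) *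
        (((2 * 128 ^ ((2 * s + 3) / 16) : ℝ).toNNReal : ℝ≥0∞) ^ 2 *
        ‖(sobolevWeight ((2 * s + 3) / 8) ((2 * Real.pi) ^ 3 * η ^ 4) : ℂ) *
          F ((2 * Real.pi) ^ 3 * η ^ 4)‖ₑ ^ 2) := by
        refine setLIntegral_mono' measurableSet_Ioi fun η hη => ?_
        have hη : (0 : ℝ) < η := hη
        set w := sobolevWeight ((2 * s + 3) / 8) ((2 * Real.pi) ^ 3 * η ^ 4) with hw
        have hw0 : 0 < w := sobolevWeight_pos _ _
        have hm := one_add_rootModulus_rpow_le hs ((2 * Real.pi) ^ 3 * η ^ 4)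
        rw [rootModulus_quartic hη.le, ← hw] at hm
        set m := 2 * Real.pi * η with hm_def
        have hm0 : 0 < m := by positivity
        have e1 : 4 * (2 * Real.pi) ^ 3 * η ^ 3 = 4 * m ^ 3 := by rw [hm_def]; ring
        rw [e1, enorm_mul, enorm_mul, enorm_mul]
        have h1 : ∀ r : ℝ, 0 ≤ r → ‖(r : ℂ)‖ₑ = ENNReal.ofReal r := fun r hr => by
          rw [← ofReal_norm, Complex.norm_real, Real.norm_of_nonneg hr]
        rw [h1 _ (sobolevWeight_pos _ _).le, h1 _ (by positivity), h1 _ hw0.le]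
        simp only [mul_pow, ← mul_assoc]
        refine mul_le_mul' ?_ le_rfl
        rw [show (((2 * 128 ^ ((2 * s + 3) / 16) : ℝ).toNNReal : ℝ≥0∞)) =
          ENNReal.ofReal (2 * 128 ^ ((2 * s + 3) / 16)) from rfl,
          ← ENNReal.ofReal_pow (sobolevWeight_pos _ _).le, ← ENNReal.ofReal_pow (by positivity),
          ← ENNReal.ofReal_pow (by positivity), ← ENNReal.ofReal_pow hw0.le,
          ← ENNReal.ofReal_mul (by positivity), ← ENNReal.ofReal_mul (by positivity),
          ← ENNReal.ofReal_mul (by positivity)]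
        apply ENNReal.ofReal_le_ofReal
        have h2 : sobolevWeight s (-η) ≤ (1 + m) ^ s := by
          unfold sobolevWeight
          have : (1 + m) ^ s = ((1 + m) ^ 2) ^ (s / 2) := by
            rw [← Real.rpow_natCast, ← Real.rpow_mul (by positivity)]
            congr 1; push_cast; ring
          rw [this]
          apply Real.rpow_le_rpow (by positivity) _ (by positivity)
          rw [show 2 * Real.pi * -η = -m by rw [hm_def]; ring]
          nlinarith
        -- The squared norm contains the Jacobian twice. One copy turns dη back into dξ, the other
        -- is (m^{3/2})² up to the constant and joins the weight to form the power s + 3/2.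
        have h3 : m ^ 3 = (m ^ (3 / 2 : ℝ)) ^ 2 := by
          rw [← Real.rpow_natCast, ← Real.rpow_natCast, ← Real.rpow_mul hm0.le]
          norm_num
        have h4 : (1 + m) ^ s * m ^ (3 / 2 : ℝ) ≤ 128 ^ ((2 * s + 3) / 16) * w := by
          refine le_trans ?_ hm
          rw [Real.rpow_add (by positivity)]
          gcongr
          linarith
        calc sobolevWeight s (-η) ^ 2 * (4 * m ^ 3) ^ 2
            ≤ ((1 + m) ^ s) ^ 2 * (4 * m ^ 3) ^ 2 := by
              gcongr
              exact (sobolevWeight_pos _ _).le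
          _ = 4 * m ^ 3 * (4 * ((1 + m) ^ s * m ^ (3 / 2 : ℝ)) ^ 2) := by rw [h3]; ring
          _ ≤ 4 * m ^ 3 * (4 * (128 ^ ((2 * s + 3) / 16) * w) ^ 2) := by gcongr
          _ = _ := by ring
    _ = ∫⁻ ξ in Ioi (0 : ℝ), (((2 * 128 ^ ((2 * s + 3) / 16) : ℝ).toNNReal : ℝ≥0∞) ^ 2 *
        ‖(sobolevWeight ((2 * s + 3) / 8) ξ : ℂ) * F ξ‖ₑ ^ 2) := (lintegral_Ioi_quartic fun ξ =>
        (((2 * 128 ^ ((2 * s + 3) / 16) : ℝ).toNNReal : ℝ≥0∞) ^ 2 *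
        ‖(sobolevWeight ((2 * s + 3) / 8) ξ : ℂ) * F ξ‖ₑ ^ 2)).symm
    _ ≤ _ := by
        rw [lintegral_const_mul' _ _ (by simp)]
        gcongr
        exact Measure.restrict_le_self

/-- The function e^{-iμx} is the character of frequency η = -μ/(2π), so the quartic substitution
writes the superposition as an inverse Fourier transform supported on η < 0; no continuation past x
= 0 has to be constructed. -/
theorem invFourierL2_oscillatoryOperator {F : ℝ → ℂ} (hi : Integrable F)
    (hL : MemLp (oscillatoryOperator F) 2) :
    ∀ᵐ x ∂(volume.restrict (Ioi (0 : ℝ))), invFourierL2 (oscillatoryOperator F) x =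
      ∫ ξ in Ioi (0 : ℝ), Complex.exp (-Complex.I * rootModulus ξ * x) * F ξ := by
  have h1 : IntegrableOn (fun η : ℝ => ((4 * (2 * Real.pi) ^ 3 * η ^ 3 : ℝ) : ℂ) *
      F ((2 * Real.pi) ^ 3 * η ^ 4)) (Ioi 0) := by
    have := (integrableOn_image_iff_integrableOn_abs_deriv_smul (measurableSet_Ioi (a := (0 : ℝ)))
      (fun η _ => hasDerivWithinAt_quartic η _) injOn_quartic_Ioi F).1
      (by rw [image_quartic_Ioi]; exact hi.integrableOn)
    refine (integrableOn_congr_fun (fun η hη => ?_) measurableSet_Ioi).1 this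
    have : (0 : ℝ) < η := hη
    rw [abs_of_nonneg (by positivity), Complex.real_smul]
  have hV : Integrable (oscillatoryOperator F) := by
    unfold oscillatoryOperator
    rw [integrable_indicator_iff measurableSet_Iio]
    rw [← integrableOn_Ici_iff_integrableOn_Ioi] at h1
    have h2 := h1.comp_neg
    simp only [neg_Ici, neg_zero] at h2
    exact h2.mono_set Iio_subset_Iic_self
  filter_upwards [ae_restrict_of_ae (invFourierL2_ae_eq hV hL)] with x hx
  rw [hx, Real.fourierInv_eq']
  rw [integral_Ioi_quartic]
  have e : ∀ η : ℝ, Complex.exp (((2 * Real.pi * inner ℝ η x : ℝ) : ℂ) * Complex.I) •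
      oscillatoryOperator F η = (Iio (0 : ℝ)).indicator (fun η : ℝ =>
        Complex.exp (2 * Real.pi * Complex.I * (η * x)) *
        (((4 * (2 * Real.pi) ^ 3 * (-η) ^ 3 : ℝ) : ℂ) * F ((2 * Real.pi) ^ 3 * (-η) ^ 4))) η := by
    intro η
    unfold oscillatoryOperator
    by_cases h : η ∈ Iio (0 : ℝ)
    · simp only [indicator_of_mem h, smul_eq_mul]
      congr 2
      simp; ring
    · simp [indicator_of_notMem h]
  simp_rw [e]
  rw [integral_indicator measurableSet_Iio, ← integral_Iic_eq_integral_Iio]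
  have h4 := integral_comp_neg_Ioi (0 : ℝ) (fun η : ℝ =>
        Complex.exp (2 * Real.pi * Complex.I * (η * x)) *
        (((4 * (2 * Real.pi) ^ 3 * (-η) ^ 3 : ℝ) : ℂ) * F ((2 * Real.pi) ^ 3 * (-η) ^ 4)))
  rw [neg_zero] at h4
  rw [← h4]
  refine setIntegral_congr_fun measurableSet_Ioi fun η hη => ?_
  have hη : (0 : ℝ) < η := hη
  simp only [neg_neg]
  rw [rootModulus_quartic hη.le, mul_left_comm]
  congr 3
  push_cast; ring

/-- Extension of `x ↦ ∫_{ξ>0} e^{-cμ(ξ)x} F(ξ) dξ`, `x > 0`, to the line, on the Fourier side. -/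
theorem exists_halfLineExtension {s : ℝ} (hs : 0 ≤ s) {c : ℂ} (hc : 0 < c.re ∨ c = Complex.I) :
    ∃ (C : ℝ≥0) (V : (ℝ → ℂ) → ℝ → ℂ),
      (∀ F, Measurable F → Measurable (V F)) ∧
      (∀ F, Measurable F → weightedENorm s (V F) ≤ C * weightedENorm ((2 * s + 3) / 8) F) ∧
      (∀ F F', Measurable F → Measurable F' → weightedENorm ((2 * s + 3) / 8) F < ⊤ →
        weightedENorm ((2 * s + 3) / 8) F' < ⊤ →
        V (fun ξ => F ξ - F' ξ) =ᵐ[volume] fun η => V F η - V F' η) ∧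
      (∀ F, Measurable F → weightedENorm ((2 * s + 3) / 8) F < ⊤ → Integrable F →
        ∀ᵐ x ∂(volume.restrict (Ioi (0 : ℝ))), invFourierL2 (V F) x =
          ∫ ξ in Ioi (0 : ℝ), Complex.exp (-c * rootModulus ξ * x) * F ξ) := by
  rcases hc with hc | rfl
  · obtain ⟨M, hM⟩ := exists_nat_ge (max s 1)
    have hsM : s ≤ M := (le_max_left _ _).trans hM
    have hM0 : 0 < M := by
      have : (1 : ℝ) ≤ M := (le_max_right _ _).trans hM
      exact_mod_cast this
    obtain ⟨C, hC⟩ := weightedENorm_extensionOperator_le hs hc hsM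
    refine ⟨C, extensionOperator c M, fun F hF => measurable_extensionOperator hc M hF, hC, ?_, ?_⟩
    · intro F F' hF hF' hf hf'
      filter_upwards [integrable_extensionKernel_mul hs hc hsM hF hf,
        integrable_extensionKernel_mul hs hc hsM hF' hf'] with η h1 h2
      unfold extensionOperator
      rw [← integral_sub h1 h2]
      simp_rw [mul_sub]
    · intro F hF hf hi
      exact invFourierL2_extensionOperator hc hM0 hF hi (memLp_of_weightedENorm_lt_top hs
        (measurable_extensionOperator hc M hF).aestronglyMeasurable
        ((hC F hF).trans_lt (ENNReal.mul_lt_top (by simp) hf)))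
  · obtain ⟨C, hC⟩ := weightedENorm_oscillatoryOperator_le hs
    refine ⟨C, oscillatoryOperator, fun F hF => measurable_oscillatoryOperator hF, fun F _ => hC F,
      ?_, ?_⟩
    · intro F F' hF hF' hf hf'
      refine Eventually.of_forall fun η => ?_
      unfold oscillatoryOperator
      by_cases h : η ∈ Iio (0 : ℝ) <;> simp only [indicator_of_mem, indicator_of_notMem, h,
        not_false_eq_true, sub_zero]
      ring
    · intro F hF hf hi
      exact invFourierL2_oscillatoryOperator hi (memLp_of_weightedENorm_lt_top hs
        (measurable_oscillatoryOperator hF).aestronglyMeasurable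
        ((hC F).trans_lt (ENNReal.mul_lt_top (by simp) hf)))

theorem weightedENorm_comp_neg (σ : ℝ) (F : ℝ → ℂ) (hF : Measurable F) :
    weightedENorm σ (fun ξ => F (-ξ)) = weightedENorm σ F := by
  have h := eLpNorm_comp_measurePreserving (p := 2)
    (g := fun ξ => (sobolevWeight σ ξ : ℂ) * F ξ)
    (aestronglyMeasurable_sobolevWeight_mul σ hF.aestronglyMeasurable)
    (Measure.measurePreserving_neg (volume : Measure ℝ))
  unfold weightedENorm
  rw [← h]
  congr 1
  ext ξ
  simp [sobolevWeight]

/-- The two-sided version of `exists_halfLineExtension`, for data `F` living on one of the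
half-lines `{ξ | 0 < εξ}`, `ε = ±1`. -/
theorem exists_signedExtension {s : ℝ} (hs : 0 ≤ s) {c : ℂ} (hc : 0 < c.re ∨ c = Complex.I)
    {ε : ℝ} (hε : ε = 1 ∨ ε = -1) :
    ∃ (C : ℝ≥0) (V : (ℝ → ℂ) → ℝ → ℂ),
      (∀ F, Measurable F → Measurable (V F)) ∧
      (∀ F, Measurable F → weightedENorm s (V F) ≤ C * weightedENorm ((2 * s + 3) / 8) F) ∧
      (∀ F F', Measurable F → Measurable F' → weightedENorm ((2 * s + 3) / 8) F < ⊤ →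
        weightedENorm ((2 * s + 3) / 8) F' < ⊤ →
        V (fun ξ => F ξ - F' ξ) =ᵐ[volume] fun η => V F η - V F' η) ∧
      (∀ F, Measurable F → weightedENorm ((2 * s + 3) / 8) F < ⊤ → Integrable F →
        (∀ ξ, ε * ξ ≤ 0 → F ξ = 0) →
        ∀ᵐ x ∂(volume.restrict (Ioi (0 : ℝ))), invFourierL2 (V F) x =
          ∫ ξ, Complex.exp (-c * rootModulus ξ * x) * F ξ) := by
  obtain ⟨C, V, h1, h2, h3, h4⟩ := exists_halfLineExtension hs hc
  rcases hε with rfl | rfl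
  · refine ⟨C, V, h1, h2, h3, fun F hF hf hi h0 => ?_⟩
    filter_upwards [h4 F hF hf hi] with x hx
    rw [hx, setIntegral_eq_integral_of_forall_compl_eq_zero]
    intro ξ hξ
    rw [h0 ξ (by simpa using hξ), mul_zero]
  -- The root modulus is even, so negative frequencies are handled by reflecting F.
  · refine ⟨C, fun F => V fun ξ => F (-ξ), fun F hF => h1 _ (hF.comp measurable_neg), ?_, ?_, ?_⟩
    · intro F hF
      rw [← weightedENorm_comp_neg _ F hF]
      exact h2 _ (hF.comp measurable_neg)
    · intro F F' hF hF' hf hf'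
      exact h3 _ _ (hF.comp measurable_neg) (hF'.comp measurable_neg)
        (by rwa [weightedENorm_comp_neg _ F hF]) (by rwa [weightedENorm_comp_neg _ F' hF'])
    · intro F hF hf hi h0
      filter_upwards [h4 (fun ξ => F (-ξ)) (hF.comp measurable_neg)
        (by rwa [weightedENorm_comp_neg _ F hF])
        hi.comp_neg] with x hx
      rw [hx, setIntegral_eq_integral_of_forall_compl_eq_zero]
      · rw [← integral_neg_eq_self]
        simp [rootModulus_neg]
      · intro ξ hξ
        rw [h0 (-ξ) (by simpa using hξ), mul_zero]

end

/-! ### Superpositions of elementary solutions -/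

noncomputable section

/-- The restriction of `F` to the frequencies `|ξ| ≤ n`. -/
def freqTrunc (n : ℕ) (F : ℝ → ℂ) : ℝ → ℂ := (Icc (-n : ℝ) n).indicator F

/-- The spatial factor `e^{-cμ(ξ)x}` of an elementary solution. -/
def spatialFactor (c : ℂ) (x ξ : ℝ) : ℂ := Complex.exp (-c * rootModulus ξ * x)

/-- The temporal factor `e^{2πiξt}` of an elementary solution. -/
def temporalFactor (t ξ : ℝ) : ℂ := Complex.exp (2 * Real.pi * Complex.I * ξ * t)

/-- Superposition of the elementary solutions of frequency `|ξ| ≤ n`. -/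
def partialWave (c : ℂ) (F : ℝ → ℂ) (n : ℕ) (x t : ℝ) : ℂ :=
  ∫ ξ, temporalFactor t ξ * (spatialFactor c x ξ * freqTrunc n F ξ)

theorem measurable_freqTrunc {F : ℝ → ℂ} (hF : Measurable F) (n : ℕ) :
    Measurable (freqTrunc n F) := hF.indicator measurableSet_Icc

theorem norm_freqTrunc_le (n : ℕ) (F : ℝ → ℂ) (ξ : ℝ) : ‖freqTrunc n F ξ‖ ≤ ‖F ξ‖ :=
  norm_indicator_le_norm_self _ _

theorem continuous_spatialFactor (c : ℂ) : Continuous fun p : ℝ × ℝ => spatialFactor c p.1 p.2 := by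
  have := continuous_rootModulus
  unfold spatialFactor
  fun_prop

theorem continuous_temporalFactor : Continuous fun p : ℝ × ℝ => temporalFactor p.1 p.2 := by
  unfold temporalFactor
  fun_prop

theorem norm_temporalFactor (t ξ : ℝ) : ‖temporalFactor t ξ‖ = 1 := by
  unfold temporalFactor
  rw [Complex.norm_exp]
  simp

theorem norm_spatialFactor_le {c : ℂ} (hc : 0 ≤ c.re) {x : ℝ} (hx : 0 ≤ x) (ξ : ℝ) :
    ‖spatialFactor c x ξ‖ ≤ 1 := by
  unfold spatialFactor
  rw [Complex.norm_exp, Real.exp_le_one_iff]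
  have := rootModulus_nonneg ξ
  simp
  positivity

theorem integrable_freqTrunc {σ : ℝ} (hσ : 0 ≤ σ) {F : ℝ → ℂ} (hF : Measurable F)
    (hfin : weightedENorm σ F < ⊤) (n : ℕ) : Integrable (freqTrunc n F) := by
  unfold freqTrunc
  rw [integrable_indicator_iff measurableSet_Icc]
  have := memLp_of_weightedENorm_lt_top hσ hF.aestronglyMeasurable hfin
  exact (this.restrict (Icc (-n : ℝ) n)).integrable (by norm_num)

theorem tendsto_weightedENorm_sub_freqTrunc {σ : ℝ} {F : ℝ → ℂ} (hF : Measurable F)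
    (hfin : weightedENorm σ F < ⊤) :
    Tendsto (fun n => weightedENorm σ (fun ξ => F ξ - freqTrunc n F ξ)) atTop (𝓝 0) := by
  have h := tendsto_weightedENorm_mul_sub (l := atTop) hF.aestronglyMeasurable hfin
    (m := fun n : ℕ => (Icc (-n : ℝ) n).indicator fun _ => (1 : ℂ)) (m₀ := fun _ => 1) (K := 1)
    (Eventually.of_forall fun n =>
      (measurable_const.indicator measurableSet_Icc).aestronglyMeasurable)
    aestronglyMeasurable_const
    (Eventually.of_forall fun n ξ => by
      by_cases h : ξ ∈ Icc (-n : ℝ) n <;> simp [h])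
    (Eventually.of_forall fun ξ => by
      apply tendsto_const_nhds.congr'
      obtain ⟨N, hN⟩ := exists_nat_ge |ξ|
      filter_upwards [eventually_ge_atTop N] with n hn
      have : (N : ℝ) ≤ n := by exact_mod_cast hn
      rw [indicator_of_mem]
      exact abs_le.1 (hN.trans this))
  refine h.congr fun n => ?_
  unfold weightedENorm
  rw [← eLpNorm_neg]
  congr 1
  ext ξ
  unfold freqTrunc
  by_cases h : ξ ∈ Icc (-n : ℝ) n <;> simp [h]

theorem stronglyMeasurable_partialWave (c : ℂ) {F : ℝ → ℂ} (hF : Measurable F) (n : ℕ) :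
    StronglyMeasurable (Function.uncurry (partialWave c F n)) := by
  refine StronglyMeasurable.integral_prod_right (ν := volume)
    (f := fun (p : ℝ × ℝ) ξ =>
      temporalFactor p.2 ξ * (spatialFactor c p.1 ξ * freqTrunc n F ξ)) ?_
  refine Measurable.stronglyMeasurable ?_
  have h1 := continuous_temporalFactor.measurable.comp
    (show Measurable fun p : (ℝ × ℝ) × ℝ => (p.1.2, p.2) by fun_prop)
  have h2 := (continuous_spatialFactor c).measurable.comp
    (show Measurable fun p : (ℝ × ℝ) × ℝ => (p.1.1, p.2) by fun_prop)
  exact h1.mul (h2.mul ((measurable_freqTrunc hF n).comp measurable_snd))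

theorem norm_partialWave_le {c : ℂ} (hc : 0 ≤ c.re) {F : ℝ → ℂ} {n : ℕ}
    (hi : Integrable (freqTrunc n F)) {x : ℝ} (hx : 0 ≤ x) (t : ℝ) :
    ‖partialWave c F n x t‖ ≤ ∫ ξ, ‖freqTrunc n F ξ‖ := by
  refine norm_integral_le_of_norm_le hi.norm (Eventually.of_forall fun ξ => ?_)
  rw [norm_mul, norm_mul, norm_temporalFactor, one_mul]
  exact mul_le_of_le_one_left (norm_nonneg _) (norm_spatialFactor_le hc hx ξ)

/-- The squared errors are summable, so their sum is finite almost everywhere and the terms tend to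
0. No further subsequence is extracted, so one sequence works for all slices at once. -/
theorem ae_tendsto_of_eLpNorm_sub_le {α : Type*} [MeasurableSpace α] {μ : Measure α}
    {g : ℕ → α → ℂ} {f : α → ℂ} (hg : ∀ k, AEStronglyMeasurable (g k) μ)
    (hf : AEStronglyMeasurable f μ) {K : ℝ≥0}
    (h : ∀ k, eLpNorm (fun a => g k a - f a) 2 μ ≤ K * (2⁻¹) ^ k) :
    ∀ᵐ a ∂μ, Tendsto (fun k => g k a) atTop (𝓝 (f a)) := by
  have h2 : ∀ k, ∫⁻ a, ‖g k a - f a‖ₑ ^ 2 ∂μ ≤ (K : ℝ≥0∞) ^ 2 * (2⁻¹) ^ k := by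
    intro k
    have := eLpNorm_nnreal_pow_eq_lintegral (f := fun a => g k a - f a) (μ := μ) (p := 2)
      (by norm_num)
    simp only [NNReal.coe_ofNat, ENNReal.coe_ofNat] at this
    have e : eLpNorm (fun a => g k a - f a) 2 μ ^ 2 = ∫⁻ a, ‖g k a - f a‖ₑ ^ 2 ∂μ := by
      exact_mod_cast this
    rw [← e]
    calc _ ≤ ((K : ℝ≥0∞) * (2⁻¹) ^ k) ^ 2 := by gcongr; exact h k
      _ = (K : ℝ≥0∞) ^ 2 * ((2⁻¹) ^ k * (2⁻¹) ^ k) := by ring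
      _ ≤ (K : ℝ≥0∞) ^ 2 * ((2⁻¹) ^ k * 1) := by
        gcongr
        exact pow_le_one' (by norm_num) _
      _ = _ := by rw [mul_one]
  have hm : ∀ k, AEMeasurable (fun a => ‖g k a - f a‖ₑ ^ 2) μ := fun k =>
    ((hg k).sub hf).enorm.pow_const 2
  have hsum : ∫⁻ a, ∑' k, ‖g k a - f a‖ₑ ^ 2 ∂μ < ⊤ := by
    rw [lintegral_tsum hm]
    refine (ENNReal.tsum_le_tsum h2).trans_lt ?_
    rw [ENNReal.tsum_mul_left]
    refine ENNReal.mul_lt_top (by simp) ?_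
    rw [ENNReal.tsum_geometric]
    simp
  filter_upwards [ae_lt_top' (AEMeasurable.tsum hm) hsum.ne] with a ha
  have h3 := ENNReal.tendsto_atTop_zero_of_tsum_ne_top ha.ne
  rw [tendsto_iff_edist_tendsto_0]
  have h4 := (ENNReal.continuous_rpow_const (y := (1 / 2 : ℝ))).tendsto _ |>.comp h3
  simp only [Function.comp_def] at h4
  rw [ENNReal.zero_rpow_of_pos (by norm_num)] at h4
  refine h4.congr fun k => ?_
  rw [edist_eq_enorm_sub, ← ENNReal.rpow_natCast, ← ENNReal.rpow_mul]
  norm_num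

/-- `Z` is the superposition `∫ e^{2πiξt} e^{-cμ(ξ)x} F(ξ) dξ`, with representatives chosen so that
all of its slices are the expected functions. -/
structure IsWave (σ : ℝ) (c : ℂ) (F : ℝ → ℂ) (Z : ℝ → ℝ → ℂ) : Prop where
  measurable : StronglyMeasurable (Function.uncurry Z)
  slice_space : ∀ x, 0 ≤ x →
    invFourierL2 (fun ξ => spatialFactor c x ξ * F ξ) =ᵐ[volume] Z x
  approx : ∀ x, 0 ≤ x → ∀ n, eLpNorm (fun t => partialWave c F n x t - Z x t) 2 volume ≤
    weightedENorm σ (fun ξ => F ξ - freqTrunc n F ξ)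
  slice_time : ∀ (t : ℝ) (U : ℝ → ℂ) (K : ℝ≥0),
    AEStronglyMeasurable U (volume.restrict (Ioi 0)) →
    (∀ n, eLpNorm (fun x => partialWave c F n x t - U x) 2 (volume.restrict (Ioi 0)) ≤
      K * weightedENorm σ (fun ξ => F ξ - freqTrunc n F ξ)) →
    U =ᵐ[volume.restrict (Ioi 0)] fun x => Z x t

theorem weightedENorm_spatialFactor_mul_le {σ : ℝ} {c : ℂ} (hc : 0 ≤ c.re) {x : ℝ} (hx : 0 ≤ x)
    (F : ℝ → ℂ) : weightedENorm σ (fun ξ => spatialFactor c x ξ * F ξ) ≤ weightedENorm σ F := by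
  refine weightedENorm_mono (Eventually.of_forall fun ξ => ?_)
  rw [norm_mul]
  exact mul_le_of_le_one_left (norm_nonneg _) (norm_spatialFactor_le hc hx ξ)

theorem measurable_spatialFactor (c : ℂ) (x : ℝ) : Measurable (spatialFactor c x) := by
  have := continuous_rootModulus
  refine Continuous.measurable ?_
  unfold spatialFactor
  fun_prop

theorem measurable_temporalFactor (t : ℝ) : Measurable (temporalFactor t) := by
  refine Continuous.measurable ?_
  unfold temporalFactor
  fun_prop

theorem partialWave_eq_invFourierL2 {σ : ℝ} (hσ : 0 ≤ σ) {c : ℂ} (hc : 0 ≤ c.re) {F : ℝ → ℂ}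
    (hF : Measurable F) (hfin : weightedENorm σ F < ⊤) (n : ℕ) {x : ℝ} (hx : 0 ≤ x) :
    invFourierL2 (fun ξ => spatialFactor c x ξ * freqTrunc n F ξ) =ᵐ[volume]
      partialWave c F n x := by
  have hm : Measurable (fun ξ => spatialFactor c x ξ * freqTrunc n F ξ) :=
    (measurable_spatialFactor c x).mul (measurable_freqTrunc hF n)
  have hi : Integrable (fun ξ => spatialFactor c x ξ * freqTrunc n F ξ) :=
    (integrable_freqTrunc hσ hF hfin n).mono hm.aestronglyMeasurable (Eventually.of_forall fun ξ => by
      rw [norm_mul]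
      exact mul_le_of_le_one_left (norm_nonneg _) (norm_spatialFactor_le hc hx ξ))
  have hL : MemLp (fun ξ => spatialFactor c x ξ * freqTrunc n F ξ) 2 :=
    memLp_of_weightedENorm_lt_top hσ hm.aestronglyMeasurable
      (((weightedENorm_spatialFactor_mul_le hc hx _).trans (weightedENorm_mono
        (Eventually.of_forall (norm_freqTrunc_le n F)))).trans_lt hfin)
  filter_upwards [invFourierL2_ae_eq hi hL] with t ht
  rw [ht, Real.fourierInv_eq']
  unfold partialWave
  congr with ξ
  rw [smul_eq_mul]
  congr 1
  unfold temporalFactor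
  congr 1
  simp; ring

/-- An L² class in (x,t) has no canonical restriction to a line. Here Z is the pointwise limit of
truncated waves along one subsequence with errors at most 2^{-k}. The limit is jointly measurable,
and on each line x = const ≥ 0, or t = const, it coincides almost everywhere with any function
approximated at the rate of the truncation error. -/
theorem exists_isWave {σ : ℝ} (hσ : 0 ≤ σ) {c : ℂ} (hc : 0 ≤ c.re) {F : ℝ → ℂ}
    (hF : Measurable F) (hfin : weightedENorm σ F < ⊤) : ∃ Z, IsWave σ c F Z := by
  set e : ℕ → ℝ≥0∞ := fun n => weightedENorm σ (fun ξ => F ξ - freqTrunc n F ξ) with he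
  have hlim : Tendsto e atTop (𝓝 0) := tendsto_weightedENorm_sub_freqTrunc hF hfin
  have hsub : ∀ k : ℕ, ∃ N, e N ≤ (2⁻¹) ^ k := fun k => by
    have := hlim.eventually (ge_mem_nhds (show (0 : ℝ≥0∞) < (2⁻¹) ^ k from
      ENNReal.pow_pos (by simp) k))
    exact this.exists
  choose N hN using hsub
  have hZm := StronglyMeasurable.limUnder (l := atTop)
    (fun k => stronglyMeasurable_partialWave c hF (N k))
  set Z : ℝ → ℝ → ℂ := fun x t => limUnder atTop fun k => partialWave c F (N k) x t with hZ
  have hbound : ∀ x, 0 ≤ x → ∀ n, eLpNorm (fun t => partialWave c F n x t -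
      invFourierL2 (fun ξ => spatialFactor c x ξ * F ξ) t) 2 volume ≤ e n := by
    intro x hx n
    have hL : MemLp (fun ξ => spatialFactor c x ξ * F ξ) 2 :=
      memLp_of_weightedENorm_lt_top hσ ((measurable_spatialFactor c x).mul hF).aestronglyMeasurable
        ((weightedENorm_spatialFactor_mul_le hc hx _).trans_lt hfin)
    have hLn : MemLp (fun ξ => spatialFactor c x ξ * freqTrunc n F ξ) 2 :=
      memLp_of_weightedENorm_lt_top hσ
        ((measurable_spatialFactor c x).mul (measurable_freqTrunc hF n)).aestronglyMeasurable
        (((weightedENorm_spatialFactor_mul_le hc hx _).trans (weightedENorm_mono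
        (Eventually.of_forall (norm_freqTrunc_le n F)))).trans_lt hfin)
    have h1 := eLpNorm_invFourierL2 (hLn.sub hL)
    have h2 : eLpNorm (fun t => partialWave c F n x t -
      invFourierL2 (fun ξ => spatialFactor c x ξ * F ξ) t) 2 volume =
      eLpNorm (invFourierL2 ((fun ξ => spatialFactor c x ξ * freqTrunc n F ξ) -
        fun ξ => spatialFactor c x ξ * F ξ)) 2 volume := by
      apply eLpNorm_congr_ae
      have h3 := invFourierL2_sub hLn hL
      filter_upwards [partialWave_eq_invFourierL2 hσ hc hF hfin n hx,
        Lp.coeFn_sub (invFourierL2 (fun ξ => spatialFactor c x ξ * freqTrunc n F ξ))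
          (invFourierL2 (fun ξ => spatialFactor c x ξ * F ξ))] with t ht ht2
      rw [← ht, ← Pi.sub_apply, ← ht2, ← h3]
      rfl
    rw [h2, h1]
    refine (eLpNorm_mono fun ξ => ?_).trans (eLpNorm_le_weightedENorm hσ _)
    simp only [Pi.sub_apply]
    rw [← mul_sub, norm_mul, ← norm_sub_rev (F ξ)]
    exact mul_le_of_le_one_left (norm_nonneg _) (norm_spatialFactor_le hc hx ξ)
  have hsl : ∀ x, 0 ≤ x → invFourierL2 (fun ξ => spatialFactor c x ξ * F ξ) =ᵐ[volume] Z x := by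
    intro x hx
    have := ae_tendsto_of_eLpNorm_sub_le (K := 1) (μ := volume)
      (g := fun k t => partialWave c F (N k) x t)
      (f := invFourierL2 (fun ξ => spatialFactor c x ξ * F ξ))
      (fun k => ((stronglyMeasurable_partialWave c hF (N k)).comp_measurable
        measurable_prodMk_left).aestronglyMeasurable)
      (Lp.aestronglyMeasurable _)
      (fun k => by simpa using (hbound x hx (N k)).trans (hN k))
    filter_upwards [this] with t ht
    exact ht.limUnder_eq.symm
  refine ⟨Z, hZm, hsl, ?_, ?_⟩
  · intro x hx n
    refine le_trans (le_of_eq (eLpNorm_congr_ae ?_)) (hbound x hx n)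
    filter_upwards [hsl x hx] with t ht
    rw [ht]
  · intro t U K hU hb
    have := ae_tendsto_of_eLpNorm_sub_le (K := K) (μ := volume.restrict (Ioi 0))
      (g := fun k x => partialWave c F (N k) x t) (f := U)
      (fun k => ((stronglyMeasurable_partialWave c hF (N k)).comp_measurable
        measurable_prodMk_right).aestronglyMeasurable) hU
      (fun k => (hb (N k)).trans (by gcongr; exact hN k))
    filter_upwards [this] with x hx
    exact hx.limUnder_eq.symm

/-- The slices in time of a wave whose data live on one of the half-lines `{ξ | 0 < εξ}`. -/
theorem IsWave.exists_timeSlices {s : ℝ} (hs : 0 ≤ s) {c : ℂ} (hc : 0 < c.re ∨ c = Complex.I)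
    {ε : ℝ} (hε : ε = 1 ∨ ε = -1) :
    ∃ C : ℝ≥0, ∀ F : ℝ → ℂ, Measurable F → weightedENorm ((2 * s + 3) / 8) F < ⊤ →
      (∀ ξ, ε * ξ ≤ 0 → F ξ = 0) → ∀ Z, IsWave ((2 * s + 3) / 8) c F Z →
      ∃ G : ℝ → ℝ → ℂ, (∀ t, Measurable (G t)) ∧
        (∀ t, weightedENorm s (G t) ≤ C * weightedENorm ((2 * s + 3) / 8) F) ∧
        (∀ t, invFourierL2 (G t) =ᵐ[volume.restrict (Ioi 0)] fun x => Z x t) ∧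
        (∀ t, Tendsto (fun t' => weightedENorm s (fun η => G t' η - G t η)) (𝓝 t) (𝓝 0)) := by
  obtain ⟨C, V, hVm, hVb, hVs, hVr⟩ := exists_signedExtension hs hc hε
  refine ⟨C, fun F hF hfin h0 Z hZ => ?_⟩
  set σ := (2 * s + 3) / 8 with hσdef
  have hσ : 0 ≤ σ := by positivity
  have hFt : ∀ t, Measurable fun ξ => temporalFactor t ξ * F ξ := fun t =>
    (measurable_temporalFactor t).mul hF
  have hnorm : ∀ (t : ℝ) (H : ℝ → ℂ),
      weightedENorm σ (fun ξ => temporalFactor t ξ * H ξ) = weightedENorm σ H := fun t H => by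
    apply le_antisymm <;> refine weightedENorm_mono (Eventually.of_forall fun ξ => ?_) <;>
      simp [norm_temporalFactor]
  have hfint : ∀ t, weightedENorm σ (fun ξ => temporalFactor t ξ * F ξ) < ⊤ := fun t => by
    rwa [hnorm]
  have hfinb : ∀ t, weightedENorm s (V fun ξ => temporalFactor t ξ * F ξ) < ⊤ := fun t =>
    (hVb _ (hFt t)).trans_lt (ENNReal.mul_lt_top (by simp) (hfint t))
  have hmL : ∀ t, MemLp (V fun ξ => temporalFactor t ξ * F ξ) 2 := fun t =>
    memLp_of_weightedENorm_lt_top hs (hVm _ (hFt t)).aestronglyMeasurable (hfinb t)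
  refine ⟨fun t => V fun ξ => temporalFactor t ξ * F ξ, fun t => hVm _ (hFt t), fun t => ?_,
    fun t => ?_, fun t => ?_⟩
  · rw [← hnorm t F]
    exact hVb _ (hFt t)
  -- The truncated wave at time t is represented exactly on x > 0 by the extension operator; by
  -- linearity the error is the operator applied to the discarded frequencies, of norm at most C
  -- times the truncation error.
  · refine hZ.slice_time t _ C (Lp.aestronglyMeasurable _).restrict fun n => ?_
    set Fn := fun ξ => temporalFactor t ξ * freqTrunc n F ξ with hFn
    have hFnm : Measurable Fn := (measurable_temporalFactor t).mul (measurable_freqTrunc hF n)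
    have hFnfin : weightedENorm σ Fn < ⊤ := by
      rw [hFn, hnorm]
      exact (weightedENorm_mono (Eventually.of_forall (norm_freqTrunc_le n F))).trans_lt hfin
    have hi : Integrable Fn := (integrable_freqTrunc hσ hF hfin n).mono hFnm.aestronglyMeasurable
      (Eventually.of_forall fun ξ => by simp [hFn, norm_temporalFactor])
    have hrep := hVr Fn hFnm hFnfin hi (fun ξ hξ => by
      simp only [hFn, freqTrunc, indicator_apply, h0 ξ hξ, ite_self, mul_zero])
    have hLn : MemLp (V Fn) 2 :=
      memLp_of_weightedENorm_lt_top hs (hVm _ hFnm).aestronglyMeasurable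
        ((hVb _ hFnm).trans_lt (ENNReal.mul_lt_top (by simp) hFnfin))
    have hdiff := hVs Fn _ hFnm (hFt t) hFnfin (hfint t)
    have h2 : eLpNorm (fun x => partialWave c F n x t -
        invFourierL2 (V fun ξ => temporalFactor t ξ * F ξ) x) 2 (volume.restrict (Ioi 0)) =
        eLpNorm (invFourierL2 (fun η => V Fn η - V (fun ξ => temporalFactor t ξ * F ξ) η)) 2
          (volume.restrict (Ioi 0)) := by
      apply eLpNorm_congr_ae
      rw [invFourierL2_sub hLn (hmL t)]
      filter_upwards [hrep, ae_restrict_of_ae (Lp.coeFn_sub (invFourierL2 (V Fn))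
        (invFourierL2 (V fun ξ => temporalFactor t ξ * F ξ)))] with x hx hx2
      rw [hx2, Pi.sub_apply, hx]
      congr 1
      unfold partialWave
      congr with ξ
      simp only [hFn, spatialFactor]
      ring
    rw [h2]
    refine (eLpNorm_mono_measure _ Measure.restrict_le_self).trans ?_
    rw [eLpNorm_invFourierL2 (show MemLp (fun η => V Fn η -
      V (fun ξ => temporalFactor t ξ * F ξ) η) 2 from hLn.sub (hmL t))]
    refine (eLpNorm_le_weightedENorm hs _).trans ?_
    rw [← weightedENorm_congr hdiff]
    refine (hVb _ (hFnm.sub (hFt t))).trans ?_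
    gcongr 1
    refine weightedENorm_mono (Eventually.of_forall fun ξ => ?_)
    simp only [hFn, Pi.sub_apply]
    rw [← mul_sub, norm_mul, norm_temporalFactor, one_mul, norm_sub_rev]
  -- Continuity in time is strong continuity of the unimodular multipliers e^{2πiξt}, carried over
  -- by the boundedness and linearity of V.
  · have hm := tendsto_weightedENorm_mul_sub (σ := σ) (l := 𝓝 t) hF.aestronglyMeasurable hfin
      (m := temporalFactor) (m₀ := temporalFactor t) (K := 2)
      (Eventually.of_forall fun t' => (measurable_temporalFactor t').aestronglyMeasurable)
      (measurable_temporalFactor t).aestronglyMeasurable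
      (Eventually.of_forall fun t' ξ => by
        refine (norm_sub_le _ _).trans ?_
        rw [norm_temporalFactor, norm_temporalFactor]
        norm_num)
      (Eventually.of_forall fun ξ =>
        (continuous_temporalFactor.comp (Continuous.prodMk_left ξ)).tendsto t)
    have hm2 := ENNReal.Tendsto.const_mul (a := (C : ℝ≥0∞)) hm (Or.inr (by simp))
    rw [mul_zero] at hm2
    refine tendsto_of_tendsto_of_tendsto_of_le_of_le tendsto_const_nhds hm2
      (fun _ => bot_le) fun t' => ?_
    rw [← weightedENorm_congr (hVs _ _ (hFt t') (hFt t) (hfint t') (hfint t))]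
    exact hVb _ ((hFt t').sub (hFt t))

end

/-! ### Waves as distributional solutions -/

noncomputable section

/-- The partial derivative in the first variable. -/
def partialFst (φ : ℝ × ℝ → ℂ) (p : ℝ × ℝ) : ℂ := deriv (fun y => φ (y, p.2)) p.1

/-- The partial derivative in the second variable. -/
def partialSnd (φ : ℝ × ℝ → ℂ) (p : ℝ × ℝ) : ℂ := deriv (fun τ => φ (p.1, τ)) p.2

theorem partialFst_eq_fderiv {φ : ℝ × ℝ → ℂ} (hφ : ContDiff ℝ ∞ φ) (p : ℝ × ℝ) :
    partialFst φ p = fderiv ℝ φ p (1, 0) := by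
  have h1 : HasFDerivAt φ (fderiv ℝ φ p) (p.1, p.2) :=
    (hφ.differentiable (by simp) p).hasFDerivAt
  have h2 : HasDerivAt (fun y : ℝ => (y, p.2)) ((1 : ℝ), (0 : ℝ)) p.1 :=
    (hasDerivAt_id p.1).prodMk (hasDerivAt_const p.1 p.2)
  exact (h1.comp_hasDerivAt p.1 h2).deriv

theorem partialSnd_eq_fderiv {φ : ℝ × ℝ → ℂ} (hφ : ContDiff ℝ ∞ φ) (p : ℝ × ℝ) :
    partialSnd φ p = fderiv ℝ φ p (0, 1) := by
  have h1 : HasFDerivAt φ (fderiv ℝ φ p) (p.1, p.2) :=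
    (hφ.differentiable (by simp) p).hasFDerivAt
  have h2 : HasDerivAt (fun y : ℝ => (p.1, y)) ((0 : ℝ), (1 : ℝ)) p.2 :=
    (hasDerivAt_const p.2 p.1).prodMk (hasDerivAt_id p.2)
  exact (h1.comp_hasDerivAt p.2 h2).deriv

theorem IsTestFunctionOn.fderiv_apply {Ω : Set (ℝ × ℝ)} {φ : ℝ × ℝ → ℂ}
    (h : IsTestFunctionOn Ω φ) (v : ℝ × ℝ) : IsTestFunctionOn Ω (fun p => fderiv ℝ φ p v) := by
  obtain ⟨h1, h2, h3⟩ := h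
  have hs : tsupport (fun p => fderiv ℝ φ p v) ⊆ tsupport φ := tsupport_fderiv_apply_subset ℝ v
  exact ⟨(h1.fderiv_right (m := ∞) (by simp)).clm_apply contDiff_const,
    h2.of_isClosed_subset (isClosed_tsupport _) hs, hs.trans h3⟩

theorem IsTestFunctionOn.partialFst {Ω : Set (ℝ × ℝ)} {φ : ℝ × ℝ → ℂ}
    (h : IsTestFunctionOn Ω φ) : IsTestFunctionOn Ω (partialFst φ) := by
  have : _root_.partialFst φ = fun p => fderiv ℝ φ p (1, 0) := funext (partialFst_eq_fderiv h.1)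
  rw [this]
  exact h.fderiv_apply _

theorem IsTestFunctionOn.partialSnd {Ω : Set (ℝ × ℝ)} {φ : ℝ × ℝ → ℂ}
    (h : IsTestFunctionOn Ω φ) : IsTestFunctionOn Ω (partialSnd φ) := by
  have : _root_.partialSnd φ = fun p => fderiv ℝ φ p (0, 1) := funext (partialSnd_eq_fderiv h.1)
  rw [this]
  exact h.fderiv_apply _

theorem iteratedDeriv_four_fst (φ : ℝ × ℝ → ℂ) (p : ℝ × ℝ) :
    iteratedDeriv 4 (fun y => φ (y, p.2)) p.1 =
      partialFst (partialFst (partialFst (partialFst φ))) p := by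
  simp only [iteratedDeriv_succ, iteratedDeriv_zero]
  rfl

theorem integrable_of_isTestFunctionOn {Ω : Set (ℝ × ℝ)} {φ : ℝ × ℝ → ℂ}
    (h : IsTestFunctionOn Ω φ) {E : ℝ × ℝ → ℂ} (hE : Continuous E) :
    Integrable (fun p => E p * φ p) :=
  (hE.mul h.1.continuous).integrable_of_hasCompactSupport h.2.1.mul_left

theorem measurableSet_halfStrip (T : ℝ) : MeasurableSet (halfStrip T) :=
  measurableSet_Ioi.prod measurableSet_Ioo

theorem setIntegral_halfStrip {T : ℝ} {ψ : ℝ × ℝ → ℂ} (h : IsTestFunctionOn (halfStrip T) ψ)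
    (f : ℝ × ℝ → ℂ) : ∫ p in halfStrip T, f p * ψ p = ∫ p, f p * ψ p := by
  apply setIntegral_eq_integral_of_forall_compl_eq_zero
  intro p hp
  rw [image_eq_zero_of_notMem_tsupport fun h' => hp (h.2.2 h'), mul_zero]

/-- The waves converge in L²(dt) uniformly in x ≥ 0. Compact support of ψ in x and Cauchy–Schwarz on
(0,T) turn this into L¹ convergence of the products with ψ. -/
theorem lintegral_halfStrip_mul_le {T : ℝ} (hT : 0 < T) {ψ : ℝ × ℝ → ℂ}
    (h : IsTestFunctionOn (halfStrip T) ψ) :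
    ∃ K : ℝ≥0, ∀ (f : ℝ × ℝ → ℂ) (e : ℝ≥0∞), StronglyMeasurable f →
      (∀ x, 0 ≤ x → eLpNorm (fun t => f (x, t)) 2 volume ≤ e) →
      ∫⁻ p in halfStrip T, ‖f p * ψ p‖ₑ ≤ K * e := by
  obtain ⟨B, hB⟩ := h.1.continuous.bounded_above_of_compact_support h.2.1
  obtain ⟨R, hR⟩ := (h.2.1.isCompact.isBounded.subset_closedBall 0)
  have hsupp : ∀ p : ℝ × ℝ, R < p.1 → ψ p = 0 := by
    intro p hp
    apply image_eq_zero_of_notMem_tsupport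
    intro h'
    have := hR h'
    rw [mem_closedBall_zero_iff] at this
    have h1 : ‖p.1‖ ≤ ‖p‖ := norm_fst_le p
    linarith [le_abs_self p.1, Real.norm_eq_abs p.1]
  refine ⟨(max R 0).toNNReal * (B.toNNReal * (T ^ (1 / 2 : ℝ)).toNNReal), fun f e hf he => ?_⟩
  unfold halfStrip
  rw [Measure.volume_eq_prod, ← Measure.prod_restrict, lintegral_prod _ (by
    exact (hf.aestronglyMeasurable.mul h.1.continuous.aestronglyMeasurable).enorm)]
  have hin : ∀ x, 0 < x → ∫⁻ t in Ioo 0 T, ‖f (x, t) * ψ (x, t)‖ₑ ≤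
      (Iic R).indicator (fun _ => (B.toNNReal : ℝ≥0∞) * ((T ^ (1 / 2 : ℝ)).toNNReal * e)) x := by
    intro x hx
    by_cases hxR : x ∈ Iic R
    · rw [indicator_of_mem hxR]
      have hm : AEStronglyMeasurable (fun t => f (x, t)) (volume.restrict (Ioo 0 T)) :=
        (hf.comp_measurable measurable_prodMk_left).aestronglyMeasurable
      calc ∫⁻ t in Ioo 0 T, ‖f (x, t) * ψ (x, t)‖ₑ
          ≤ ∫⁻ t in Ioo 0 T, (B.toNNReal : ℝ≥0∞) * ‖f (x, t)‖ₑ := by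
            refine lintegral_mono fun t => ?_
            rw [enorm_mul, mul_comm]
            gcongr
            rw [← ofReal_norm]
            exact ENNReal.ofReal_le_ofReal (hB _)
        _ = B.toNNReal * ∫⁻ t in Ioo 0 T, ‖f (x, t)‖ₑ := lintegral_const_mul' _ _ (by simp)
        _ ≤ _ := by
            gcongr
            rw [← eLpNorm_one_eq_lintegral_enorm]
            refine (eLpNorm_le_eLpNorm_mul_rpow_measure_univ (p := 1) (q := 2) (by norm_num)
              hm).trans ?_
            rw [mul_comm]
            gcongr
            · simp only [MeasurableSet.univ, Measure.restrict_apply, univ_inter, Real.volume_Ioo,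
                sub_zero, ENNReal.toReal_one, ENNReal.toReal_ofNat]
              rw [ENNReal.ofReal_rpow_of_pos hT]
              apply le_of_eq
              norm_num [ENNReal.ofReal]
            · exact (eLpNorm_mono_measure _ Measure.restrict_le_self).trans (he x hx.le)
    · rw [indicator_of_notMem hxR, lintegral_congr (g := fun _ => 0)]
      · simp
      · intro t
        rw [hsupp (x, t) (not_le.1 hxR)]
        simp
  calc _ ≤ ∫⁻ x in Ioi (0 : ℝ), (Iic R).indicator
        (fun _ => (B.toNNReal : ℝ≥0∞) * ((T ^ (1 / 2 : ℝ)).toNNReal * e)) x :=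
        setLIntegral_mono' measurableSet_Ioi fun x hx => hin x hx
    _ = (B.toNNReal : ℝ≥0∞) * ((T ^ (1 / 2 : ℝ)).toNNReal * e) * volume (Ioc 0 R) := by
        rw [lintegral_indicator measurableSet_Iic, lintegral_const, Measure.restrict_apply
          MeasurableSet.univ, Measure.restrict_apply' measurableSet_Ioi]
        congr 2
        ext x
        simp [and_comm]
    _ ≤ (B.toNNReal : ℝ≥0∞) * ((T ^ (1 / 2 : ℝ)).toNNReal * e) * (max R 0).toNNReal := by
        gcongr
        rw [Real.volume_Ioc, sub_zero]
        exact ENNReal.ofReal_le_ofReal (le_max_left _ _)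
    _ = _ := by push_cast; ring

section Pairing

variable {σ : ℝ} {c : ℂ} {F : ℝ → ℂ} {Z : ℝ → ℝ → ℂ} {T : ℝ} {ψ : ℝ × ℝ → ℂ}

theorem integrableOn_partialWave_mul (hσ : 0 ≤ σ) (hc : 0 ≤ c.re) (hF : Measurable F)
    (hfin : weightedENorm σ F < ⊤) (h : IsTestFunctionOn (halfStrip T) ψ) (n : ℕ) :
    IntegrableOn (fun p => partialWave c F n p.1 p.2 * ψ p) (halfStrip T) := by
  have hψ : Integrable ψ := h.1.continuous.integrable_of_hasCompactSupport h.2.1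
  refine hψ.integrableOn.bdd_mul (c := ∫ ξ, ‖freqTrunc n F ξ‖)
    (stronglyMeasurable_partialWave c hF n).aestronglyMeasurable ?_
  filter_upwards [ae_restrict_mem (measurableSet_halfStrip T)] with p hp
  exact norm_partialWave_le hc (integrable_freqTrunc hσ hF hfin n) (le_of_lt hp.1) _

theorem IsWave.integrableOn_mul (hZ : IsWave σ c F Z) (hσ : 0 ≤ σ) (hc : 0 ≤ c.re)
    (hF : Measurable F) (hfin : weightedENorm σ F < ⊤) (hT : 0 < T)
    (h : IsTestFunctionOn (halfStrip T) ψ) :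
    IntegrableOn (fun p => Z p.1 p.2 * ψ p) (halfStrip T) := by
  obtain ⟨K, hK⟩ := lintegral_halfStrip_mul_le hT h
  have hm : StronglyMeasurable fun p : ℝ × ℝ => partialWave c F 0 p.1 p.2 - Z p.1 p.2 :=
    (stronglyMeasurable_partialWave c hF 0).sub hZ.measurable
  -- The estimate above bounds the error partialWave - Z, so Z is recovered as a truncated wave
  -- minus its error; any n would do in place of 0.
  have h1 : IntegrableOn (fun p => (partialWave c F 0 p.1 p.2 - Z p.1 p.2) * ψ p) (halfStrip T) := by
    refine ⟨hm.aestronglyMeasurable.mul h.1.continuous.aestronglyMeasurable, ?_⟩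
    refine (hK _ _ hm fun x hx => hZ.approx x hx 0).trans_lt (ENNReal.mul_lt_top (by simp) ?_)
    refine lt_of_le_of_lt (weightedENorm_mono (Eventually.of_forall fun ξ => ?_)) hfin
    unfold freqTrunc
    by_cases h : ξ ∈ Icc (-(0 : ℕ) : ℝ) (0 : ℕ)
    · simp only [indicator_of_mem h, sub_self, norm_zero, norm_nonneg]
    · simp only [indicator_of_notMem h, sub_zero, le_refl]
  refine ((integrableOn_partialWave_mul hσ hc hF hfin h 0).sub h1).congr
    (Eventually.of_forall fun p => ?_)
  simp only [Pi.sub_apply]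
  ring

theorem IsWave.tendsto_pairing (hZ : IsWave σ c F Z) (hσ : 0 ≤ σ) (hc : 0 ≤ c.re)
    (hF : Measurable F) (hfin : weightedENorm σ F < ⊤) (hT : 0 < T)
    (h : IsTestFunctionOn (halfStrip T) ψ) :
    Tendsto (fun n => ∫ p in halfStrip T, partialWave c F n p.1 p.2 * ψ p) atTop
      (𝓝 (∫ p in halfStrip T, Z p.1 p.2 * ψ p)) := by
  obtain ⟨K, hK⟩ := lintegral_halfStrip_mul_le hT h
  refine tendsto_integral_of_L1 _ (hZ.integrableOn_mul hσ hc hF hfin hT h).aestronglyMeasurable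
    (Eventually.of_forall fun n => integrableOn_partialWave_mul hσ hc hF hfin h n) ?_
  have hlim := ENNReal.Tendsto.const_mul (a := (K : ℝ≥0∞))
    (tendsto_weightedENorm_sub_freqTrunc hF hfin) (Or.inr (by simp))
  rw [mul_zero] at hlim
  refine tendsto_of_tendsto_of_tendsto_of_le_of_le tendsto_const_nhds hlim (fun _ => bot_le)
    fun n => ?_
  simp only [← sub_mul]
  exact hK (fun p => partialWave c F n p.1 p.2 - Z p.1 p.2) _
    ((stronglyMeasurable_partialWave c hF n).sub hZ.measurable) fun x hx => hZ.approx x hx n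

/-- The pairing of an elementary solution with a test function. -/
def elementaryPairing (c : ℂ) (ψ : ℝ × ℝ → ℂ) (ξ : ℝ) : ℂ :=
  ∫ p : ℝ × ℝ, temporalFactor p.2 ξ * spatialFactor c p.1 ξ * ψ p

theorem integral_partialWave_mul (hσ : 0 ≤ σ) (hc : 0 ≤ c.re) (hF : Measurable F)
    (hfin : weightedENorm σ F < ⊤) (h : IsTestFunctionOn (halfStrip T) ψ) (n : ℕ) :
    ∫ p in halfStrip T, partialWave c F n p.1 p.2 * ψ p =
      ∫ ξ, freqTrunc n F ξ * elementaryPairing c ψ ξ := by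
  rw [setIntegral_halfStrip h fun p => partialWave c F n p.1 p.2]
  have hψ : Integrable ψ := h.1.continuous.integrable_of_hasCompactSupport h.2.1
  have hi := integrable_freqTrunc hσ hF hfin n
  have hmeas : AEStronglyMeasurable (fun z : (ℝ × ℝ) × ℝ =>
      temporalFactor z.1.2 z.2 * (spatialFactor c z.1.1 z.2 * freqTrunc n F z.2) * ψ z.1)
      ((volume : Measure (ℝ × ℝ)).prod volume) := by
    have h1 := continuous_temporalFactor.measurable.comp
      (show Measurable fun p : (ℝ × ℝ) × ℝ => (p.1.2, p.2) by fun_prop)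
    have h2 := (continuous_spatialFactor c).measurable.comp
      (show Measurable fun p : (ℝ × ℝ) × ℝ => (p.1.1, p.2) by fun_prop)
    exact ((h1.mul (h2.mul ((measurable_freqTrunc hF n).comp measurable_snd))).mul
      (h.1.continuous.measurable.comp measurable_fst)).aestronglyMeasurable
  have hprod : Integrable (fun z : (ℝ × ℝ) × ℝ =>
      temporalFactor z.1.2 z.2 * (spatialFactor c z.1.1 z.2 * freqTrunc n F z.2) * ψ z.1)
      ((volume : Measure (ℝ × ℝ)).prod volume) := by
    refine (hψ.mul_prod hi).mono hmeas (Eventually.of_forall fun z => ?_)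
    by_cases hz : z.1 ∈ halfStrip T
    · rw [norm_mul, norm_mul, norm_mul, norm_temporalFactor, one_mul, norm_mul, mul_comm]
      gcongr
      exact mul_le_of_le_one_left (norm_nonneg _) (norm_spatialFactor_le hc (le_of_lt hz.1) _)
    · rw [image_eq_zero_of_notMem_tsupport fun h' => hz (h.2.2 h')]
      simp
  calc _ = ∫ p : ℝ × ℝ, ∫ ξ,
      temporalFactor p.2 ξ * (spatialFactor c p.1 ξ * freqTrunc n F ξ) * ψ p := by
        congr with p
        rw [integral_mul_const]
        rfl
    _ = ∫ ξ, ∫ p : ℝ × ℝ,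
      temporalFactor p.2 ξ * (spatialFactor c p.1 ξ * freqTrunc n F ξ) * ψ p :=
        integral_integral_swap hprod
    _ = _ := by
        congr with ξ
        unfold elementaryPairing
        rw [← integral_const_mul]
        congr with p
        ring

theorem continuous_elementary (c : ℂ) (ξ : ℝ) :
    Continuous fun p : ℝ × ℝ => temporalFactor p.2 ξ * spatialFactor c p.1 ξ := by
  unfold temporalFactor spatialFactor
  fun_prop

theorem integral_cexp_mul_deriv {f : ℝ → ℂ} (hf : ContDiff ℝ ∞ f) (hc : HasCompactSupport f)
    (a : ℂ) : ∫ x : ℝ, Complex.exp (a * x) * deriv f x = -a * ∫ x : ℝ, Complex.exp (a * x) * f x := by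
  have hu : ∀ x : ℝ, HasDerivAt (fun x : ℝ => Complex.exp (a * x)) (Complex.exp (a * x) * a) x := by
    intro x
    simpa using ((Complex.ofRealCLM.hasDerivAt (x := x)).const_mul a).cexp
  have hv : ∀ x, HasDerivAt f (deriv f x) x := fun x =>
    (hf.differentiable (by simp) x).hasDerivAt
  have hE : Continuous fun x : ℝ => Complex.exp (a * x) := by fun_prop
  have h1 := integral_mul_deriv_eq_deriv_mul_of_integrable (u := fun x : ℝ => Complex.exp (a * x))
    (v := f) (u' := fun x => Complex.exp (a * x) * a) (v' := deriv f) (fun x _ => hu x) (fun x _ => hv x)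
    ((hE.mul (hf.continuous_deriv (by simp))).integrable_of_hasCompactSupport hc.deriv.mul_left)
    (((hE.mul continuous_const).mul hf.continuous).integrable_of_hasCompactSupport hc.mul_left)
    ((hE.mul hf.continuous).integrable_of_hasCompactSupport hc.mul_left)
  rw [h1, ← integral_const_mul, ← integral_neg]
  congr with x
  ring

theorem IsTestFunctionOn.slice_fst {Ω : Set (ℝ × ℝ)} (h : IsTestFunctionOn Ω ψ) (t : ℝ) :
    ContDiff ℝ ∞ (fun y => ψ (y, t)) ∧ HasCompactSupport (fun y => ψ (y, t)) := by
  refine ⟨h.1.comp (contDiff_id.prodMk contDiff_const), ?_⟩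
  refine HasCompactSupport.intro (h.2.1.isCompact.image continuous_fst) fun x hx => ?_
  exact image_eq_zero_of_notMem_tsupport fun h' => hx ⟨_, h', rfl⟩

theorem IsTestFunctionOn.slice_snd {Ω : Set (ℝ × ℝ)} (h : IsTestFunctionOn Ω ψ) (x : ℝ) :
    ContDiff ℝ ∞ (fun y => ψ (x, y)) ∧ HasCompactSupport (fun y => ψ (x, y)) := by
  refine ⟨h.1.comp (contDiff_const.prodMk contDiff_id), ?_⟩
  refine HasCompactSupport.intro (h.2.1.isCompact.image continuous_snd) fun t ht => ?_
  exact image_eq_zero_of_notMem_tsupport fun h' => ht ⟨_, h', rfl⟩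

/-- One integration by parts in x: differentiating the test function multiplies the pairing by minus
the exponent -cμ. -/
theorem elementaryPairing_partialFst {Ω : Set (ℝ × ℝ)} (h : IsTestFunctionOn Ω ψ) (c : ℂ) (ξ : ℝ) :
    elementaryPairing c (partialFst ψ) ξ = c * rootModulus ξ * elementaryPairing c ψ ξ := by
  unfold elementaryPairing
  have i1 := integrable_of_isTestFunctionOn h.partialFst (continuous_elementary c ξ)
  have i2 := integrable_of_isTestFunctionOn h (continuous_elementary c ξ)
  rw [Measure.volume_eq_prod] at i1 i2 ⊢
  rw [integral_prod_symm _ i1, integral_prod_symm _ i2, ← integral_const_mul]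
  congr with t
  simp_rw [mul_assoc, integral_const_mul]
  have := integral_cexp_mul_deriv (h.slice_fst t).1 (h.slice_fst t).2 (-c * rootModulus ξ)
  simp only [spatialFactor, partialFst]
  rw [this]
  ring

theorem elementaryPairing_partialSnd {Ω : Set (ℝ × ℝ)} (h : IsTestFunctionOn Ω ψ) (c : ℂ) (ξ : ℝ) :
    elementaryPairing c (partialSnd ψ) ξ =
      -(2 * Real.pi * Complex.I * ξ) * elementaryPairing c ψ ξ := by
  unfold elementaryPairing
  have i1 := integrable_of_isTestFunctionOn h.partialSnd (continuous_elementary c ξ)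
  have i2 := integrable_of_isTestFunctionOn h (continuous_elementary c ξ)
  rw [Measure.volume_eq_prod] at i1 i2 ⊢
  rw [integral_prod _ i1, integral_prod _ i2, ← integral_const_mul]
  congr with x
  have e : ∀ (f : ℝ × ℝ → ℂ) (t : ℝ), temporalFactor t ξ * spatialFactor c x ξ * f (x, t) =
      spatialFactor c x ξ * (temporalFactor t ξ * f (x, t)) := fun f t => by ring
  simp_rw [e, integral_const_mul]
  have := integral_cexp_mul_deriv (h.slice_snd x).1 (h.slice_snd x).2 (2 * Real.pi * Complex.I * ξ)
  simp only [temporalFactor, partialSnd]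
  rw [this]
  ring

/-- For truncated waves both pairings are integrals over ξ, where the identity is pointwise; the
truncation is then removed by continuity of the pairings. -/
theorem IsWave.weak_dx {σ' : ℝ} {Z' : ℝ → ℝ → ℂ} (hZ : IsWave σ c F Z)
    (hZ' : IsWave σ' c (fun ξ => -c * rootModulus ξ * F ξ) Z') (hσ : 0 ≤ σ) (hσ' : 0 ≤ σ')
    (hc : 0 ≤ c.re) (hF : Measurable F) (hfin : weightedENorm σ F < ⊤)
    (hfin' : weightedENorm σ' (fun ξ => -c * rootModulus ξ * F ξ) < ⊤) (hT : 0 < T)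
    (h : IsTestFunctionOn (halfStrip T) ψ) :
    ∫ p in halfStrip T, Z p.1 p.2 * partialFst ψ p = -∫ p in halfStrip T, Z' p.1 p.2 * ψ p := by
  have hF' : Measurable fun ξ => -c * rootModulus ξ * F ξ := by
    have := continuous_rootModulus.measurable
    fun_prop
  refine tendsto_nhds_unique (hZ.tendsto_pairing hσ hc hF hfin hT h.partialFst) ?_
  refine ((hZ'.tendsto_pairing hσ' hc hF' hfin' hT h).neg).congr fun n => ?_
  rw [integral_partialWave_mul hσ hc hF hfin h.partialFst, integral_partialWave_mul hσ' hc hF' hfin' h,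
    ← integral_neg]
  congr with ξ
  rw [elementaryPairing_partialFst h]
  unfold freqTrunc
  by_cases hξ : ξ ∈ Icc (-n : ℝ) n
  · simp only [indicator_of_mem hξ]; ring
  · simp only [indicator_of_notMem hξ]; ring

/-- After pairing, -i∂_t and ∂_x⁴ acting on the test function become multiplication by -2πξ and
(cμ)⁴, which cancel on the support of F. -/
theorem IsWave.weak_equation (hZ : IsWave σ c F Z) (hσ : 0 ≤ σ) (hc : 0 ≤ c.re)
    (hF : Measurable F) (hfin : weightedENorm σ F < ⊤) (hT : 0 < T)
    (hchar : ∀ ξ, F ξ ≠ 0 → (c * rootModulus ξ) ^ 4 = 2 * Real.pi * ξ)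
    (h : IsTestFunctionOn (halfStrip T) ψ) :
    ∫ p in halfStrip T, Z p.1 p.2 * (-Complex.I * partialSnd ψ p +
      partialFst (partialFst (partialFst (partialFst ψ))) p) = 0 := by
  have i1 := hZ.integrableOn_mul hσ hc hF hfin hT h.partialSnd
  have h4 := h.partialFst.partialFst.partialFst.partialFst
  have i2 := hZ.integrableOn_mul hσ hc hF hfin hT h4
  have e : ∀ p : ℝ × ℝ, Z p.1 p.2 * (-Complex.I * partialSnd ψ p +
      partialFst (partialFst (partialFst (partialFst ψ))) p) =
      -Complex.I * (Z p.1 p.2 * partialSnd ψ p) +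
      Z p.1 p.2 * partialFst (partialFst (partialFst (partialFst ψ))) p := fun p => by ring
  simp_rw [e]
  rw [integral_add (i1.const_mul _) i2, integral_const_mul]
  have l1 := ((hZ.tendsto_pairing hσ hc hF hfin hT h.partialSnd).const_mul (-Complex.I)).add
    (hZ.tendsto_pairing hσ hc hF hfin hT h4)
  refine tendsto_nhds_unique l1 (tendsto_const_nhds.congr fun n => ?_)
  rw [integral_partialWave_mul hσ hc hF hfin h.partialSnd, integral_partialWave_mul hσ hc hF hfin h4,
    ← integral_const_mul]
  have e2 : ∀ ξ, -Complex.I * (freqTrunc n F ξ * elementaryPairing c (partialSnd ψ) ξ) =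
      -(freqTrunc n F ξ * elementaryPairing c
        (partialFst (partialFst (partialFst (partialFst ψ)))) ξ) := by
    intro ξ
    rw [elementaryPairing_partialFst h.partialFst.partialFst.partialFst,
      elementaryPairing_partialFst h.partialFst.partialFst,
      elementaryPairing_partialFst h.partialFst, elementaryPairing_partialFst h,
      elementaryPairing_partialSnd h]
    unfold freqTrunc
    by_cases hξ : ξ ∈ Icc (-n : ℝ) n
    · rw [indicator_of_mem hξ]
      by_cases h0 : F ξ = 0
      · simp [h0]
      · have := hchar ξ h0
        linear_combination (F ξ * elementaryPairing c ψ ξ) * this +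
          (2 * Real.pi * ξ * F ξ * elementaryPairing c ψ ξ) * Complex.I_sq
    · simp [indicator_of_notMem hξ]
  simp_rw [e2]
  rw [integral_neg, neg_add_cancel]

end Pairing

end

/-! ### Cauchy's theorem in the right half-plane, Laplace transforms and the analytic root -/

noncomputable section

/-- Cauchy's theorem on the rectangle [0,R] × [-R,R]: the other sides have total length 4R and the
integrand is O(R^{-2}) there. Only continuity is asked on the axis, because the fourth root is not
differentiable at 0. -/
theorem integral_imaginary_axis_eq_zero {F : ℂ → ℂ} (hcont : ContinuousOn F {z | 0 ≤ z.re})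
    (hdiff : DifferentiableOn ℂ F {z | 0 < z.re}) {C : ℝ}
    (hb : ∀ z : ℂ, 0 ≤ z.re → 1 ≤ ‖z‖ → ‖F z‖ ≤ C / ‖z‖ ^ 2) :
    ∫ y : ℝ, F (y * Complex.I) = 0 := by
  have hFc : Continuous fun y : ℝ => F (y * Complex.I) := by
    refine hcont.comp_continuous (by fun_prop) fun y => ?_
    simp
  have hint : Integrable fun y : ℝ => F (y * Complex.I) := by
    obtain ⟨B, hB⟩ := (isCompact_Icc (a := (-1 : ℝ)) (b := 1)).exists_bound_of_continuousOn
      hFc.continuousOn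
    -- The 2 absorbs 1 + y² ≤ 2 where |y| ≤ 1 and 1 + y² ≤ 2y² elsewhere.
    refine Integrable.mono' (integrable_inv_one_add_sq.const_mul (2 * (|B| + |C|)))
      hFc.aestronglyMeasurable (Eventually.of_forall fun y => ?_)
    rw [← div_eq_mul_inv, le_div_iff₀ (by positivity)]
    by_cases hy : |y| ≤ 1
    · have h1 := hB y (abs_le.1 hy)
      have h2 : y ^ 2 ≤ 1 := by rw [← sq_abs]; nlinarith [abs_nonneg y]
      nlinarith [le_abs_self B, abs_nonneg C, norm_nonneg (F (y * Complex.I)), sq_nonneg y]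
    · push Not at hy
      have h1 := hb (y * Complex.I) (by simp) (by simpa using hy.le)
      simp only [norm_mul, Complex.norm_real, Complex.norm_I, mul_one, Real.norm_eq_abs,
        sq_abs] at h1
      have h2 : 1 ≤ y ^ 2 := by rw [← sq_abs]; nlinarith
      rw [le_div_iff₀ (by linarith)] at h1
      nlinarith [le_abs_self C, abs_nonneg B, norm_nonneg (F (y * Complex.I))]
  have hlim1 : Tendsto (fun R : ℝ => ∫ y in (-R)..R, F (y * Complex.I)) atTop
      (𝓝 (∫ y : ℝ, F (y * Complex.I))) :=
    intervalIntegral_tendsto_integral hint tendsto_neg_atTop_atBot tendsto_id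
  have hlim2 : Tendsto (fun R : ℝ => 4 * |C| / R) atTop (𝓝 0) :=
    tendsto_const_nhds.div_atTop tendsto_id
  refine tendsto_nhds_unique hlim1 (squeeze_zero_norm' ?_ hlim2)
  filter_upwards [eventually_ge_atTop 1] with R hR
  have hR0 : 0 < R := by linarith
  have hrect := Complex.integral_boundary_rect_eq_zero_of_continuousOn_of_differentiableOn F
    (-(R : ℂ) * Complex.I) (R + R * Complex.I)
    (hcont.mono (by
      intro z hz
      have := hz.1
      simp only [mem_preimage, Complex.mul_re, Complex.neg_re, Complex.ofReal_re, Complex.I_re,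
        mul_zero, Complex.neg_im, Complex.ofReal_im, neg_zero, Complex.I_im, mul_one, sub_self,
        Complex.add_re, add_zero] at this
      rw [uIcc_of_le hR0.le] at this
      exact this.1))
    (hdiff.mono (by
      intro z hz
      have := hz.1
      simp only [mem_preimage, Complex.mul_re, Complex.neg_re, Complex.ofReal_re, Complex.I_re,
        mul_zero, Complex.neg_im, Complex.ofReal_im, neg_zero, Complex.I_im, mul_one, sub_self,
        Complex.add_re, add_zero, min_eq_left hR0.le] at this
      exact this.1))
  simp only [Complex.mul_re, Complex.neg_re, Complex.ofReal_re, Complex.I_re,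
        mul_zero, Complex.neg_im, Complex.ofReal_im, neg_zero, Complex.I_im, mul_one, sub_self,
        Complex.add_re, add_zero, Complex.mul_im, Complex.add_im, zero_add,
        Complex.ofReal_zero, smul_eq_mul, Complex.ofReal_neg] at hrect
  have hside : ∀ z : ℂ, 0 ≤ z.re → R ≤ ‖z‖ → ‖F z‖ ≤ |C| / R ^ 2 := by
    intro z hz hzR
    refine (hb z hz (hR.trans hzR)).trans ?_
    gcongr
    exact le_abs_self C
  have s1 : ‖∫ x in (0 : ℝ)..R, F (x + -(R : ℂ) * Complex.I)‖ ≤ |C| / R ^ 2 * |R - 0| := by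
    refine intervalIntegral.norm_integral_le_of_norm_le_const fun x hx => ?_
    rw [uIoc_of_le hR0.le] at hx
    refine hside _ (by simpa using hx.1.le) ?_
    refine le_trans ?_ (Complex.abs_im_le_norm _)
    simp [abs_of_pos hR0]
  have s2 : ‖∫ x in (0 : ℝ)..R, F (x + (R : ℂ) * Complex.I)‖ ≤ |C| / R ^ 2 * |R - 0| := by
    refine intervalIntegral.norm_integral_le_of_norm_le_const fun x hx => ?_
    rw [uIoc_of_le hR0.le] at hx
    refine hside _ (by simpa using hx.1.le) ?_
    refine le_trans ?_ (Complex.abs_im_le_norm _)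
    simp [abs_of_pos hR0]
  have s3 : ‖∫ y in (-R)..R, F (R + (y : ℂ) * Complex.I)‖ ≤ |C| / R ^ 2 * |R - -R| := by
    refine intervalIntegral.norm_integral_le_of_norm_le_const fun y hy => ?_
    refine hside _ (by simpa using hR0.le) ?_
    refine le_trans ?_ (Complex.abs_re_le_norm _)
    simp [abs_of_pos hR0]
  set A1 := ∫ x in (0 : ℝ)..R, F (x + -(R : ℂ) * Complex.I)
  set A2 := ∫ x in (0 : ℝ)..R, F (x + (R : ℂ) * Complex.I)
  set A3 := ∫ y in (-R)..R, F (R + (y : ℂ) * Complex.I)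
  set A4 := ∫ y in (-R)..R, F ((y : ℂ) * Complex.I)
  have e : A4 = -Complex.I * (A1 - A2) + A3 := by
    linear_combination (Complex.I) * hrect + (-A3 + A4) * Complex.I_sq
  rw [e]
  calc _ ≤ ‖-Complex.I * (A1 - A2)‖ + ‖A3‖ := norm_add_le _ _
    _ ≤ (‖A1‖ + ‖A2‖) + ‖A3‖ := by
        gcongr
        rw [norm_mul, norm_neg, Complex.norm_I, one_mul]
        exact norm_sub_le _ _
    _ ≤ (|C| / R ^ 2 * |R - 0| + |C| / R ^ 2 * |R - 0|) + |C| / R ^ 2 * |R - -R| := by gcongr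
    _ = 4 * |C| / R := by
        rw [sub_zero, sub_neg_eq_add, abs_of_pos hR0, abs_of_pos (by linarith : 0 < R + R)]
        field_simp
        ring

/-- The Laplace transform of a function on `(0,T)`. -/
def laplaceOn (T : ℝ) (h : ℝ → ℂ) (z : ℂ) : ℂ := ∫ t in Ioo 0 T, Complex.exp (-z * t) * h t

/-- The interval is bounded, so the exponential and its z-derivative are bounded uniformly for z in
a unit ball, and one may differentiate under the integral anywhere in ℂ. -/
theorem differentiable_laplaceOn {T : ℝ} {h : ℝ → ℂ} (hh : IntegrableOn h (Ioo 0 T)) :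
    Differentiable ℂ (laplaceOn T h) := by
  intro z₀
  set B : ℝ := |T| * Real.exp ((‖z₀‖ + 1) * |T|) with hB
  have hbd : ∀ z : ℂ, ∀ t ∈ Ioo 0 T, z ∈ Metric.ball z₀ 1 →
      ‖Complex.exp (-z * t)‖ ≤ Real.exp ((‖z₀‖ + 1) * |T|) := by
    intro z t ht hz
    rw [Complex.norm_exp, Real.exp_le_exp]
    have h1 : ‖z‖ ≤ ‖z₀‖ + 1 := by
      rw [mem_ball_iff_norm] at hz
      calc ‖z‖ = ‖z₀ + (z - z₀)‖ := by ring_nf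
        _ ≤ ‖z₀‖ + ‖z - z₀‖ := norm_add_le _ _
        _ ≤ _ := by linarith
    have h2 : |t| ≤ |T| := by
      rw [abs_of_pos ht.1]; exact ht.2.le.trans (le_abs_self T)
    calc (-z * t).re ≤ ‖-z * t‖ := Complex.re_le_norm _
      _ = ‖z‖ * |t| := by simp
      _ ≤ _ := by gcongr
  have key := hasDerivAt_integral_of_dominated_loc_of_deriv_le (μ := volume.restrict (Ioo 0 T))
    (F := fun z t => Complex.exp (-z * t) * h t) (F' := fun z t => -t * Complex.exp (-z * t) * h t)
    (x₀ := z₀) (s := Metric.ball z₀ 1) (bound := fun t => B * ‖h t‖) (Metric.ball_mem_nhds _ one_pos)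
    (Eventually.of_forall fun z => (Continuous.aestronglyMeasurable (by fun_prop)).mul
      hh.aestronglyMeasurable)
    (hh.bdd_mul (c := Real.exp ((‖z₀‖ + 1) * |T|)) (Continuous.aestronglyMeasurable (by fun_prop))
      (by filter_upwards [ae_restrict_mem measurableSet_Ioo] with t ht using
            hbd z₀ t ht (Metric.mem_ball_self one_pos)))
    ((Continuous.aestronglyMeasurable (by fun_prop)).mul hh.aestronglyMeasurable)
    (by
      filter_upwards [ae_restrict_mem measurableSet_Ioo] with t ht z hz
      rw [norm_mul, norm_mul, hB]
      gcongr
      · rw [norm_neg, Complex.norm_real, Real.norm_eq_abs, abs_of_pos ht.1]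
        exact ht.2.le.trans (le_abs_self T)
      · exact hbd z t ht hz)
    (hh.norm.const_mul B)
    (Eventually.of_forall fun t z _ => by
      have : HasDerivAt (fun z : ℂ => -z * t) (-t) z := by
        simpa using (hasDerivAt_id z).neg.mul_const (t : ℂ)
      refine (this.cexp.mul_const (h t)).congr_deriv ?_
      ring)
  exact key.2.differentiableAt

theorem norm_laplaceOn_le {T : ℝ} {h : ℝ → ℂ} (hh : IntegrableOn h (Ioo 0 T)) {z : ℂ}
    (hz : 0 ≤ z.re) : ‖laplaceOn T h z‖ ≤ ∫ t in Ioo 0 T, ‖h t‖ := by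
  refine norm_integral_le_of_norm_le hh.norm ?_
  filter_upwards [ae_restrict_mem measurableSet_Ioo] with t ht
  rw [norm_mul]
  refine mul_le_of_le_one_left (norm_nonneg _) ?_
  rw [Complex.norm_exp, Real.exp_le_one_iff]
  have := ht.1
  simp
  positivity

/-- The root `ρ = e^{-iπ/8} z^{1/4}` of the characteristic equation `ρ⁴ = -iz`; the decaying roots
are `-ρ` and `-iρ`. -/
def charRoot (z : ℂ) : ℂ := Complex.exp (-(Real.pi / 8 : ℝ) * Complex.I) * z ^ (1 / 4 : ℂ)

theorem norm_charRoot (z : ℂ) : ‖charRoot z‖ = ‖z‖ ^ (1 / 4 : ℝ) := by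
  unfold charRoot
  rw [norm_mul, ← Complex.ofReal_neg, Complex.norm_exp_ofReal_mul_I, one_mul]
  have := Complex.norm_cpow_real z (1 / 4)
  simpa using this

theorem charRoot_eq {z : ℂ} (hz : z ≠ 0) :
    charRoot z = (‖z‖ ^ (1 / 4 : ℝ) : ℝ) *
      Complex.exp ((z.arg / 4 - Real.pi / 8 : ℝ) * Complex.I) := by
  unfold charRoot
  rw [Complex.cpow_def_of_ne_zero hz, ← Complex.exp_add, Real.rpow_def_of_pos (norm_pos_iff.2 hz),
    Complex.ofReal_exp, ← Complex.exp_add]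
  congr 1
  rw [Complex.log]
  push_cast
  ring

/-- For Re z ≥ 0 the argument of the root is arg z/4 - π/8, in [-π/4, 0]. The rotation by e^{-iπ/8}
is chosen so that both ρ and iρ stay in the closed right half-plane. -/
theorem charRoot_cone {z : ℂ} (hz : 0 ≤ z.re) :
    0 ≤ (charRoot z).re ∧ 0 ≤ (Complex.I * charRoot z).re := by
  by_cases h0 : z = 0
  · simp [h0, charRoot]
  have harg := abs_le.1 (Complex.abs_arg_le_pi_div_two_iff.2 hz)
  have hpi := Real.pi_pos
  rw [charRoot_eq h0]
  constructor
  · rw [Complex.re_ofReal_mul, Complex.exp_ofReal_mul_I_re]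
    refine mul_nonneg (by positivity) (Real.cos_nonneg_of_mem_Icc ⟨?_, ?_⟩) <;> linarith [harg.1, harg.2]
  · rw [Complex.I_mul_re, Complex.im_ofReal_mul, Complex.exp_ofReal_mul_I_im, ← mul_neg,
      ← Real.sin_neg]
    refine mul_nonneg (by positivity) (Real.sin_nonneg_of_nonneg_of_le_pi ?_ ?_) <;>
      linarith [harg.1, harg.2]

theorem charRoot_of_pos {ξ : ℝ} (hξ : 0 < ξ) :
    charRoot (2 * Real.pi * Complex.I * ξ) = rootModulus ξ := by
  have e : (2 * Real.pi * Complex.I * ξ : ℂ) = (2 * Real.pi * ξ : ℝ) * Complex.I := by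
    push_cast; ring
  have hp : 0 < 2 * Real.pi * ξ := by positivity
  rw [e, charRoot_eq (by simpa using hp.ne'), Complex.arg_real_mul _ hp, Complex.arg_I]
  rw [show Real.pi / 2 / 4 - Real.pi / 8 = 0 by ring]
  simp only [norm_mul, Complex.norm_real, Complex.norm_I, mul_one, Real.norm_eq_abs]
  simp [rootModulus, abs_of_pos Real.pi_pos]

theorem charRoot_of_neg {ξ : ℝ} (hξ : ξ < 0) :
    charRoot (2 * Real.pi * Complex.I * ξ) =
      Complex.exp (-(Real.pi / 4 : ℝ) * Complex.I) * rootModulus ξ := by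
  have e : (2 * Real.pi * Complex.I * ξ : ℂ) = (2 * Real.pi * -ξ : ℝ) * (-Complex.I) := by
    push_cast; ring
  have hp : 0 < 2 * Real.pi * -ξ := by
    have : 0 < -ξ := by linarith
    positivity
  rw [e, charRoot_eq (by
    rw [mul_ne_zero_iff]; exact ⟨by exact_mod_cast hp.ne', by simp⟩), Complex.arg_real_mul _ hp,
    Complex.arg_neg_I]
  rw [show -(Real.pi / 2) / 4 - Real.pi / 8 = -(Real.pi / 4) by ring]
  simp only [norm_mul, Complex.norm_real, norm_neg, Complex.norm_I, mul_one, Real.norm_eq_abs]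
  rw [mul_comm]
  simp [rootModulus, abs_of_pos Real.pi_pos]

/-- The exponent 1/4 is positive, so continuity includes the branch point z = 0, which lies on the
contour. -/
theorem continuousOn_charRoot : ContinuousOn charRoot {z | 0 ≤ z.re} := by
  intro z hz
  refine ContinuousAt.continuousWithinAt ?_
  unfold charRoot
  refine continuousAt_const.mul ?_
  have h1 : ContinuousAt (fun p : ℂ × ℂ => p.1 ^ p.2) (z, 1 / 4) :=
    Complex.continuousAt_cpow_of_re_pos (Or.inl hz) (by norm_num)
  exact h1.comp (f := fun w : ℂ => (w, (1 / 4 : ℂ))) (by fun_prop)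

theorem differentiableOn_charRoot : DifferentiableOn ℂ charRoot {z | 0 < z.re} := by
  intro z hz
  refine DifferentiableAt.differentiableWithinAt ?_
  unfold charRoot
  exact (differentiableAt_const _).mul (differentiableAt_id.cpow_const (Or.inl hz))

/-- Plancherel applied to the conjugate of k, which turns the inner product into a bilinear pairing.
-/
theorem integral_invFourierL2_mul {g k : ℝ → ℂ} (hg : MemLp g 2) (hk : MemLp k 2)
    (hk1 : Integrable k) : ∫ t, invFourierL2 g t * k t = ∫ ξ, g ξ * 𝓕⁻ k ξ := by
  have hkc : MemLp (fun t => (starRingEnd ℂ) (k t)) 2 := by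
    refine ⟨(Complex.continuous_conj.comp_aestronglyMeasurable hk.1), ?_⟩
    rw [eLpNorm_congr_norm_ae (g := k) (Eventually.of_forall fun t => by simp)]
    exact hk.2
  have hkc1 : Integrable (fun t => (starRingEnd ℂ) (k t)) :=
    hk1.mono hkc.1 (Eventually.of_forall fun t => by simp)
  have h1 := Lp.inner_fourier_eq (hkc.toLp _) (invFourierL2 g)
  rw [L2.inner_def, L2.inner_def] at h1
  have e1 : ∫ t, inner ℂ ((hkc.toLp _ : Lp ℂ 2 (volume : Measure ℝ)) t) (invFourierL2 g t) =
      ∫ t, invFourierL2 g t * k t := by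
    apply integral_congr_ae
    filter_upwards [hkc.coeFn_toLp] with t ht
    rw [ht]
    simp
  have e2 : ∫ ξ, inner ℂ ((𝓕 (hkc.toLp _) : Lp ℂ 2 (volume : Measure ℝ)) ξ)
      ((𝓕 (invFourierL2 g) : Lp ℂ 2 (volume : Measure ℝ)) ξ) = ∫ ξ, g ξ * 𝓕⁻ k ξ := by
    apply integral_congr_ae
    filter_upwards [Integrable.fourier_toLp_ae_eq hkc1 hkc, fourier_invFourierL2 hg] with ξ h1 h2
    rw [h1, h2]
    simp only [RCLike.inner_apply]
    congr 1
    rw [Real.fourier_eq', Real.fourierInv_eq', ← integral_conj]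
    congr with t
    simp only [smul_eq_mul, map_mul, Complex.conj_conj, ← Complex.exp_conj, Complex.conj_ofReal,
      Complex.conj_I]
    congr 2
    push_cast
    ring
  rw [← e1, ← e2, h1]

end

/-! ### The transformed solution and causality -/

noncomputable section

/-- The response at `x` to Dirichlet data, as a function of the characteristic root. -/
def dirichletSymbol (x : ℝ) (w : ℂ) : ℂ :=
  (Complex.exp (-Complex.I * w * x) - Complex.I * Complex.exp (-w * x)) / (1 - Complex.I)

/-- The response at `x` to Neumann data, times the characteristic root. -/
def neumannSymbol (x : ℝ) (w : ℂ) : ℂ :=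
  (Complex.exp (-Complex.I * w * x) - Complex.exp (-w * x)) / (1 - Complex.I)

theorem one_le_norm_one_sub_I : 1 ≤ ‖(1 - Complex.I : ℂ)‖ := by
  have := Complex.abs_re_le_norm (1 - Complex.I)
  simpa using this

theorem one_sub_I_ne_zero : (1 - Complex.I : ℂ) ≠ 0 := by
  intro h
  have := one_le_norm_one_sub_I
  rw [h, norm_zero] at this
  linarith

theorem norm_cexp_cone {x : ℝ} (hx : 0 ≤ x) {w : ℂ} (h1 : 0 ≤ w.re)
    (h2 : 0 ≤ (Complex.I * w).re) :
    ‖Complex.exp (-Complex.I * w * x)‖ ≤ 1 ∧ ‖Complex.exp (-w * x)‖ ≤ 1 := by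
  constructor
  · rw [Complex.norm_exp, Real.exp_le_one_iff, Complex.re_mul_ofReal, neg_mul, Complex.neg_re,
      neg_mul, Left.neg_nonpos_iff]
    positivity
  · rw [Complex.norm_exp, Real.exp_le_one_iff, Complex.re_mul_ofReal, Complex.neg_re, neg_mul,
      Left.neg_nonpos_iff]
    positivity

theorem norm_dirichletSymbol_le {x : ℝ} (hx : 0 ≤ x) {w : ℂ} (h1 : 0 ≤ w.re)
    (h2 : 0 ≤ (Complex.I * w).re) : ‖dirichletSymbol x w‖ ≤ 2 := by
  unfold dirichletSymbol
  obtain ⟨a, b⟩ := norm_cexp_cone hx h1 h2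
  rw [norm_div, div_le_iff₀ (by linarith [one_le_norm_one_sub_I])]
  calc _ ≤ ‖Complex.exp (-Complex.I * w * x)‖ + ‖Complex.I * Complex.exp (-w * x)‖ :=
        norm_sub_le _ _
    _ ≤ 1 + 1 := by
        rw [norm_mul, Complex.norm_I, one_mul]; gcongr
    _ ≤ _ := by linarith [one_le_norm_one_sub_I]

theorem norm_neumannSymbol_le {x : ℝ} (hx : 0 ≤ x) {w : ℂ} (h1 : 0 ≤ w.re)
    (h2 : 0 ≤ (Complex.I * w).re) : ‖neumannSymbol x w‖ ≤ 2 := by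
  unfold neumannSymbol
  obtain ⟨a, b⟩ := norm_cexp_cone hx h1 h2
  rw [norm_div, div_le_iff₀ (by linarith [one_le_norm_one_sub_I])]
  calc _ ≤ ‖Complex.exp (-Complex.I * w * x)‖ + ‖Complex.exp (-w * x)‖ :=
        norm_sub_le _ _
    _ ≤ 1 + 1 := by gcongr
    _ ≤ _ := by linarith [one_le_norm_one_sub_I]

theorem differentiable_dirichletSymbol (x : ℝ) : Differentiable ℂ (dirichletSymbol x) := by
  unfold dirichletSymbol
  fun_prop

theorem differentiable_neumannSymbol (x : ℝ) : Differentiable ℂ (neumannSymbol x) := by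
  unfold neumannSymbol
  fun_prop

theorem neumannSymbol_zero (x : ℝ) : neumannSymbol x 0 = 0 := by simp [neumannSymbol]

/-- The Neumann response is `neumannSymbol` divided by the root, with a removable singularity at 0;
`dslope` is its entire continuation and keeps the transformed solution continuous at z = 0. -/
theorem differentiable_dslope_neumannSymbol (x : ℝ) :
    Differentiable ℂ (dslope (neumannSymbol x) 0) := by
  rw [← differentiableOn_univ, Complex.differentiableOn_dslope univ_mem]
  exact (differentiable_neumannSymbol x).differentiableOn

theorem dslope_neumannSymbol (x : ℝ) {w : ℂ} (hw : w ≠ 0) :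
    dslope (neumannSymbol x) 0 w = neumannSymbol x w / w := by
  rw [dslope_of_ne _ hw, slope_def_field, neumannSymbol_zero, sub_zero, sub_zero]

/-- The Fourier–Laplace transform in time of the solution with boundary data `h₀`, `h₁`. -/
def solutionSymbol (T : ℝ) (h₀ h₁ : ℝ → ℂ) (x : ℝ) (z : ℂ) : ℂ :=
  dirichletSymbol x (charRoot z) * laplaceOn T h₀ z +
    dslope (neumannSymbol x) 0 (charRoot z) * laplaceOn T h₁ z

theorem norm_solutionSymbol_le {T : ℝ} {h₀ h₁ : ℝ → ℂ} (hh₀ : IntegrableOn h₀ (Ioo 0 T))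
    (hh₁ : IntegrableOn h₁ (Ioo 0 T)) {x : ℝ} (hx : 0 ≤ x) {z : ℂ} (hz : 0 ≤ z.re)
    (hz1 : 1 ≤ ‖z‖) : ‖solutionSymbol T h₀ h₁ x z‖ ≤
      2 * (∫ t in Ioo 0 T, ‖h₀ t‖) + 2 * ∫ t in Ioo 0 T, ‖h₁ t‖ := by
  obtain ⟨c1, c2⟩ := charRoot_cone hz
  have hρ : 1 ≤ ‖charRoot z‖ := by
    rw [norm_charRoot]
    exact Real.one_le_rpow hz1 (by norm_num)
  have hρ0 : charRoot z ≠ 0 := by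
    intro h
    rw [h, norm_zero] at hρ
    linarith
  unfold solutionSymbol
  refine (norm_add_le _ _).trans ?_
  rw [norm_mul, norm_mul]
  gcongr
  · exact norm_dirichletSymbol_le hx c1 c2
  · exact norm_laplaceOn_le hh₀ hz
  · rw [dslope_neumannSymbol x hρ0, norm_div]
    exact div_le_of_le_mul₀ (by positivity) (by norm_num)
      ((norm_neumannSymbol_le hx c1 c2).trans (by linarith))
  · exact norm_laplaceOn_le hh₁ hz

/-- The symbol is bounded for |z| ≥ 1, and dividing by (a+z)² supplies the quadratic decay. The pole
-a has real part -1, outside the half-plane. -/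
theorem integral_solutionSymbol_div_eq_zero {T : ℝ} {h₀ h₁ : ℝ → ℂ}
    (hh₀ : IntegrableOn h₀ (Ioo 0 T)) (hh₁ : IntegrableOn h₁ (Ioo 0 T)) {x : ℝ} (hx : 0 ≤ x)
    {a : ℂ} (ha : a.re = 1) :
    ∫ ξ : ℝ, solutionSymbol T h₀ h₁ x (2 * Real.pi * Complex.I * ξ) /
      (a + 2 * Real.pi * Complex.I * ξ) ^ 2 = 0 := by
  have hne : ∀ z : ℂ, 0 ≤ z.re → a + z ≠ 0 := by
    intro z hz h
    have := congrArg Complex.re h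
    simp [ha] at this
    linarith
  have hroot := continuousOn_charRoot
  have hmain := integral_imaginary_axis_eq_zero
    (F := fun z => solutionSymbol T h₀ h₁ x z / (a + z) ^ 2)
    (C := (2 * (∫ t in Ioo 0 T, ‖h₀ t‖) + 2 * ∫ t in Ioo 0 T, ‖h₁ t‖) * (1 + ‖a‖) ^ 2) ?_ ?_ ?_
  · have hs := Measure.integral_comp_mul_left (fun y : ℝ =>
      solutionSymbol T h₀ h₁ x (y * Complex.I) / (a + y * Complex.I) ^ 2) (2 * Real.pi)
    rw [hmain, smul_zero] at hs
    rw [← hs]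
    congr with ξ
    rw [show ((2 * Real.pi * ξ : ℝ) : ℂ) * Complex.I = 2 * Real.pi * Complex.I * ξ by
      push_cast; ring]
  · unfold solutionSymbol
    refine ContinuousOn.div ?_ (by fun_prop) fun z hz => pow_ne_zero 2 (hne z hz)
    exact (((differentiable_dirichletSymbol x).continuous.comp_continuousOn hroot).mul
      (differentiable_laplaceOn hh₀).continuous.continuousOn).add
      (((differentiable_dslope_neumannSymbol x).continuous.comp_continuousOn hroot).mul
      (differentiable_laplaceOn hh₁).continuous.continuousOn)
  · unfold solutionSymbol
    refine DifferentiableOn.div ?_ (by fun_prop) fun z hz => pow_ne_zero 2 (hne z (le_of_lt hz))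
    exact (((differentiable_dirichletSymbol x).comp_differentiableOn differentiableOn_charRoot).mul
      (differentiable_laplaceOn hh₀).differentiableOn).add
      (((differentiable_dslope_neumannSymbol x).comp_differentiableOn differentiableOn_charRoot).mul
      (differentiable_laplaceOn hh₁).differentiableOn)
  · intro z hz hz1
    rw [norm_div, norm_pow, div_le_div_iff₀ (by have := norm_pos_iff.2 (hne z hz); positivity)
      (by positivity), mul_assoc, ← mul_pow]
    have h1 : 1 ≤ ‖a + z‖ := by
      refine le_trans ?_ (Complex.abs_re_le_norm _)
      rw [Complex.add_re, ha]
      exact le_trans (by linarith) (le_abs_self _)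
    have h2 : ‖z‖ ≤ (1 + ‖a‖) * ‖a + z‖ := by
      have : ‖z‖ ≤ ‖a + z‖ + ‖a‖ := by
        calc ‖z‖ = ‖(a + z) - a‖ := by ring_nf
          _ ≤ _ := norm_sub_le _ _
      nlinarith [norm_nonneg a]
    gcongr
    exact norm_solutionSymbol_le hh₀ hh₁ hx hz hz1

/-- Causality: the solution vanishes at negative times. -/
theorem invFourierL2_solutionSymbol_eq_zero {T : ℝ} {h₀ h₁ : ℝ → ℂ}
    (hh₀ : IntegrableOn h₀ (Ioo 0 T)) (hh₁ : IntegrableOn h₁ (Ioo 0 T)) {x : ℝ} (hx : 0 ≤ x)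
    {g : ℝ → ℂ} (hg : MemLp g 2)
    (hgs : g =ᵐ[volume] fun ξ => solutionSymbol T h₀ h₁ x (2 * Real.pi * Complex.I * ξ)) :
    ∀ᵐ t, t < 0 → invFourierL2 g t = 0 := by
  -- The test function |t|e^{at} on t < 0 is chosen because its inverse transform is exactly (a +
  -- 2πiξ)^{-2}.
  set k : ℂ → ℝ → ℂ := fun a => (Iio 0).indicator fun t => -(t : ℂ) * Complex.exp (a * t) with hk
  have hkneg : ∀ a t, k a (-t) = (Ioi (0 : ℝ)).indicator
      (fun u : ℝ => (u : ℂ) ^ 1 * Complex.exp (-a * u)) t := by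
    intro a t
    simp only [hk, indicator_apply, mem_Iio, mem_Ioi, Left.neg_neg_iff]
    split_ifs
    · push_cast
      rw [pow_one]
      ring_nf
    · rfl
  have hki : ∀ a : ℂ, 0 < a.re → Integrable (k a) := by
    intro a ha
    have h1 := (integrable_indicator_iff measurableSet_Ioi).2 (integrableOn_pow_mul_cexp ha 1)
    have h2 : Integrable fun t => k a (-t) := h1.congr (Eventually.of_forall fun t => (hkneg a t).symm)
    simpa using h2.comp_neg
  have hkm : ∀ a, Measurable (k a) := fun a => by
    refine Measurable.indicator ?_ measurableSet_Iio
    fun_prop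
  have hk2 : MemLp (k 1) 2 := by
    rw [memLp_two_iff_integrable_sq_norm (hkm 1).aestronglyMeasurable]
    have h1 := (integrable_indicator_iff measurableSet_Ioi).2
      (integrableOn_pow_mul_cexp (r := 2) (by simp) 2)
    have h2 := h1.comp_neg.norm
    refine h2.congr (Eventually.of_forall fun t => ?_)
    simp only [hk, indicator_apply, mem_Iio, mem_Ioi, Left.neg_pos_iff]
    split_ifs
    · simp only [norm_mul, norm_neg, norm_pow, Complex.norm_real, Complex.norm_exp, mul_pow]
      rw [← Real.exp_nat_mul]
      simp
    · simp
  have hkexp : ∀ η t : ℝ, k (1 + 2 * Real.pi * Complex.I * η) t =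
      Complex.exp (2 * Real.pi * Complex.I * η * t) * k 1 t := by
    intro η t
    simp only [hk, indicator_apply]
    split_ifs
    · rw [mul_left_comm, ← Complex.exp_add]
      ring_nf
    · simp
  have hk2' : ∀ η : ℝ, MemLp (k (1 + 2 * Real.pi * Complex.I * η)) 2 := by
    intro η
    refine hk2.of_le (hkm _).aestronglyMeasurable (Eventually.of_forall fun t => ?_)
    rw [hkexp, norm_mul, Complex.norm_exp]
    simp
  have hkF : ∀ a : ℂ, 0 < a.re → ∀ ξ : ℝ, 𝓕⁻ (k a) ξ = 1 / (a + 2 * Real.pi * Complex.I * ξ) ^ 2 := by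
    intro a ha ξ
    rw [Real.fourierInv_eq', ← integral_neg_eq_self]
    simp_rw [hkneg]
    have h1 := integral_pow_mul_cexp (r := a + 2 * Real.pi * Complex.I * ξ) (by simpa using ha) 1
    rw [Nat.factorial_one, Nat.cast_one] at h1
    rw [← h1, ← integral_indicator measurableSet_Ioi]
    congr with t
    by_cases ht : t ∈ Ioi (0 : ℝ)
    · simp only [indicator_of_mem ht, smul_eq_mul]
      rw [mul_left_comm, ← Complex.exp_add]
      congr 2
      simp
      ring
    · simp [indicator_of_notMem ht]
  -- For a = 1 + 2πiη these integrals are the values of the Fourier transform, at -η, of the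
  -- solution times the kernel for a = 1. That product therefore vanishes almost everywhere, and its
  -- second factor is nonzero for t < 0.
  have hzero : ∀ η : ℝ, ∫ t, invFourierL2 g t * k (1 + 2 * Real.pi * Complex.I * η) t = 0 := by
    intro η
    have hre : (1 + 2 * Real.pi * Complex.I * η : ℂ).re = 1 := by simp
    rw [integral_invFourierL2_mul hg (hk2' η) (hki _ (by rw [hre]; exact one_pos))]
    rw [← integral_solutionSymbol_div_eq_zero hh₀ hh₁ hx hre]
    apply integral_congr_ae
    filter_upwards [hgs] with ξ hξ
    rw [hξ, hkF _ (by rw [hre]; exact one_pos)]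
    ring
  have hint : Integrable fun t => invFourierL2 g t * k 1 t :=
    (Lp.memLp (invFourierL2 g)).integrable_mul hk2
  have hae := Integrable.ae_eq_zero_of_fourier_eq_zero hint (fun η => by
    rw [Real.fourier_eq']
    rw [← hzero (-η)]
    congr with t
    rw [hkexp, smul_eq_mul, mul_left_comm]
    congr 2
    simp
    ring_nf)
  filter_upwards [hae] with t ht htneg
  simp only [hk, Pi.zero_apply, mul_eq_zero] at ht
  rcases ht with ht | ht
  · exact ht
  · rw [indicator_of_mem (mem_Iio.2 htneg)] at ht
    have h1 : (t : ℂ) ≠ 0 := by exact_mod_cast htneg.ne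
    simp [h1] at ht

end

/-! ### Division by the root modulus: low and high frequencies -/

noncomputable section

theorem rootModulus_eq_rpow (ξ : ℝ) : rootModulus ξ = ((2 * Real.pi * ξ) ^ 2) ^ (1 / 8 : ℝ) := by
  have e : (2 * Real.pi * ξ) ^ 2 = (2 * Real.pi * |ξ|) ^ 2 := by
    rw [mul_pow, mul_pow _ |ξ|, sq_abs]
  unfold rootModulus
  rw [e, ← Real.rpow_natCast, ← Real.rpow_mul (by positivity)]
  norm_num

theorem sobolevWeight_add (σ σ' ξ : ℝ) :
    sobolevWeight (σ + σ') ξ = sobolevWeight σ ξ * sobolevWeight σ' ξ := by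
  unfold sobolevWeight
  rw [← Real.rpow_add (by positivity), add_div]

/-- One factor μ is worth a quarter of a time derivative, the gap between the orders (2s+3)/8 and
(2s+1)/8. -/
theorem rootModulus_le_sobolevWeight (ξ : ℝ) : rootModulus ξ ≤ sobolevWeight (1 / 4) ξ := by
  rw [rootModulus_eq_rpow]
  unfold sobolevWeight
  norm_num
  exact Real.rpow_le_rpow (by positivity) (by linarith) (by norm_num)

theorem sobolevWeight_le_rootModulus {ξ : ℝ} (hξ : 1 ≤ |ξ|) :
    sobolevWeight (1 / 4) ξ ≤ 2 * rootModulus ξ := by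
  have h1 : 1 ≤ (2 * Real.pi * ξ) ^ 2 := by
    rw [← sq_abs, abs_mul]
    have : 1 ≤ |2 * Real.pi| := by
      rw [abs_of_pos (by positivity)]
      linarith [Real.pi_gt_three]
    exact one_le_pow₀ (one_le_mul_of_one_le_of_one_le this hξ)
  rw [rootModulus_eq_rpow]
  unfold sobolevWeight
  norm_num
  have e : (2 : ℝ) = (2 ^ 8) ^ (1 / 8 : ℝ) := by
    rw [← Real.rpow_natCast, ← Real.rpow_mul (by norm_num)]
    norm_num
  conv_rhs => rw [e]
  rw [← Real.mul_rpow (by positivity) (by positivity)]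
  exact Real.rpow_le_rpow (by positivity) (by linarith) (by norm_num)

theorem weightedENorm_rootModulus_mul_le (σ : ℝ) (F : ℝ → ℂ) :
    weightedENorm σ (fun ξ => rootModulus ξ * F ξ) ≤ weightedENorm (σ + 1 / 4) F := by
  refine eLpNorm_mono fun ξ => ?_
  rw [sobolevWeight_add, ← mul_assoc, norm_mul, norm_mul _ (F ξ), ← Complex.ofReal_mul,
    Complex.norm_real, Complex.norm_real, Real.norm_of_nonneg (mul_nonneg
    (sobolevWeight_pos _ _).le (rootModulus_nonneg _)), Real.norm_of_nonneg (mul_nonneg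
    (sobolevWeight_pos _ _).le (sobolevWeight_pos _ _).le)]
  have := sobolevWeight_pos σ ξ
  gcongr
  exact rootModulus_le_sobolevWeight ξ

theorem sobolevWeight_neg (σ ξ : ℝ) : sobolevWeight σ (-ξ) = sobolevWeight σ ξ := by
  unfold sobolevWeight
  rw [mul_neg, neg_sq]

/-- Near zero the square of 1/μ is of size |ξ|^{-1/2}, which is integrable. -/
theorem weightedENorm_indicator_inv_rootModulus_lt_top {σ : ℝ} (hσ : 0 ≤ σ) :
    weightedENorm σ ((Ioo (-1 : ℝ) 1).indicator fun ξ => ((rootModulus ξ)⁻¹ : ℂ)) < ⊤ := by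
  refine (ENNReal.pow_lt_top_iff.1 (?_ : _ ^ 2 < ⊤)).resolve_right two_ne_zero
  rw [weightedENorm_sq, lintegral_even]
  · refine ENNReal.mul_lt_top (by simp) ?_
    have hint : IntegrableOn (fun x : ℝ => sobolevWeight σ 1 ^ 2 * x ^ (-(1 / 2) : ℝ)) (Ioc 0 1) := by
      have := (intervalIntegral.intervalIntegrable_rpow' (a := 0) (b := 1)
        (r := -(1 / 2)) (by norm_num)).const_mul (sobolevWeight σ 1 ^ 2)
      rwa [intervalIntegrable_iff_integrableOn_Ioc_of_le zero_le_one] at this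
    calc _ ≤ ∫⁻ x in Ioi (0 : ℝ), (Ioc (0 : ℝ) 1).indicator
          (fun x => ENNReal.ofReal (sobolevWeight σ 1 ^ 2 * x ^ (-(1 / 2) : ℝ))) x := by
          refine setLIntegral_mono' measurableSet_Ioi fun x hx => ?_
          have hx : 0 < x := hx
          by_cases h : x < 1
          · rw [indicator_of_mem (show x ∈ Ioo (-1 : ℝ) 1 from ⟨by linarith, h⟩),
              indicator_of_mem (show x ∈ Ioc (0 : ℝ) 1 from ⟨hx, h.le⟩), ← ofReal_norm,
              ← ENNReal.ofReal_pow (norm_nonneg _)]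
            refine ENNReal.ofReal_le_ofReal ?_
            rw [norm_mul, ← Complex.ofReal_inv, Complex.norm_real, Complex.norm_real, mul_pow,
              Real.norm_of_nonneg (sobolevWeight_pos _ _).le,
              Real.norm_of_nonneg (inv_nonneg.2 (rootModulus_nonneg _))]
            gcongr ?_ ^ 2 * ?_
            · exact (sobolevWeight_pos _ _).le
            · unfold sobolevWeight
              gcongr
            · unfold rootModulus
              rw [abs_of_pos hx, ← Real.rpow_neg (by positivity), ← Real.rpow_natCast,
                ← Real.rpow_mul (by positivity)]
              norm_num
              rw [show (-(1 / 2) : ℝ) = -(1 / 2 : ℝ) by norm_num]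
              refine Real.rpow_le_rpow_of_nonpos hx ?_ (by norm_num)
              nlinarith [Real.pi_gt_three]
          · rw [indicator_of_notMem (show x ∉ Ioo (-1 : ℝ) 1 from fun h' => h h'.2)]
            simp
      _ ≤ ∫⁻ x, (Ioc (0 : ℝ) 1).indicator
          (fun x => ENNReal.ofReal (sobolevWeight σ 1 ^ 2 * x ^ (-(1 / 2) : ℝ))) x :=
          lintegral_mono' Measure.restrict_le_self le_rfl
      _ = _ := lintegral_indicator measurableSet_Ioc _
      _ < ⊤ := hint.lintegral_lt_top
  · intro x
    have : (-x ∈ Ioo (-1 : ℝ) 1) ↔ x ∈ Ioo (-1 : ℝ) 1 := by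
      constructor <;> rintro ⟨h1, h2⟩ <;> constructor <;> linarith
    simp only [indicator_apply, this, sobolevWeight_neg, rootModulus_neg]

/-- For |ξ| ≥ 1 dividing by μ gains a quarter derivative. For |ξ| < 1 the weighted norm cannot
control the quotient, and the supremum of H is used instead, against the square integrable 1/μ. -/
theorem weightedENorm_div_rootModulus_le {σ : ℝ} (hσ : 0 ≤ σ) :
    ∃ C : ℝ≥0, ∀ H : ℝ → ℂ, Measurable H → ∀ M : ℝ≥0, (∀ ξ, ‖H ξ‖ ≤ M) →
      weightedENorm (σ + 1 / 4) (fun ξ => H ξ / rootModulus ξ) ≤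
        C * (weightedENorm σ H + M) := by
  set L := weightedENorm (σ + 1 / 4)
    ((Ioo (-1 : ℝ) 1).indicator fun ξ => ((rootModulus ξ)⁻¹ : ℂ)) with hL
  have hLt : L < ⊤ := weightedENorm_indicator_inv_rootModulus_lt_top (by linarith)
  refine ⟨2 + L.toNNReal, fun H hH M hM => ?_⟩
  have hμ : Measurable fun ξ => (rootModulus ξ : ℂ) :=
    (Complex.continuous_ofReal.comp continuous_rootModulus).measurable
  have hq : Measurable fun ξ => H ξ / rootModulus ξ := hH.div hμ
  have hsplit : (fun ξ => H ξ / rootModulus ξ) = fun ξ =>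
      (Ioo (-1 : ℝ) 1).indicator (fun ξ => H ξ / rootModulus ξ) ξ +
      (Ioo (-1 : ℝ) 1)ᶜ.indicator (fun ξ => H ξ / rootModulus ξ) ξ := by
    ext ξ
    exact (congrFun (indicator_self_add_compl (Ioo (-1 : ℝ) 1)
      (fun ξ => H ξ / (rootModulus ξ : ℂ))) ξ).symm
  have hlow : weightedENorm (σ + 1 / 4)
      ((Ioo (-1 : ℝ) 1).indicator (fun ξ => H ξ / rootModulus ξ)) ≤ M * L := by
    refine weightedENorm_le_mul (Eventually.of_forall fun ξ => ?_)
    by_cases h : ξ ∈ Ioo (-1 : ℝ) 1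
    · rw [indicator_of_mem h, indicator_of_mem h, div_eq_mul_inv, norm_mul]
      gcongr
      exact hM ξ
    · simp [indicator_of_notMem h]
  have hhigh : weightedENorm (σ + 1 / 4)
      ((Ioo (-1 : ℝ) 1)ᶜ.indicator (fun ξ => H ξ / rootModulus ξ)) ≤ (2 : ℝ≥0) * weightedENorm σ H := by
    refine eLpNorm_le_nnreal_smul_eLpNorm_of_ae_le_mul (Eventually.of_forall fun ξ => ?_) 2
    rw [← NNReal.coe_le_coe]
    push_cast
    by_cases h : ξ ∈ Ioo (-1 : ℝ) 1
    · rw [indicator_of_notMem (by simpa using h)]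
      simp only [mul_zero, norm_zero]
      positivity
    · rw [indicator_of_mem h]
      have h1 : 1 ≤ |ξ| := by
        by_contra h'
        exact h (abs_lt.1 (not_le.1 h'))
      have h0 : 0 < rootModulus ξ := rootModulus_pos (by
        rintro rfl
        norm_num at h1)
      rw [norm_mul, norm_div, norm_mul, Complex.norm_real, Complex.norm_real, Complex.norm_real,
        Real.norm_of_nonneg (sobolevWeight_pos _ _).le, Real.norm_of_nonneg h0.le,
        Real.norm_of_nonneg (sobolevWeight_pos _ _).le, sobolevWeight_add]
      have h2 := sobolevWeight_le_rootModulus h1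
      have h3 := sobolevWeight_pos σ ξ
      rw [mul_div_assoc', div_le_iff₀ h0]
      calc sobolevWeight σ ξ * sobolevWeight (1 / 4) ξ * ‖H ξ‖
          ≤ sobolevWeight σ ξ * (2 * rootModulus ξ) * ‖H ξ‖ := by gcongr
        _ = _ := by ring
  rw [hsplit]
  refine (weightedENorm_add_le (hq.indicator measurableSet_Ioo).aestronglyMeasurable
    (hq.indicator measurableSet_Ioo.compl).aestronglyMeasurable).trans ?_
  refine (add_le_add hlow hhigh).trans ?_
  push_cast
  rw [ENNReal.coe_toNNReal hLt.ne, add_mul, mul_add, mul_add]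
  calc _ = 2 * weightedENorm σ H + L * M := by ring
    _ ≤ _ := by
      gcongr
      · exact le_self_add
      · exact le_add_self

/-- The Fourier transform of a function supported in `(0, T)` is its Laplace transform on the
imaginary axis. -/
theorem fourier_ae_eq_laplaceOn {T : ℝ} {h : ℝ → ℂ} (f : Lp ℂ 2 (volume : Measure ℝ))
    (hf : f =ᵐ[volume] h) (h0 : ∀ᵐ t : ℝ, t ∉ Ioo 0 T → h t = 0) :
    IntegrableOn h (Ioo 0 T) ∧ (𝓕 f : Lp ℂ 2 (volume : Measure ℝ)) =ᵐ[volume]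
      fun ξ => laplaceOn T h (2 * Real.pi * Complex.I * ξ) := by
  have hf2 : MemLp h 2 := (memLp_congr_ae hf).1 (Lp.memLp f)
  have hion : IntegrableOn h (Ioo 0 T) := by
    have := hf2.restrict (Ioo 0 T)
    exact this.integrable (by norm_num)
  have hzero : (Ioo 0 T).indicator h =ᵐ[volume] h := by
    filter_upwards [h0] with t ht
    by_cases hm : t ∈ Ioo 0 T
    · rw [indicator_of_mem hm]
    · rw [indicator_of_notMem hm, ht hm]
  have hint : Integrable h := ((integrable_indicator_iff measurableSet_Ioo).2 hion).congr hzero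
  refine ⟨hion, ?_⟩
  have e : hf2.toLp h = f := Lp.ext (hf2.coeFn_toLp.trans hf.symm)
  have h1 := Integrable.fourier_toLp_ae_eq hint hf2
  rw [e] at h1
  refine h1.trans (Eventually.of_forall fun ξ => ?_)
  dsimp only
  rw [Real.fourier_eq', laplaceOn, ← integral_indicator measurableSet_Ioo]
  refine integral_congr_ae ?_
  filter_upwards [hzero] with t ht
  simp only [indicator_apply] at ht ⊢
  rw [← ht, smul_eq_mul]
  split_ifs
  · congr 2
    simp
    ring
  · simp

/-- Cauchy–Schwarz on (0,T). The L¹ norm bounds the transform of h₁ uniformly, so this is the origin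
of T^{1/2} in the final estimate. -/
theorem integral_norm_le_sqrt_mul_eLpNorm {T : ℝ} (hT : 0 < T) {h : ℝ → ℂ} (hh : MemLp h 2) :
    ENNReal.ofReal (∫ t in Ioo 0 T, ‖h t‖) ≤ ENNReal.ofReal (T ^ (1 / 2 : ℝ)) * eLpNorm h 2 := by
  have hi : IntegrableOn h (Ioo 0 T) := (hh.restrict (Ioo 0 T)).integrable (by norm_num)
  rw [ofReal_integral_norm_eq_lintegral_enorm hi, ← eLpNorm_one_eq_lintegral_enorm]
  refine (eLpNorm_le_eLpNorm_mul_rpow_measure_univ (p := 1) (q := 2) (by norm_num) hi.1).trans ?_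
  rw [mul_comm]
  gcongr
  · rw [Measure.restrict_apply_univ, Real.volume_Ioo, sub_zero,
      ENNReal.ofReal_rpow_of_pos hT]
    norm_num
  · exact Measure.restrict_le_self
end

/-! ### Sums in the restriction spaces, and traces of waves -/

noncomputable section

theorem sobolevLineENorm_add_le (σ : ℝ) (f g : Lp ℂ 2 (volume : Measure ℝ)) :
    sobolevLineENorm σ (f + g) ≤ sobolevLineENorm σ f + sobolevLineENorm σ g := by
  simp only [sobolevLineENorm_eq]
  refine le_trans (le_of_eq (weightedENorm_congr ?_))
    (weightedENorm_add_le (Lp.aestronglyMeasurable _) (Lp.aestronglyMeasurable _))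
  rw [FourierTransform.fourier_add]
  exact Lp.coeFn_add _ _

theorem sobolevENorm_add_le (σ : ℝ) (I : Set ℝ) (g g' : ℝ → ℂ) :
    sobolevENorm σ I (fun y => g y + g' y) ≤ sobolevENorm σ I g + sobolevENorm σ I g' := by
  conv_rhs => unfold sobolevENorm
  simp_rw [ENNReal.iInf_add, ENNReal.add_iInf]
  refine le_iInf₂ fun f hf => le_iInf₂ fun f' hf' => ?_
  refine (sobolevENorm_le (f + f') ?_).trans (sobolevLineENorm_add_le σ f f')
  filter_upwards [hf, hf', ae_restrict_of_ae (Lp.coeFn_add f f')] with x h1 h2 h3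
  rw [h3, Pi.add_apply, h1, h2]

theorem sobolevENorm_zero (σ : ℝ) (I : Set ℝ) : sobolevENorm σ I (fun _ => 0) = 0 := by
  refine le_antisymm ((sobolevENorm_le 0 (ae_restrict_of_ae (Lp.coeFn_zero _ _ _))).trans
    (le_of_eq ?_)) bot_le
  rw [sobolevLineENorm_eq, FourierTransform.fourier_zero, weightedENorm_congr (Lp.coeFn_zero _ _ _)]
  simp [weightedENorm]

theorem sobolevENorm_sum_le {ι : Type*} (σ : ℝ) (I : Set ℝ) (g : ι → ℝ → ℂ) (S : Finset ι) :
    sobolevENorm σ I (fun y => ∑ j ∈ S, g j y) ≤ ∑ j ∈ S, sobolevENorm σ I (g j) := by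
  classical
  induction S using Finset.induction_on with
  | empty => simp [sobolevENorm_zero]
  | insert a S ha ih =>
    simp only [Finset.sum_insert ha]
    exact (sobolevENorm_add_le _ _ _ _).trans (add_le_add le_rfl ih)

theorem sobolevENorm_mono {σ σ' : ℝ} (h : σ ≤ σ') (I : Set ℝ) (g : ℝ → ℂ) :
    sobolevENorm σ I g ≤ sobolevENorm σ' I g := by
  refine iInf₂_mono fun f _ => eLpNorm_mono fun ξ => ?_
  rw [norm_mul, norm_mul, Complex.norm_real, Complex.norm_real,
    Real.norm_of_nonneg (by positivity), Real.norm_of_nonneg (by positivity)]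
  gcongr
  exact le_add_of_nonneg_right (sq_nonneg _)

theorem ContinuousInSobolev.mono_order {σ σ' : ℝ} {J I : Set ℝ} {u : ℝ → ℝ → ℂ}
    (hu : ContinuousInSobolev J σ' I u) (h : σ ≤ σ') : ContinuousInSobolev J σ I u := fun a ha =>
  ⟨(sobolevENorm_mono h _ _).trans_lt (hu a ha).1,
    tendsto_of_tendsto_of_tendsto_of_le_of_le tendsto_const_nhds (hu a ha).2 (fun _ => bot_le)
      fun _ => sobolevENorm_mono h _ _⟩

theorem ContinuousInSobolev.mono_set {σ : ℝ} {J J' I : Set ℝ} {u : ℝ → ℝ → ℂ}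
    (hu : ContinuousInSobolev J' σ I u) (h : J ⊆ J') : ContinuousInSobolev J σ I u := fun a ha =>
  ⟨(hu a (h ha)).1, (hu a (h ha)).2.mono_left (nhdsWithin_mono _ h)⟩

theorem ContinuousInSobolev.sum {ι : Type*} {σ : ℝ} {J I : Set ℝ} {u : ι → ℝ → ℝ → ℂ}
    {S : Finset ι} (hu : ∀ j ∈ S, ContinuousInSobolev J σ I (u j)) :
    ContinuousInSobolev J σ I (fun a y => ∑ j ∈ S, u j a y) := by
  intro a ha
  refine ⟨(sobolevENorm_sum_le σ I (fun j => u j a) S).trans_lt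
    (ENNReal.sum_lt_top.2 fun j hj => (hu j hj a ha).1), ?_⟩
  have hlim := tendsto_finsetSum S fun j hj => (hu j hj a ha).2
  simp only [Finset.sum_const_zero] at hlim
  refine tendsto_of_tendsto_of_tendsto_of_le_of_le tendsto_const_nhds hlim (fun _ => bot_le)
    fun b => ?_
  simp only [← Finset.sum_sub_distrib]
  exact sobolevENorm_sum_le σ I (fun j y => u j b y - u j a y) S

theorem IsWave.sobolevENorm_le {σ : ℝ} {c : ℂ} {F : ℝ → ℂ} {Z : ℝ → ℝ → ℂ} (hZ : IsWave σ c F Z)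
    (hσ : 0 ≤ σ) (hc : 0 ≤ c.re) (hF : Measurable F) (hfin : weightedENorm σ F < ⊤) {x : ℝ}
    (hx : 0 ≤ x) (I : Set ℝ) : sobolevENorm σ I (Z x) ≤ weightedENorm σ F := by
  have hle := weightedENorm_spatialFactor_mul_le (σ := σ) hc hx F
  have hm : Measurable fun ξ => spatialFactor c x ξ * F ξ := (measurable_spatialFactor c x).mul hF
  exact (sobolevENorm_le_weightedENorm (memLp_of_weightedENorm_lt_top hσ hm.aestronglyMeasurable
    (hle.trans_lt hfin)) (ae_restrict_of_ae (hZ.slice_space x hx))).trans hle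

/-- For x ≥ 0 the spatial factors have modulus at most 1 and depend continuously on x at each
frequency, which is strong continuity of the multipliers. -/
theorem IsWave.continuousInSobolev {σ : ℝ} {c : ℂ} {F : ℝ → ℂ} {Z : ℝ → ℝ → ℂ}
    (hZ : IsWave σ c F Z) (hσ : 0 ≤ σ) (hc : 0 ≤ c.re) (hF : Measurable F)
    (hfin : weightedENorm σ F < ⊤) (I : Set ℝ) : ContinuousInSobolev (Ici 0) σ I Z := by
  refine continuousInSobolev_of_weightedENorm hσ
    (G := fun x ξ => spatialFactor c x ξ * F ξ) ?_ ?_ ?_ ?_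
  · exact fun x _ => ((measurable_spatialFactor c x).mul hF).aestronglyMeasurable
  · exact fun x hx => (weightedENorm_spatialFactor_mul_le hc hx F).trans_lt hfin
  · exact fun x hx => ae_restrict_of_ae (hZ.slice_space x hx)
  · intro x hx
    refine tendsto_weightedENorm_mul_sub (K := 2) hF.aestronglyMeasurable hfin
      (Eventually.of_forall fun y => (measurable_spatialFactor c y).aestronglyMeasurable)
      (measurable_spatialFactor c x).aestronglyMeasurable ?_ ?_
    · filter_upwards [self_mem_nhdsWithin] with y hy ξ
      refine (norm_sub_le _ _).trans ?_
      have h1 := norm_spatialFactor_le hc hx ξ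
      have h2 := norm_spatialFactor_le hc hy ξ
      push_cast
      linarith
    · refine Eventually.of_forall fun ξ => Tendsto.mono_left ?_ nhdsWithin_le_nhds
      exact ((continuous_spatialFactor c).comp
        (show Continuous fun y : ℝ => (y, ξ) by fun_prop)).tendsto x

theorem IsWave.exists_time_bound {s : ℝ} (hs : 0 ≤ s) {c : ℂ} (hc : 0 < c.re ∨ c = Complex.I)
    {ε : ℝ} (hε : ε = 1 ∨ ε = -1) :
    ∃ C : ℝ≥0, ∀ F : ℝ → ℂ, Measurable F → weightedENorm ((2 * s + 3) / 8) F < ⊤ →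
      (∀ ξ, ε * ξ ≤ 0 → F ξ = 0) → ∀ Z, IsWave ((2 * s + 3) / 8) c F Z →
      ContinuousInSobolev univ s (Ioi 0) (fun t x => Z x t) ∧
      ∀ t, sobolevENorm s (Ioi 0) (fun x => Z x t) ≤ C * weightedENorm ((2 * s + 3) / 8) F := by
  obtain ⟨C, hC⟩ := IsWave.exists_timeSlices hs hc hε
  refine ⟨C, fun F hF hfin h0 Z hZ => ?_⟩
  obtain ⟨G, hGm, hGb, hGs, hGl⟩ := hC F hF hfin h0 Z hZ
  have hGf : ∀ t, weightedENorm s (G t) < ⊤ := fun t =>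
    (hGb t).trans_lt (ENNReal.mul_lt_top (by simp) hfin)
  refine ⟨continuousInSobolev_of_weightedENorm hs (fun t _ => (hGm t).aestronglyMeasurable)
    (fun t _ => hGf t) (fun t _ => hGs t) fun t _ => ?_, fun t =>
    (sobolevENorm_le_weightedENorm (memLp_of_weightedENorm_lt_top hs
      (hGm t).aestronglyMeasurable (hGf t)) (hGs t)).trans (hGb t)⟩
  rw [nhdsWithin_univ]
  exact hGl t

/-- A function that is continuous in time with values in `H^s` and vanishes at negative times
vanishes at time zero. -/
theorem ae_eq_zero_of_vanishing_past {s : ℝ} (hs : 0 ≤ s) {z : ℝ → ℝ → ℂ}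
    (hz : StronglyMeasurable (Function.uncurry z))
    (hc : ContinuousInSobolev univ s (Ioi 0) (fun t x => z x t))
    (h0 : ∀ x, 0 ≤ x → ∀ᵐ t, t < 0 → z x t = 0) :
    ∀ᵐ x ∂(volume.restrict (Ioi (0 : ℝ))), z x 0 = 0 := by
  have h1 : ∀ᵐ t, ∀ᵐ x ∂(volume.restrict (Ioi (0 : ℝ))), t < 0 → z x t = 0 := by
    -- Vanishing is known for each x at almost every t < 0. Joint measurability allows the
    -- quantifiers to be exchanged, giving almost every t < 0 and then almost every x.
    have hms : MeasurableSet {p : ℝ × ℝ | p.2 < 0 → z p.1 p.2 = 0} := by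
      have e : {p : ℝ × ℝ | p.2 < 0 → z p.1 p.2 = 0} =
          {p : ℝ × ℝ | p.2 < 0}ᶜ ∪ (Function.uncurry z) ⁻¹' {0} := by
        ext p
        simp only [mem_ofPred_eq, mem_union, mem_compl_iff, mem_preimage, Function.uncurry,
          mem_singleton_iff]
        tauto
      rw [e]
      exact (measurableSet_lt measurable_snd measurable_const).compl.union
        (hz.measurable (measurableSet_singleton 0))
    rw [← Measure.ae_ae_comm hms]
    filter_upwards [ae_restrict_mem measurableSet_Ioi] with x hx
    exact h0 x (le_of_lt hx)
  have hlim := (hc 0 (mem_univ 0)).2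
  rw [nhdsWithin_univ] at hlim
  have hL : MemLp (fun x => z x 0) 2 (volume.restrict (Ioi 0)) :=
    memLp_of_sobolevENorm_lt_top hs (hc 0 (mem_univ 0)).1
  have hzero : eLpNorm (fun x => z x 0) 2 (volume.restrict (Ioi 0)) = 0 := by
    by_contra hne
    obtain ⟨δ, hδ, hb⟩ := Metric.eventually_nhds_iff.1
      (hlim.eventually (gt_mem_nhds (pos_iff_ne_zero.2 hne)))
    -- If the slice at time 0 were nonzero, some good time t in (-δ, 0) would have a zero slice
    -- closer to it than its own norm.
    have hex : ∃ t ∈ Ioo (-δ) 0, ∀ᵐ x ∂(volume.restrict (Ioi (0 : ℝ))), t < 0 → z x t = 0 := by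
      have hne' : (volume.restrict (Ioo (-δ) 0)) ≠ 0 := by
        rw [Ne, Measure.restrict_eq_zero, Real.volume_Ioo]
        simpa using hδ
      have : (ae (volume.restrict (Ioo (-δ) 0))).NeBot := ae_neBot.2 hne'
      obtain ⟨t, h, h'⟩ := ((ae_restrict_mem (μ := volume) (measurableSet_Ioo (a := -δ) (b := 0))).and
        (ae_restrict_of_ae h1)).exists
      exact ⟨t, h, h'⟩
    obtain ⟨t, ht, hx⟩ := hex
    have := hb (y := t) (by rw [Real.dist_eq, sub_zero, abs_of_neg ht.2]; linarith [ht.1])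
    refine absurd this (not_lt.2 ?_)
    refine le_trans (le_of_eq ?_) (eLpNorm_restrict_le_sobolevENorm hs _)
    rw [← eLpNorm_neg]
    refine eLpNorm_congr_ae ?_
    filter_upwards [hx] with x hx
    rw [hx ht.2]
    simp
  exact (eLpNorm_eq_zero_iff hL.1 (by norm_num)).1 hzero
end

/-! ### The four characteristic roots and their amplitudes -/

noncomputable section

/-- The ratios of the four decaying or oscillating characteristic roots to their modulus; the
first two belong to positive, the others to negative frequencies. -/
def waveSlope : Fin 4 → ℂ :=
  ![1, Complex.I, Complex.exp (-(Real.pi / 4 : ℝ) * Complex.I),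
    Complex.I * Complex.exp (-(Real.pi / 4 : ℝ) * Complex.I)]

/-- The sign of the frequencies at which a characteristic root is used. -/
def waveSign : Fin 4 → ℝ := ![1, 1, -1, -1]

/-- The weight of the Dirichlet data in the amplitude of a characteristic root. -/
def dirichletCoeff : Fin 4 → ℂ :=
  ![-Complex.I / (1 - Complex.I), 1 / (1 - Complex.I), -Complex.I / (1 - Complex.I),
    1 / (1 - Complex.I)]

/-- The weight of the Neumann data in the amplitude of a characteristic root. -/
def neumannCoeff : Fin 4 → ℂ :=
  ![-1 / (1 - Complex.I), 1 / (1 - Complex.I),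
    -1 / (1 - Complex.I) / Complex.exp (-(Real.pi / 4 : ℝ) * Complex.I),
    1 / (1 - Complex.I) / Complex.exp (-(Real.pi / 4 : ℝ) * Complex.I)]

/-- The amplitude of a characteristic root for boundary data with transforms `H₀`, `H₁`. -/
def waveAmplitude (H₀ H₁ : ℝ → ℂ) (j : Fin 4) (ξ : ℝ) : ℂ :=
  {ξ | 0 < waveSign j * ξ}.indicator
    (fun ξ => dirichletCoeff j * H₀ ξ + neumannCoeff j * (H₁ ξ / rootModulus ξ)) ξ

theorem waveSign_eq (j : Fin 4) : waveSign j = 1 ∨ waveSign j = -1 := by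
  fin_cases j <;> simp [waveSign]

theorem cexp_neg_pi_div_four :
    Complex.exp (-(Real.pi / 4 : ℝ) * Complex.I) =
      (Real.sqrt 2 / 2 : ℝ) * (1 - Complex.I) := by
  rw [← Complex.ofReal_neg, Complex.exp_mul_I, ← Complex.ofReal_cos, ← Complex.ofReal_sin,
    Real.cos_neg, Real.sin_neg, Real.cos_pi_div_four, Real.sin_pi_div_four]
  push_cast
  ring

theorem waveSlope_re (j : Fin 4) : 0 < (waveSlope j).re ∨ waveSlope j = Complex.I := by
  have h : 0 < Real.sqrt 2 := by positivity
  fin_cases j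
  · left; simp [waveSlope]
  · right; simp [waveSlope]
  · left
    change 0 < (Complex.exp (-(Real.pi / 4 : ℝ) * Complex.I)).re
    rw [cexp_neg_pi_div_four, Complex.re_ofReal_mul]
    simp
  · left
    change 0 < (Complex.I * Complex.exp (-(Real.pi / 4 : ℝ) * Complex.I)).re
    rw [cexp_neg_pi_div_four, mul_left_comm, Complex.re_ofReal_mul]
    simp

theorem waveSlope_re_nonneg (j : Fin 4) : 0 ≤ (waveSlope j).re := by
  rcases waveSlope_re j with h | h
  · exact h.le
  · simp [h]

theorem norm_waveSlope (j : Fin 4) : ‖waveSlope j‖ = 1 := by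
  have h : ‖Complex.exp (-(Real.pi / 4 : ℝ) * Complex.I)‖ = 1 := by
    rw [← Complex.ofReal_neg, Complex.norm_exp_ofReal_mul_I]
  fin_cases j
  · simp [waveSlope]
  · simp [waveSlope]
  · exact h
  · change ‖Complex.I * Complex.exp (-(Real.pi / 4 : ℝ) * Complex.I)‖ = 1
    rw [norm_mul, h, Complex.norm_I, one_mul]

theorem waveSlope_pow_four (j : Fin 4) : waveSlope j ^ 4 = waveSign j := by
  have h : Complex.exp (-(Real.pi / 4 : ℝ) * Complex.I) ^ 4 = -1 := by
    rw [← Complex.exp_nat_mul, show ((4 : ℕ) : ℂ) * (-(Real.pi / 4 : ℝ) * Complex.I) =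
      -(Real.pi * Complex.I) by push_cast; ring, Complex.exp_neg, Complex.exp_pi_mul_I]
    norm_num
  fin_cases j
  · simp [waveSlope, waveSign]
  · simp [waveSlope, waveSign]
  · simpa [waveSlope, waveSign] using! h
  · change (Complex.I * Complex.exp (-(Real.pi / 4 : ℝ) * Complex.I)) ^ 4 = ((-1 : ℝ) : ℂ)
    rw [mul_pow, h, Complex.I_pow_four]
    simp

theorem norm_waveCoeff_le (j : Fin 4) : ‖dirichletCoeff j‖ ≤ 1 ∧ ‖neumannCoeff j‖ ≤ 1 := by
  have h : ‖Complex.exp (-(Real.pi / 4 : ℝ) * Complex.I)‖ = 1 := by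
    rw [← Complex.ofReal_neg, Complex.norm_exp_ofReal_mul_I]
  have h2 : ‖(1 - Complex.I : ℂ)‖⁻¹ ≤ 1 := inv_le_one_of_one_le₀ one_le_norm_one_sub_I
  fin_cases j <;> constructor <;>
    simp only [dirichletCoeff, neumannCoeff, Fin.zero_eta, Fin.mk_one, Fin.reduceFinMk,
      Matrix.cons_val, norm_div, norm_neg, Complex.norm_I, norm_one, h, div_one, one_div, norm_inv] <;>
    exact h2

theorem waveAmplitude_eq_zero (H₀ H₁ : ℝ → ℂ) (j : Fin 4) {ξ : ℝ} (h : waveSign j * ξ ≤ 0) :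
    waveAmplitude H₀ H₁ j ξ = 0 :=
  indicator_of_notMem (s := {ξ | 0 < waveSign j * ξ}) (a := ξ) (not_lt.2 h) _

theorem waveSlope_char (H₀ H₁ : ℝ → ℂ) (j : Fin 4) (ξ : ℝ) (h : waveAmplitude H₀ H₁ j ξ ≠ 0) :
    (waveSlope j * rootModulus ξ) ^ 4 = 2 * Real.pi * ξ := by
  have hpos : 0 < waveSign j * ξ := by
    by_contra h'
    exact h (waveAmplitude_eq_zero H₀ H₁ j (not_lt.1 h'))
  rw [mul_pow, waveSlope_pow_four, ← Complex.ofReal_pow, rootModulus_pow_four]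
  have : waveSign j * |ξ| = ξ := by
    rcases waveSign_eq j with h | h <;> rw [h] at hpos ⊢
    · rw [abs_of_pos (by linarith)]; ring
    · rw [abs_of_neg (by linarith)]; ring
  push_cast
  rw [mul_left_comm, ← Complex.ofReal_mul, this]

theorem measurable_waveAmplitude {H₀ H₁ : ℝ → ℂ} (h₀ : Measurable H₀) (h₁ : Measurable H₁)
    (j : Fin 4) : Measurable (waveAmplitude H₀ H₁ j) := by
  have hμ : Measurable fun ξ => (rootModulus ξ : ℂ) :=
    (Complex.continuous_ofReal.comp continuous_rootModulus).measurable
  refine Measurable.indicator ?_ (measurableSet_lt measurable_const (by fun_prop))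
  fun_prop

theorem weightedENorm_waveAmplitude_le {H₀ H₁ : ℝ → ℂ} (h₀ : Measurable H₀) (h₁ : Measurable H₁)
    (σ : ℝ) (j : Fin 4) : weightedENorm σ (waveAmplitude H₀ H₁ j) ≤
      weightedENorm σ H₀ + weightedENorm σ (fun ξ => H₁ ξ / rootModulus ξ) := by
  have hμ : Measurable fun ξ => (rootModulus ξ : ℂ) :=
    (Complex.continuous_ofReal.comp continuous_rootModulus).measurable
  obtain ⟨c1, c2⟩ := norm_waveCoeff_le j
  have m0 : Measurable fun ξ => dirichletCoeff j * H₀ ξ := h₀.const_mul _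
  have m1 : Measurable fun ξ => neumannCoeff j * (H₁ ξ / rootModulus ξ) := (h₁.div hμ).const_mul _
  refine (weightedENorm_mono (G := fun ξ => dirichletCoeff j * H₀ ξ +
    neumannCoeff j * (H₁ ξ / rootModulus ξ))
    (Eventually.of_forall fun ξ => ?_)).trans ?_
  · unfold waveAmplitude
    exact norm_indicator_le_norm_self (fun ξ => dirichletCoeff j * H₀ ξ +
      neumannCoeff j * (H₁ ξ / rootModulus ξ)) ξ
  refine (weightedENorm_add_le m0.aestronglyMeasurable m1.aestronglyMeasurable).trans ?_
  refine add_le_add (weightedENorm_mono (Eventually.of_forall fun ξ => ?_))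
    (weightedENorm_mono (Eventually.of_forall fun ξ => ?_))
  · rw [norm_mul]
    exact mul_le_of_le_one_left (norm_nonneg _) c1
  · rw [norm_mul]
    exact mul_le_of_le_one_left (norm_nonneg _) c2

/-- With ρ = μ the amplitudes a of e^{-ρx} and b of e^{-iρx} solve a + b = H₀ and -ρ(a + ib) = H₁.
The multipliers m are free because the sum is used with m = 1 for the Dirichlet trace, with the
factors -cμ for the Neumann trace, and with the spatial factors for the solution itself. -/
theorem sum_waveAmplitude_of_pos (H₀ H₁ : ℝ → ℂ) (m : Fin 4 → ℂ) {ξ : ℝ} (hξ : 0 < ξ) :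
    ∑ j, m j * waveAmplitude H₀ H₁ j ξ =
      (m 0 * (-Complex.I * H₀ ξ - H₁ ξ / rootModulus ξ) +
        m 1 * (H₀ ξ + H₁ ξ / rootModulus ξ)) / (1 - Complex.I) := by
  have e2 : waveAmplitude H₀ H₁ 2 ξ = 0 :=
    waveAmplitude_eq_zero _ _ _ (by simp [waveSign]; linarith)
  have e3 : waveAmplitude H₀ H₁ 3 ξ = 0 :=
    waveAmplitude_eq_zero _ _ _ (by simp [waveSign]; linarith)
  have e0 : waveAmplitude H₀ H₁ 0 ξ = _ :=
    indicator_of_mem (show ξ ∈ {ξ | 0 < waveSign 0 * ξ} by simpa [waveSign] using hξ) _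
  have e1 : waveAmplitude H₀ H₁ 1 ξ = _ :=
    indicator_of_mem (show ξ ∈ {ξ | 0 < waveSign 1 * ξ} by simpa [waveSign] using hξ) _
  rw [Fin.sum_univ_four, e0, e1, e2, e3]
  simp only [dirichletCoeff, neumannCoeff, Matrix.cons_val]
  ring

theorem sum_waveAmplitude_of_neg (H₀ H₁ : ℝ → ℂ) (m : Fin 4 → ℂ) {ξ : ℝ} (hξ : ξ < 0) :
    ∑ j, m j * waveAmplitude H₀ H₁ j ξ =
      (m 2 * (-Complex.I * H₀ ξ -
          H₁ ξ / (Complex.exp (-(Real.pi / 4 : ℝ) * Complex.I) * rootModulus ξ)) +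
        m 3 * (H₀ ξ + H₁ ξ / (Complex.exp (-(Real.pi / 4 : ℝ) * Complex.I) * rootModulus ξ))) /
        (1 - Complex.I) := by
  have e0 : waveAmplitude H₀ H₁ 0 ξ = 0 :=
    waveAmplitude_eq_zero _ _ _ (by simp [waveSign]; linarith)
  have e1 : waveAmplitude H₀ H₁ 1 ξ = 0 :=
    waveAmplitude_eq_zero _ _ _ (by simp [waveSign]; linarith)
  have e2 : waveAmplitude H₀ H₁ 2 ξ = _ :=
    indicator_of_mem (show ξ ∈ {ξ | 0 < waveSign 2 * ξ} by simpa [waveSign] using hξ) _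
  have e3 : waveAmplitude H₀ H₁ 3 ξ = _ :=
    indicator_of_mem (show ξ ∈ {ξ | 0 < waveSign 3 * ξ} by simpa [waveSign] using hξ) _
  rw [Fin.sum_univ_four, e0, e1, e2, e3]
  simp only [dirichletCoeff, neumannCoeff, Matrix.cons_val]
  ring

/-- The four waves, built from different formulas on the two half-lines of frequencies, are the
boundary values of one analytic symbol; this makes the causality argument applicable to their sum.
-/
theorem sum_spatialFactor_mul_waveAmplitude (T : ℝ) (h₀ h₁ : ℝ → ℂ) (x : ℝ) {ξ : ℝ} (hξ : ξ ≠ 0) :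
    ∑ j, spatialFactor (waveSlope j) x ξ * waveAmplitude
      (fun ξ => laplaceOn T h₀ (2 * Real.pi * Complex.I * ξ))
      (fun ξ => laplaceOn T h₁ (2 * Real.pi * Complex.I * ξ)) j ξ =
      solutionSymbol T h₀ h₁ x (2 * Real.pi * Complex.I * ξ) := by
  have hμ : (rootModulus ξ : ℂ) ≠ 0 := Complex.ofReal_ne_zero.2 (rootModulus_pos hξ).ne'
  have hE : Complex.exp (-(Real.pi / 4 : ℝ) * Complex.I) ≠ 0 := Complex.exp_ne_zero _
  unfold solutionSymbol
  rcases lt_or_gt_of_ne hξ with h | h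
  · rw [sum_waveAmplitude_of_neg _ _ _ h, charRoot_of_neg h,
      dslope_neumannSymbol x (mul_ne_zero hE hμ)]
    unfold dirichletSymbol neumannSymbol spatialFactor
    simp only [waveSlope, Matrix.cons_val]
    rw [show -(Complex.I * Complex.exp (-(Real.pi / 4 : ℝ) * Complex.I)) * rootModulus ξ * x =
      -Complex.I * (Complex.exp (-(Real.pi / 4 : ℝ) * Complex.I) * rootModulus ξ) * x by ring,
      show -Complex.exp (-(Real.pi / 4 : ℝ) * Complex.I) * rootModulus ξ * x =
      -(Complex.exp (-(Real.pi / 4 : ℝ) * Complex.I) * rootModulus ξ) * x by ring]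
    ring
  · rw [sum_waveAmplitude_of_pos _ _ _ h, charRoot_of_pos h, dslope_neumannSymbol x hμ]
    unfold dirichletSymbol neumannSymbol spatialFactor
    simp only [waveSlope, Matrix.cons_val]
    rw [show -1 * (rootModulus ξ : ℂ) * x = -(rootModulus ξ : ℂ) * x by ring]
    ring

theorem sum_waveAmplitude (H₀ H₁ : ℝ → ℂ) {ξ : ℝ} (hξ : ξ ≠ 0) :
    ∑ j, waveAmplitude H₀ H₁ j ξ = H₀ ξ := by
  have h1 := one_sub_I_ne_zero
  have e := sum_waveAmplitude_of_pos H₀ H₁ 1 (ξ := ξ)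
  have e' := sum_waveAmplitude_of_neg H₀ H₁ 1 (ξ := ξ)
  simp only [Pi.one_apply, one_mul] at e e'
  rcases lt_or_gt_of_ne hξ with h | h
  · rw [e' h, div_eq_iff h1]
    ring
  · rw [e h, div_eq_iff h1]
    ring

theorem sum_waveSlope_mul_waveAmplitude (H₀ H₁ : ℝ → ℂ) {ξ : ℝ} (hξ : ξ ≠ 0) :
    ∑ j, -waveSlope j * rootModulus ξ * waveAmplitude H₀ H₁ j ξ = H₁ ξ := by
  have h1 := one_sub_I_ne_zero
  have hμ : (rootModulus ξ : ℂ) ≠ 0 := Complex.ofReal_ne_zero.2 (rootModulus_pos hξ).ne'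
  have hE : Complex.exp (-(Real.pi / 4 : ℝ) * Complex.I) ≠ 0 := Complex.exp_ne_zero _
  rcases lt_or_gt_of_ne hξ with h | h
  · rw [sum_waveAmplitude_of_neg _ _ (fun j => -waveSlope j * rootModulus ξ) h, div_eq_iff h1]
    simp only [waveSlope, Matrix.cons_val]
    field_simp
    ring
  · rw [sum_waveAmplitude_of_pos _ _ (fun j => -waveSlope j * rootModulus ξ) h, div_eq_iff h1]
    simp only [waveSlope, Matrix.cons_val]
    field_simp
    ring
end

/-! ### Existence and estimates -/

noncomputable section

theorem invFourierL2_sum {ι : Type*} (S : Finset ι) {G : ι → ℝ → ℂ} (hG : ∀ j ∈ S, MemLp (G j) 2) :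
    invFourierL2 (fun ξ => ∑ j ∈ S, G j ξ) =ᵐ[volume] fun t => ∑ j ∈ S, invFourierL2 (G j) t := by
  classical
  induction S using Finset.induction_on with
  | empty =>
    have h0 : MemLp (fun _ : ℝ => (0 : ℂ)) 2 (volume : Measure ℝ) := MemLp.zero
    have := eLpNorm_invFourierL2 h0
    simp only [eLpNorm_zero'] at this
    simpa [Pi.zero_def] using (eLpNorm_eq_zero_iff (Lp.aestronglyMeasurable _) (by norm_num)).1 this
  | insert a S ha ih =>
    have hS : ∀ j ∈ S, MemLp (G j) 2 := fun j hj => hG j (Finset.mem_insert_of_mem hj)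
    simp only [Finset.sum_insert ha]
    rw [invFourierL2_add (hG a (Finset.mem_insert_self a S)) (memLp_finsetSum S hS)]
    filter_upwards [Lp.coeFn_add (invFourierL2 (G a)) (invFourierL2 fun ξ => ∑ j ∈ S, G j ξ), ih hS]
      with t h1 h2
    rw [h1, Pi.add_apply, h2]

theorem IsWave.invFourierL2_sum {ι : Type*} [Fintype ι] {σ : ℝ} {c : ι → ℂ} {F : ι → ℝ → ℂ}
    {Z : ι → ℝ → ℝ → ℂ} (hσ : 0 ≤ σ) (hZ : ∀ j, IsWave σ (c j) (F j) (Z j))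
    (hc : ∀ j, 0 ≤ (c j).re) (hF : ∀ j, Measurable (F j))
    (hfin : ∀ j, weightedENorm σ (F j) < ⊤) {x : ℝ} (hx : 0 ≤ x) {g : ℝ → ℂ}
    (hg : ∀ᵐ ξ, ∑ j, spatialFactor (c j) x ξ * F j ξ = g ξ) :
    MemLp g 2 ∧ (fun t => ∑ j, Z j x t) =ᵐ[volume] invFourierL2 g := by
  have hm : ∀ j, MemLp (fun ξ => spatialFactor (c j) x ξ * F j ξ) 2 := fun j =>
    memLp_of_weightedENorm_lt_top hσ ((measurable_spatialFactor _ x).mul (hF j)).aestronglyMeasurable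
      ((weightedENorm_spatialFactor_mul_le (hc j) hx (F j)).trans_lt (hfin j))
  have hs : MemLp (fun ξ => ∑ j, spatialFactor (c j) x ξ * F j ξ) 2 :=
    memLp_finsetSum _ fun j _ => hm j
  refine ⟨(memLp_congr_ae hg).1 hs, ?_⟩
  rw [← invFourierL2_congr hs hg]
  have h1 := _root_.invFourierL2_sum Finset.univ fun j _ => hm j
  have h2 : ∀ᵐ t, ∀ j, invFourierL2 (fun ξ => spatialFactor (c j) x ξ * F j ξ) t = Z j x t :=
    ae_all_iff.2 fun j => (hZ j).slice_space x hx
  filter_upwards [h1, h2] with t h1 h2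
  rw [h1]
  exact Finset.sum_congr rfl fun j _ => (h2 j).symm

/-- The solution is the sum of the four waves. Its x-derivative is a separate sum of waves with
amplitudes -cμA of order (2s+1)/8, so that it too has good representatives on every slice; the two
are linked by `IsWave.weak_dx`. -/
theorem exists_isHalfLineSolution {s : ℝ} (hs : 0 ≤ s) :
    ∃ C : ℝ≥0, ∀ T : ℝ, 0 < T → ∀ h₀ h₁ : ℝ → ℂ,
      sobolevENorm ((2 * s + 3) / 8) univ h₀ < ⊤ → sobolevENorm ((2 * s + 1) / 8) univ h₁ < ⊤ →
      (∀ᵐ t : ℝ, t ∉ Ioo 0 T → h₀ t = 0) → (∀ᵐ t : ℝ, t ∉ Ioo 0 T → h₁ t = 0) →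
      ∃ z zx : ℝ → ℝ → ℂ, IsHalfLineSolution T h₀ h₁ z zx ∧
        ContinuousInSobolev (Icc 0 T) s (Ioi 0) (fun t x => z x t) ∧
        ContinuousInSobolev (Ici 0) ((2 * s + 3) / 8) (Ioo 0 T) z ∧
        ContinuousInSobolev (Ici 0) ((2 * s + 1) / 8) (Ioo 0 T) zx ∧
        (⨆ t ∈ Icc (0 : ℝ) T, sobolevENorm s (Ioi 0) (fun x => z x t)) +
            (⨆ x ∈ Ici (0 : ℝ), sobolevENorm ((2 * s + 3) / 8) (Ioo 0 T) (z x)) ≤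
          C * (sobolevENorm ((2 * s + 3) / 8) univ h₀ +
            ENNReal.ofReal (1 + T ^ (1 / 2 : ℝ)) *
              sobolevENorm ((2 * s + 1) / 8) univ h₁) := by
  have hadd : (2 * s + 1) / 8 + 1 / 4 = (2 * s + 3) / 8 := by ring
  have hσ₀ : 0 ≤ (2 * s + 3) / 8 := by positivity
  have hσ₁ : 0 ≤ (2 * s + 1) / 8 := by positivity
  choose Ct hCt using fun j : Fin 4 =>
    IsWave.exists_time_bound hs (waveSlope_re j) (waveSign_eq j)
  obtain ⟨Cd, hCd⟩ := weightedENorm_div_rootModulus_le hσ₁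
  rw [hadd] at hCd
  generalize (2 * s + 3) / 8 = σ₀ at *
  generalize (2 * s + 1) / 8 = σ₁ at *
  -- The constants `Ct` bound the slices in time of the four waves, 4 counts their traces in x, and
  -- 1 + `Cd` bounds the amplitudes by the data.
  refine ⟨((∑ j, Ct j) + 4) * (1 + Cd), fun T hT h₀ h₁ hfin₀ hfin₁ hv₀ hv₁ => ?_⟩
  obtain ⟨f₀, hf₀, hf₀t⟩ := exists_ae_eq_of_sobolevENorm_lt_top hfin₀
  obtain ⟨f₁, hf₁, hf₁t⟩ := exists_ae_eq_of_sobolevENorm_lt_top hfin₁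
  rw [Measure.restrict_univ] at hf₀ hf₁
  obtain ⟨hi₀, hF₀⟩ := fourier_ae_eq_laplaceOn f₀ hf₀ hv₀
  obtain ⟨hi₁, hF₁⟩ := fourier_ae_eq_laplaceOn f₁ hf₁ hv₁
  have hN₀ : sobolevENorm σ₀ univ h₀ =
      weightedENorm σ₀ (fun ξ : ℝ => laplaceOn T h₀ (2 * Real.pi * Complex.I * ξ)) := by
    rw [sobolevENorm_univ f₀ hf₀, sobolevLineENorm_eq, weightedENorm_congr hF₀]
  have hN₁ : sobolevENorm σ₁ univ h₁ =
      weightedENorm σ₁ (fun ξ : ℝ => laplaceOn T h₁ (2 * Real.pi * Complex.I * ξ)) := by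
    rw [sobolevENorm_univ f₁ hf₁, sobolevLineENorm_eq, weightedENorm_congr hF₁]
  have hcoe : Measurable fun ξ : ℝ => (2 * Real.pi * Complex.I * ξ : ℂ) := by fun_prop
  have hH₀m := (differentiable_laplaceOn hi₀).continuous.measurable.comp hcoe
  have hH₁m := (differentiable_laplaceOn hi₁).continuous.measurable.comp hcoe
  have hsymb := fun x ξ => sum_spatialFactor_mul_waveAmplitude T h₀ h₁ x (ξ := ξ)
  simp only [Function.comp_def] at hH₀m hH₁m
  -- The uniform bound needed at low frequencies is the L¹ norm of h₁ on (0,T).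
  have hH₁b : ∀ ξ : ℝ, ‖laplaceOn T h₁ (2 * Real.pi * Complex.I * ξ)‖ ≤
      (∫ t in Ioo 0 T, ‖h₁ t‖).toNNReal := fun ξ => by
    rw [Real.coe_toNNReal _ (integral_nonneg fun _ => norm_nonneg _)]
    exact norm_laplaceOn_le hi₁ (by simp)
  have hL₁ : eLpNorm h₁ 2 volume ≤ sobolevENorm σ₁ univ h₁ := by
    rw [sobolevENorm_univ f₁ hf₁, ← eLpNorm_congr_ae hf₁]
    exact eLpNorm_le_sobolevLineENorm hσ₁ f₁
  have hL₁m : MemLp h₁ 2 := (memLp_congr_ae hf₁).1 (Lp.memLp f₁)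
  have hM := hCd _ hH₁m _ hH₁b
  rw [← hN₁] at hM
  have hM' : weightedENorm σ₀ (fun ξ : ℝ => laplaceOn T h₁ (2 * Real.pi * Complex.I * ξ) /
      rootModulus ξ) ≤ Cd * (ENNReal.ofReal (1 + T ^ (1 / 2 : ℝ)) * sobolevENorm σ₁ univ h₁) := by
    refine hM.trans ?_
    gcongr
    rw [ENNReal.ofReal_add (by norm_num) (by positivity), ENNReal.ofReal_one, add_mul, one_mul]
    gcongr
    exact (integral_norm_le_sqrt_mul_eLpNorm hT hL₁m).trans (by gcongr)
  set E : ℝ≥0∞ := (1 + Cd) * (sobolevENorm σ₀ univ h₀ +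
    ENNReal.ofReal (1 + T ^ (1 / 2 : ℝ)) * sobolevENorm σ₁ univ h₁) with hE
  have hEt : E < ⊤ := by
    refine ENNReal.mul_lt_top (by simp) (ENNReal.add_lt_top.2 ⟨hfin₀, ?_⟩)
    exact ENNReal.mul_lt_top (by simp) hfin₁
  generalize hH₀ : (fun ξ : ℝ => laplaceOn T h₀ (2 * Real.pi * Complex.I * ξ)) = H₀ at *
  generalize hH₁ : (fun ξ : ℝ => laplaceOn T h₁ (2 * Real.pi * Complex.I * ξ)) = H₁ at *
  have hAm := measurable_waveAmplitude hH₀m hH₁m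
  have hAE : ∀ j, weightedENorm σ₀ (waveAmplitude H₀ H₁ j) ≤ E := fun j => by
    refine (weightedENorm_waveAmplitude_le hH₀m hH₁m σ₀ j).trans ?_
    rw [← hN₀, hE, mul_add]
    gcongr
    · exact le_mul_of_one_le_left bot_le le_self_add
    · subst hH₁
      refine hM'.trans ?_
      gcongr
      exact le_add_self
  have hAt : ∀ j, weightedENorm σ₀ (waveAmplitude H₀ H₁ j) < ⊤ := fun j => (hAE j).trans_lt hEt
  have hA'm : ∀ j, Measurable fun ξ => -waveSlope j * rootModulus ξ * waveAmplitude H₀ H₁ j ξ :=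
    fun j => by
    have hμ : Measurable fun ξ => (rootModulus ξ : ℂ) :=
      (Complex.continuous_ofReal.comp continuous_rootModulus).measurable
    exact (hμ.const_mul _).mul (hAm j)
  have hA't : ∀ j, weightedENorm σ₁
      (fun ξ => -waveSlope j * rootModulus ξ * waveAmplitude H₀ H₁ j ξ) < ⊤ := fun j => by
    refine lt_of_le_of_lt ((weightedENorm_mono (Eventually.of_forall fun ξ => ?_)).trans
      (weightedENorm_rootModulus_mul_le σ₁ (waveAmplitude H₀ H₁ j))) ?_
    · rw [mul_assoc, norm_mul, norm_neg, norm_waveSlope, one_mul]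
    · rw [hadd]
      exact hAt j
  choose Z hZ using fun j => exists_isWave hσ₀ (waveSlope_re_nonneg j) (hAm j) (hAt j)
  choose Z' hZ' using fun j => exists_isWave hσ₁ (waveSlope_re_nonneg j) (hA'm j) (hA't j)
  have htime := fun j => hCt j _ (hAm j) (hAt j) (fun ξ h => waveAmplitude_eq_zero H₀ H₁ j h) _ (hZ j)
  have hspace := fun j => (hZ j).continuousInSobolev hσ₀ (waveSlope_re_nonneg j) (hAm j) (hAt j)
    (Ioo 0 T)
  have hspace' := fun j => (hZ' j).continuousInSobolev hσ₁ (waveSlope_re_nonneg j) (hA'm j)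
    (hA't j) (Ioo 0 T)
  -- All four amplitudes are 0 at ξ = 0, so the algebraic identities fail there; a null set is
  -- discarded.
  have hne : ∀ᵐ ξ : ℝ, ξ ≠ 0 := Measure.ae_ne volume 0
  have hct : ContinuousInSobolev univ s (Ioi 0) (fun t x => ∑ j, Z j x t) :=
    ContinuousInSobolev.sum (u := fun j t x => Z j x t) fun j _ => (htime j).1
  have hcs : ContinuousInSobolev (Ici 0) σ₀ (Ioo 0 T) (fun x t => ∑ j, Z j x t) :=
    ContinuousInSobolev.sum fun j _ => hspace j
  have hcs' : ContinuousInSobolev (Ici 0) σ₁ (Ioo 0 T) (fun x t => ∑ j, Z' j x t) :=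
    ContinuousInSobolev.sum fun j _ => hspace' j
  have hmeas : StronglyMeasurable (Function.uncurry fun x t => ∑ j, Z j x t) :=
    Finset.stronglyMeasurable_fun_sum Finset.univ (f := fun j (p : ℝ × ℝ) => Z j p.1 p.2)
      fun j _ => (hZ j).measurable
  have hmeas' : StronglyMeasurable (Function.uncurry fun x t => ∑ j, Z' j x t) :=
    Finset.stronglyMeasurable_fun_sum Finset.univ (f := fun j (p : ℝ × ℝ) => Z' j p.1 p.2)
      fun j _ => (hZ' j).measurable
  have hint : ∀ ψ, IsTestFunctionOn (halfStrip T) ψ → ∀ j,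
      IntegrableOn (fun p => Z j p.1 p.2 * ψ p) (halfStrip T) := fun ψ hψ j =>
    (hZ j).integrableOn_mul hσ₀ (waveSlope_re_nonneg j) (hAm j) (hAt j) hT hψ
  have hint' : ∀ ψ, IsTestFunctionOn (halfStrip T) ψ → ∀ j,
      IntegrableOn (fun p => Z' j p.1 p.2 * ψ p) (halfStrip T) := fun ψ hψ j =>
    (hZ' j).integrableOn_mul hσ₁ (waveSlope_re_nonneg j) (hA'm j) (hA't j) hT hψ
  refine ⟨fun x t => ∑ j, Z j x t, fun x t => ∑ j, Z' j x t, ?_, hct.mono_set (subset_univ _), hcs,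
    hcs', ?_⟩
  · constructor
    · exact hmeas.aestronglyMeasurable
    · exact hmeas'.aestronglyMeasurable
    · exact (hct.mono_order hs).mono_set (subset_univ _)
    · exact hcs.mono_order hσ₀
    · exact hcs'.mono_order hσ₁
    · intro φ hφ
      change ∫ p in halfStrip T, (∑ j, Z j p.1 p.2) * partialFst φ p = _
      simp_rw [Finset.sum_mul]
      rw [integral_finsetSum _ fun j _ => hint _ hφ.partialFst j,
        integral_finsetSum _ fun j _ => hint' _ hφ j, ← Finset.sum_neg_distrib]
      exact Finset.sum_congr rfl fun j _ => (hZ j).weak_dx (hZ' j) hσ₀ hσ₁ (waveSlope_re_nonneg j)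
        (hAm j) (hAt j) (hA't j) hT hφ
    · intro φ hφ
      simp_rw [iteratedDeriv_four_fst φ]
      have e : ∀ j, IntegrableOn (fun p => Z j p.1 p.2 * (-Complex.I * partialSnd φ p +
          partialFst (partialFst (partialFst (partialFst φ))) p)) (halfStrip T) := fun j => by
        have h4 := hint _ hφ.partialFst.partialFst.partialFst.partialFst j
        have h5 := (hint _ hφ.partialSnd j).const_mul (-Complex.I)
        refine (h5.add h4).congr (Eventually.of_forall fun p => ?_)
        simp only [Pi.add_apply]
        ring
      change ∫ p in halfStrip T, (∑ j, Z j p.1 p.2) * (-Complex.I * partialSnd φ p +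
          partialFst (partialFst (partialFst (partialFst φ))) p) = 0
      simp_rw [Finset.sum_mul]
      rw [integral_finsetSum _ fun j _ => e j]
      exact Finset.sum_eq_zero fun j _ => (hZ j).weak_equation hσ₀ (waveSlope_re_nonneg j)
        (hAm j) (hAt j) hT (waveSlope_char H₀ H₁ j) hφ
    -- The waves are defined for all real t, so causality at negative times passes to t = 0 through
    -- continuity in time.
    · refine ae_eq_zero_of_vanishing_past hs hmeas hct fun x hx => ?_
      have hg : ∀ᵐ ξ : ℝ, ∑ j, spatialFactor (waveSlope j) x ξ * waveAmplitude H₀ H₁ j ξ =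
          solutionSymbol T h₀ h₁ x (2 * Real.pi * Complex.I * ξ) := by
        filter_upwards [hne] with ξ hξ
        exact hsymb x ξ hξ
      obtain ⟨hgm, hge⟩ := IsWave.invFourierL2_sum hσ₀ hZ waveSlope_re_nonneg hAm hAt hx hg
      filter_upwards [hge, invFourierL2_solutionSymbol_eq_zero hi₀ hi₁ hx hgm
        (Eventually.of_forall fun _ => rfl)] with t h1 h2 h3
      rw [h1, h2 h3]
    · have hg : ∀ᵐ ξ : ℝ, ∑ j, spatialFactor (waveSlope j) 0 ξ * waveAmplitude H₀ H₁ j ξ =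
          𝓕 f₀ ξ := by
        filter_upwards [hne, hF₀] with ξ hξ hr
        rw [hr, ← sum_waveAmplitude H₀ H₁ hξ]
        simp [spatialFactor]
      obtain ⟨hgm, hge⟩ := IsWave.invFourierL2_sum hσ₀ hZ waveSlope_re_nonneg hAm hAt le_rfl hg
      rw [invFourierL2_fourier] at hge
      exact ae_restrict_of_ae (hge.trans hf₀)
    · have hg : ∀ᵐ ξ : ℝ, ∑ j, spatialFactor (waveSlope j) 0 ξ *
          (-waveSlope j * rootModulus ξ * waveAmplitude H₀ H₁ j ξ) = 𝓕 f₁ ξ := by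
        filter_upwards [hne, hF₁] with ξ hξ hr
        rw [hr, ← sum_waveSlope_mul_waveAmplitude H₀ H₁ hξ]
        simp [spatialFactor]
      obtain ⟨hgm, hge⟩ := IsWave.invFourierL2_sum hσ₁ hZ' waveSlope_re_nonneg hA'm hA't le_rfl hg
      rw [invFourierL2_fourier] at hge
      exact ae_restrict_of_ae (hge.trans hf₁)
  · have b1 : ∀ t, sobolevENorm s (Ioi 0) (fun x => ∑ j, Z j x t) ≤ (∑ j, Ct j : ℝ≥0) * E := by
      intro t
      refine (sobolevENorm_sum_le s (Ioi 0) (fun j x => Z j x t) Finset.univ).trans ?_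
      rw [ENNReal.ofNNReal_finsetSum, Finset.sum_mul]
      exact Finset.sum_le_sum fun j _ => ((htime j).2 t).trans (by gcongr; exact hAE j)
    have b2 : ∀ x, 0 ≤ x → sobolevENorm σ₀ (Ioo 0 T) (fun t => ∑ j, Z j x t) ≤ 4 * E := by
      intro x hx
      refine (sobolevENorm_sum_le σ₀ (Ioo 0 T) (fun j => Z j x) Finset.univ).trans ?_
      refine (Finset.sum_le_sum fun j _ => ((hZ j).sobolevENorm_le hσ₀ (waveSlope_re_nonneg j)
        (hAm j) (hAt j) hx _).trans (hAE j)).trans ?_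
      simp
    refine (add_le_add (iSup₂_le fun t _ => b1 t) (iSup₂_le fun x hx => b2 x hx)).trans ?_
    rw [hE]
    push_cast
    rw [← add_mul, ← mul_assoc]
end

/-! ### Weak derivatives in one variable -/

noncomputable section

/-- Test functions `θ ∈ C_c^∞(I)` of one variable. -/
def IsTestOn (I : Set ℝ) (θ : ℝ → ℂ) : Prop :=
  ContDiff ℝ ∞ θ ∧ HasCompactSupport θ ∧ tsupport θ ⊆ I

variable {I : Set ℝ} {θ : ℝ → ℂ}

theorem IsTestOn.isTestOn_deriv (h : IsTestOn I θ) : IsTestOn I (deriv θ) :=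
  ⟨((contDiff_infty_iff_deriv (𝕜 := ℝ)).1 h.1).2, h.2.1.deriv, (tsupport_deriv_subset (𝕜 := ℝ)).trans h.2.2⟩

theorem IsTestOn.isTestOn_iteratedDeriv (h : IsTestOn I θ) (k : ℕ) : IsTestOn I (iteratedDeriv k θ) := by
  induction k with
  | zero => simpa using h
  | succ k ih =>
    rw [iteratedDeriv_succ]
    exact ih.isTestOn_deriv

theorem IsTestOn.eq_zero (h : IsTestOn I θ) {x : ℝ} (hx : x ∉ I) : θ x = 0 :=
  image_eq_zero_of_notMem_tsupport fun h' => hx (h.2.2 h')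

theorem IsTestOn.sub_mul (h : IsTestOn I θ) {η : ℝ → ℂ} (hη : IsTestOn I η) (c : ℂ) :
    IsTestOn I (fun x => θ x - c * η x) := by
  refine ⟨h.1.sub (contDiff_const.mul hη.1), h.2.1.sub hη.2.1.mul_left, ?_⟩
  exact (tsupport_sub _ _).trans (union_subset h.2.2 ((tsupport_mul_subset_right).trans hη.2.2))

theorem IsTestOn.integrableOn_mul (h : IsTestOn I θ) {f : ℝ → ℂ} (hf : ContinuousOn f I) :
    IntegrableOn (fun x => f x * θ x) I := by
  have h1 : IntegrableOn (fun x => f x * θ x) (tsupport θ) :=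
    ((hf.mono h.2.2).mul h.1.continuous.continuousOn).integrableOn_compact h.2.1.isCompact
  refine ((integrableOn_iff_integrable_of_support_subset fun x hx => ?_).1 h1).integrableOn
  exact subset_tsupport θ (right_ne_zero_of_mul hx)

theorem IsTestOn.integrable_mul (h : IsTestOn I θ) {f : ℝ → ℂ} (hf : Continuous f) :
    Integrable (fun x => f x * θ x) :=
  (hf.mul h.1.continuous).integrable_of_hasCompactSupport h.2.1.mul_left

theorem IsTestOn.setIntegral_eq (h : IsTestOn I θ) (f : ℝ → ℂ) :
    ∫ x in I, f x * θ x = ∫ x, f x * θ x :=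
  setIntegral_eq_integral_of_forall_compl_eq_zero fun x hx => by rw [h.eq_zero hx, mul_zero]

theorem exists_isTestOn_integral_eq_one (hI : IsOpen I) (hne : I.Nonempty) :
    ∃ η : ℝ → ℂ, IsTestOn I η ∧ ∫ x, η x = 1 := by
  obtain ⟨x, hx⟩ := hne
  obtain ⟨ε, hε, hb⟩ := Metric.isOpen_iff.1 hI x hx
  let φ : ContDiffBump x := ⟨ε / 4, ε / 2, by positivity, by linarith⟩
  refine ⟨fun y => (φ.normed volume y : ℂ), ⟨?_, ?_, ?_⟩, ?_⟩
  · exact Complex.ofRealCLM.contDiff.comp φ.contDiff_normed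
  · exact (φ.hasCompactSupport_normed).comp_left (g := Complex.ofReal) rfl
  · refine (closure_mono (Function.support_comp_subset (g := Complex.ofReal) rfl _)).trans ?_
    change tsupport (φ.normed volume) ⊆ I
    rw [φ.tsupport_normed_eq]
    exact (Metric.closedBall_subset_ball (by change ε / 2 < ε; linarith)).trans hb
  · rw [integral_complex_ofReal, φ.integral_normed, Complex.ofReal_one]

/-- A test function with vanishing integral is the derivative of a test function. -/
theorem IsTestOn.exists_primitive (hI : I.OrdConnected) (h : IsTestOn I θ)
    (h0 : ∫ x, θ x = 0) : ∃ η, IsTestOn I η ∧ deriv η = θ := by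
  by_cases hemp : tsupport θ = ∅
  · have hz : θ = fun _ => 0 := by
      ext x
      exact image_eq_zero_of_notMem_tsupport (by simp [hemp])
    exact ⟨θ, h, by rw [hz]; simp⟩
  have hne : (tsupport θ).Nonempty := nonempty_iff_ne_empty.2 hemp
  have hcomp := h.2.1.isCompact
  set a := sInf (tsupport θ) with ha
  set b := sSup (tsupport θ) with hb
  -- The convex hull [a,b] of the support stays in I by order-connectedness. The primitive from a
  -- vanishes before a, and after b because the total integral is zero.
  have haI : a ∈ I := h.2.2 (hcomp.sInf_mem hne)
  have hbI : b ∈ I := h.2.2 (hcomp.sSup_mem hne)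
  have hlt : ∀ x, x < a → θ x = 0 := fun x hx => image_eq_zero_of_notMem_tsupport fun h' =>
    absurd (csInf_le hcomp.bddBelow h') (not_le.2 hx)
  have hgt : ∀ x, b < x → θ x = 0 := fun x hx => image_eq_zero_of_notMem_tsupport fun h' =>
    absurd (le_csSup hcomp.bddAbove h') (not_le.2 hx)
  have hθi : Integrable θ := h.1.continuous.integrable_of_hasCompactSupport h.2.1
  have hd : ∀ x, HasDerivAt (fun y => ∫ t in a..y, θ t) (θ x) x := fun x =>
    h.1.continuous.integral_hasStrictDerivAt a x |>.hasDerivAt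
  have hderiv : deriv (fun y => ∫ t in a..y, θ t) = θ := funext fun x => (hd x).deriv
  have hzero : ∀ x, x ∉ Icc a b → ∫ t in a..x, θ t = 0 := by
    intro x hx
    rcases lt_or_ge x a with h1 | h1
    · rw [intervalIntegral.integral_symm, intervalIntegral.integral_of_le h1.le,
        ← integral_Ioc_eq_integral_Ioo.symm, setIntegral_eq_zero_of_forall_eq_zero, neg_zero]
      exact fun t ht => hlt t ht.2
    · have h2 : b < x := by
        by_contra h2
        exact hx ⟨h1, not_lt.1 h2⟩
      rw [intervalIntegral.integral_of_le h1, integral_Ioc_eq_integral_Ioo,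
        ← integral_Icc_eq_integral_Ioo, setIntegral_eq_integral_of_forall_compl_eq_zero, h0]
      intro t ht
      by_contra hne
      refine ht ⟨?_, ?_⟩
      · by_contra h3; exact hne (hlt t (not_le.1 h3))
      · by_contra h3; exact hne (hgt t (h2.trans (not_le.1 h3)))
  have hsub : tsupport (fun y => ∫ t in a..y, θ t) ⊆ Icc a b :=
    closure_minimal (fun x hx => by
      by_contra h'
      exact hx (hzero x h')) isClosed_Icc
  refine ⟨_, ⟨?_, ?_, hsub.trans (hI.out haI hbI)⟩, hderiv⟩
  · rw [contDiff_infty_iff_deriv, hderiv]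
    exact ⟨fun x => (hd x).differentiableAt, h.1⟩
  · exact isCompact_Icc.of_isClosed_subset (isClosed_tsupport _) hsub

theorem IsTestOn.integral_mul_deriv (h : IsTestOn I θ) {U u : ℝ → ℂ} (hu : Continuous u)
    (hU : ∀ x, HasDerivAt U (u x) x) : ∫ x, U x * deriv θ x = -∫ x, u x * θ x := by
  have hUc : Continuous U := continuous_iff_continuousAt.2 fun x => (hU x).continuousAt
  refine integral_mul_deriv_eq_deriv_mul_of_integrable (fun x _ => hU x)
    (fun x _ => ((h.1.differentiable (by simp)) x).hasDerivAt) (h.isTestOn_deriv.integrable_mul hUc)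
    (h.integrable_mul hu) (h.integrable_mul hUc)

/-- The lemma of du Bois-Reymond: a weak derivative of order `k + 1` can be integrated once. -/
theorem exists_integral_iteratedDeriv_eq (hI : IsOpen I) (hIc : I.OrdConnected) (hne : I.Nonempty)
    {f u : ℝ → ℂ} (hf : ContinuousOn f I) (hu : Continuous u) (k : ℕ)
    (h : ∀ θ, IsTestOn I θ →
      ∫ x in I, f x * iteratedDeriv (k + 1) θ x = ∫ x in I, u x * θ x) :
    ∃ v : ℝ → ℂ, (∀ x, HasDerivAt v (-u x) x) ∧
      ∀ θ, IsTestOn I θ → ∫ x in I, f x * iteratedDeriv k θ x = ∫ x in I, v x * θ x := by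
  obtain ⟨η, hη, hη1⟩ := exists_isTestOn_integral_eq_one hI hne
  set U : ℝ → ℂ := fun x => ∫ t in (0 : ℝ)..x, u t with hU
  have hUd : ∀ x, HasDerivAt U (u x) x := fun x => (hu.integral_hasStrictDerivAt 0 x).hasDerivAt
  have hUc : Continuous U := continuous_iff_continuousAt.2 fun x => (hUd x).continuousAt
  -- The constant of integration, read off by testing with η itself. A general θ minus (∫θ)η has
  -- zero mean, hence is the derivative of a test function to which the hypothesis applies.
  set c : ℂ := (∫ x in I, f x * iteratedDeriv k η x) + ∫ x, U x * η x with hc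
  refine ⟨fun x => c - U x, fun x => by simpa using (hUd x).const_sub c, fun θ hθ => ?_⟩
  have hψ := hθ.sub_mul hη (∫ x, θ x)
  have hθi : Integrable θ := hθ.1.continuous.integrable_of_hasCompactSupport hθ.2.1
  have hηi : Integrable η := hη.1.continuous.integrable_of_hasCompactSupport hη.2.1
  obtain ⟨χ, hχ, hχd⟩ := hψ.exists_primitive hIc (by
    rw [integral_sub hθi (hηi.const_mul _), integral_const_mul, hη1]
    ring)
  have h1 := h χ hχ
  rw [iteratedDeriv_succ', hχd, hχ.setIntegral_eq, ← neg_inj, ← hχ.integral_mul_deriv hu hUd, hχd]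
    at h1
  have e1 : ∀ x, iteratedDeriv k (fun x => θ x - (∫ y, θ y) * η x) x =
      iteratedDeriv k θ x - (∫ y, θ y) * iteratedDeriv k η x := by
    intro x
    have a1 : ContDiffAt ℝ k θ x := (hθ.1.of_le (by exact_mod_cast le_top)).contDiffAt
    have a2 : ContDiffAt ℝ k η x := (hη.1.of_le (by exact_mod_cast le_top)).contDiffAt
    have := iteratedDeriv_fun_sub (n := k) (x := x) a1 (contDiffAt_const (c := ∫ y, θ y) |>.mul a2)
    rw [this, iteratedDeriv_const_mul_field]
  simp_rw [e1, mul_sub, mul_left_comm _ (∫ y, θ y)] at h1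
  rw [integral_sub ((hθ.isTestOn_iteratedDeriv k).integrableOn_mul hf)
      (((hη.isTestOn_iteratedDeriv k).integrableOn_mul hf).const_mul _),
    integral_sub (hθ.integrable_mul hUc) ((hη.integrable_mul hUc).const_mul _),
    integral_const_mul, integral_const_mul] at h1
  rw [hθ.setIntegral_eq]
  simp_rw [sub_mul]
  rw [integral_sub (hθi.const_mul c) (hθ.integrable_mul hUc), integral_const_mul, hc]
  linear_combination -h1

theorem ae_eq_of_integral_isTestOn_eq (hI : IsOpen I) {f g : ℝ → ℂ}
    (hf : LocallyIntegrableOn f I) (hg : LocallyIntegrableOn g I)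
    (h : ∀ θ, IsTestOn I θ → ∫ x in I, f x * θ x = ∫ x in I, g x * θ x) :
    f =ᵐ[volume.restrict I] g := by
  have h1 := hI.ae_eq_zero_of_integral_contDiff_smul_eq_zero (hf.sub hg) fun φ hφ hφc hφs => by
    have hθ : IsTestOn I fun x => (φ x : ℂ) := by
      refine ⟨Complex.ofRealCLM.contDiff.comp hφ, hφc.comp_left (g := Complex.ofReal) rfl, ?_⟩
      exact (closure_mono (Function.support_comp_subset (g := Complex.ofReal) rfl _)).trans hφs
    have hi : ∀ {f : ℝ → ℂ}, LocallyIntegrableOn f I →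
        IntegrableOn (fun x => f x * (φ x : ℂ)) I := fun {f} hf => by
      have h1 : IntegrableOn (fun x => f x * (φ x : ℂ)) (tsupport φ) :=
        (hf.integrableOn_compact_subset hφs hφc.isCompact).mul_continuousOn
          hθ.1.continuous.continuousOn hφc.isCompact
      refine ((integrableOn_iff_integrable_of_support_subset fun x hx => ?_).1 h1).integrableOn
      exact subset_tsupport φ (Complex.ofReal_ne_zero.1 (right_ne_zero_of_mul hx))
    have h2 := h _ hθ
    rw [← sub_eq_zero, ← integral_sub (hi hf) (hi hg)] at h2
    rw [← h2, ← setIntegral_eq_integral_of_forall_compl_eq_zero (s := I)]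
    · congr with x
      simp only [Pi.sub_apply, Complex.real_smul]
      ring
    · intro x hx
      rw [image_eq_zero_of_notMem_tsupport fun h' => hx (hφs h'), zero_smul]
  rw [EventuallyEq, ae_restrict_iff' hI.measurableSet]
  filter_upwards [h1] with x hx hxI
  exact sub_eq_zero.1 (hx hxI)

theorem eqOn_of_integral_isTestOn_eq (hI : IsOpen I) {f g : ℝ → ℂ}
    (hf : ContinuousOn f I) (hg : ContinuousOn g I)
    (h : ∀ θ, IsTestOn I θ → ∫ x in I, f x * θ x = ∫ x in I, g x * θ x) : EqOn f g I :=
  Measure.eqOn_open_of_ae_eq (ae_eq_of_integral_isTestOn_eq hI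
    (hf.locallyIntegrableOn hI.measurableSet) (hg.locallyIntegrableOn hI.measurableSet) h) hI hf hg
end

/-! ### Green's formula on the half-line without decay assumptions on derivatives -/

noncomputable section

theorem tendsto_integral_norm_window {f : ℝ → ℂ} (hf : Continuous f)
    (h2 : MemLp f 2 (volume.restrict (Ioi 0))) :
    Tendsto (fun n : ℕ => ∫ x in (n : ℝ)..(n + 1), ‖f x‖) atTop (𝓝 0) := by
  have hsq : IntegrableOn (fun x => ‖f x‖ ^ 2) (Ioi 0) :=
    (memLp_two_iff_integrable_sq_norm h2.1).1 h2
  have hci : ∀ a b, IntervalIntegrable (fun x => ‖f x‖ ^ 2) volume a b := fun a b =>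
    (hf.norm.pow 2).intervalIntegrable a b
  have hn : Tendsto (fun n : ℕ => (n : ℝ)) atTop atTop := tendsto_natCast_atTop_atTop
  have l1 := intervalIntegral_tendsto_integral_Ioi 0 hsq hn
  have l2 := intervalIntegral_tendsto_integral_Ioi 0 hsq (tendsto_atTop_add_const_right _ 1 hn)
  have l3 : Tendsto (fun n : ℕ => ∫ x in (n : ℝ)..(n + 1), ‖f x‖ ^ 2) atTop (𝓝 0) := by
    have := l2.sub l1
    rw [sub_self] at this
    refine this.congr fun n => ?_
    exact intervalIntegral.integral_interval_sub_left (hci _ _) (hci _ _)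
  rw [Metric.tendsto_atTop] at l3 ⊢
  intro ε hε
  obtain ⟨N, hN⟩ := l3 ((ε / 2) ^ 2) (by positivity)
  refine ⟨N, fun n hnN => ?_⟩
  have h3 := hN n hnN
  have hle : (n : ℝ) ≤ n + 1 := by linarith
  rw [Real.dist_eq, sub_zero] at h3 ⊢
  rw [abs_of_nonneg (intervalIntegral.integral_nonneg hle fun _ _ => by positivity)] at h3 ⊢
  -- Young's inequality ‖f‖ ≤ ε/4 + ‖f‖²/ε on an interval of length 1 stands in for Cauchy–Schwarz.
  have h4 : ∫ x in (n : ℝ)..(n + 1), ‖f x‖ ≤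
      ∫ x in (n : ℝ)..(n + 1), (ε / 2 / 2 + ‖f x‖ ^ 2 / ε) := by
    refine intervalIntegral.integral_mono_on hle (hf.norm.intervalIntegrable _ _) ?_ fun x _ => ?_
    · exact ((continuous_const).add ((hf.norm.pow 2).div_const _)).intervalIntegrable _ _
    · rw [← sub_nonneg]
      have : ε / 2 / 2 + ‖f x‖ ^ 2 / ε - ‖f x‖ = (ε / 2 - ‖f x‖) ^ 2 / ε := by
        field_simp
        ring
      rw [this]
      positivity
  refine h4.trans_lt ?_
  rw [intervalIntegral.integral_add (by simp) ((hci _ _).div_const _), intervalIntegral.integral_const,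
    intervalIntegral.integral_div]
  have : (∫ x in (n : ℝ)..(n + 1), ‖f x‖ ^ 2) / ε < (ε / 2) ^ 2 / ε := by gcongr
  have e : (ε / 2) ^ 2 / ε = ε / 4 := by field_simp; ring
  rw [e] at this
  simp only [add_sub_cancel_left, one_smul]
  linarith

variable {F₀ F₁ F₂ F₃ F₄ : ℝ → ℂ}

/-- Green's formula for the fourth derivative on `[n, n + 1]`, tested with a polynomial that
vanishes to fourth order at the right end. -/
theorem tendsto_boundary_form (h₀ : ∀ x, HasDerivAt F₀ (F₁ x) x)
    (h₁ : ∀ x, HasDerivAt F₁ (F₂ x) x) (h₂ : ∀ x, HasDerivAt F₂ (F₃ x) x)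
    (h₃ : ∀ x, HasDerivAt F₃ (F₄ x) x) (h₄ : Continuous F₄)
    (hL₀ : MemLp F₀ 2 (volume.restrict (Ioi 0))) (hL₄ : MemLp F₄ 2 (volume.restrict (Ioi 0)))
    {p p₁ p₂ p₃ : Polynomial ℂ} (e₁ : p.derivative = p₁) (e₂ : p₁.derivative = p₂)
    (e₃ : p₂.derivative = p₃)
    (hp : p.eval 1 = 0) (hp₁ : p₁.eval 1 = 0) (hp₂ : p₂.eval 1 = 0) (hp₃ : p₃.eval 1 = 0) :
    Tendsto (fun n : ℕ => F₃ n * p.eval 0 - F₂ n * p₁.eval 0 + F₁ n * p₂.eval 0 - F₀ n * p₃.eval 0)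
      atTop (𝓝 0) := by
  have c₀ : Continuous F₀ := continuous_iff_continuousAt.2 fun x => (h₀ x).continuousAt
  have hd : ∀ (q : Polynomial ℂ) (n : ℕ) (x : ℝ), HasDerivAt (fun y : ℝ => q.eval ((y : ℂ) - n))
      (q.derivative.eval ((x : ℂ) - n)) x := fun q n x => by
    have := (q.hasDerivAt ((x : ℂ) - n)).comp_sub_const (x : ℂ) (n : ℂ)
    exact this.comp_ofReal
  -- The bilinear concomitant of ∂⁴: its derivative telescopes to F₄p - F₀p'''', so only the two
  -- functions known to be in L² remain under the integral.
  have hB : ∀ (n : ℕ) (x : ℝ), HasDerivAt (fun y : ℝ => F₃ y * p.eval ((y : ℂ) - n) -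
      F₂ y * p₁.eval ((y : ℂ) - n) + F₁ y * p₂.eval ((y : ℂ) - n) - F₀ y * p₃.eval ((y : ℂ) - n))
      (F₄ x * p.eval ((x : ℂ) - n) - F₀ x * p₃.derivative.eval ((x : ℂ) - n)) x := fun n x => by
    subst e₁ e₂ e₃
    refine ((((h₃ x).fun_mul (hd p n x)).fun_sub ((h₂ x).fun_mul (hd _ n x))).fun_add
      ((h₁ x).fun_mul (hd _ n x))).fun_sub ((h₀ x).fun_mul (hd _ n x)) |>.congr_deriv ?_
    ring
  have hpc : ∀ (q : Polynomial ℂ) (n : ℕ), Continuous fun y : ℝ => q.eval ((y : ℂ) - n) :=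
    fun q n => q.continuous.comp (by fun_prop)
  have hint : ∀ n : ℕ, F₃ n * p.eval 0 - F₂ n * p₁.eval 0 + F₁ n * p₂.eval 0 - F₀ n * p₃.eval 0 =
      -∫ x in (n : ℝ)..(n + 1), (F₄ x * p.eval ((x : ℂ) - n) -
        F₀ x * p₃.derivative.eval ((x : ℂ) - n)) := fun n => by
    rw [intervalIntegral.integral_eq_sub_of_hasDerivAt (fun x _ => hB n x)
      (((h₄.mul (hpc p n)).sub (c₀.mul (hpc p₃.derivative n))).intervalIntegrable _ _)]
    simp [hp, hp₁, hp₂, hp₃]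
  have hbound : ∀ q : Polynomial ℂ, ∃ K : ℝ, ∀ (n : ℕ) (x : ℝ), x ∈ Icc (n : ℝ) (n + 1) →
      ‖q.eval ((x : ℂ) - n)‖ ≤ K := fun q => by
    obtain ⟨K, hK⟩ := (isCompact_Icc (a := (0 : ℝ)) (b := 1)).exists_bound_of_continuousOn
      (f := fun y : ℝ => q.eval (y : ℂ)) (q.continuous.comp Complex.continuous_ofReal).continuousOn
    refine ⟨K, fun n x hx => ?_⟩
    simpa using hK (x - n) ⟨by linarith [hx.1], by linarith [hx.2]⟩
  obtain ⟨K, hK⟩ := hbound p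
  obtain ⟨K', hK'⟩ := hbound p₃.derivative
  have hlim : Tendsto (fun n : ℕ => K * (∫ x in (n : ℝ)..(n + 1), ‖F₄ x‖) +
      K' * ∫ x in (n : ℝ)..(n + 1), ‖F₀ x‖) atTop (𝓝 0) := by
    have := ((tendsto_integral_norm_window h₄ hL₄).const_mul K).add
      ((tendsto_integral_norm_window c₀ hL₀).const_mul K')
    simpa using this
  refine squeeze_zero_norm (fun n => ?_) hlim
  have hle : (n : ℝ) ≤ n + 1 := by linarith
  rw [hint n, norm_neg]
  refine (intervalIntegral.norm_integral_le_of_norm_le hle (g := fun x => K * ‖F₄ x‖ + K' * ‖F₀ x‖)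
    (Eventually.of_forall fun x hx => ?_) ?_).trans (le_of_eq ?_)
  · refine (norm_sub_le _ _).trans ?_
    rw [norm_mul, norm_mul, mul_comm K, mul_comm K']
    gcongr
    · exact hK n x (Ioc_subset_Icc_self hx)
    · exact hK' n x (Ioc_subset_Icc_self hx)
  · exact ((h₄.norm.const_mul K).add (c₀.norm.const_mul K')).intervalIntegrable _ _
  · rw [intervalIntegral.integral_add ((h₄.norm.const_mul K).intervalIntegrable _ _)
      ((c₀.norm.const_mul K').intervalIntegrable _ _), intervalIntegral.integral_const_mul,
      intervalIntegral.integral_const_mul]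

-- Boundary terms at infinity are needed only along integers. The polynomials (X-1)⁴q vanish to
-- fourth order at 1, and q = X³, X², X, 1 give a triangular system for F₀, F₁, F₂, F₃ at n. The
-- coefficients below come from the expansion of (X-1)⁴ at 0, solved from F₀ upwards.
open Polynomial in
theorem tendsto_derivatives_zero (h₀ : ∀ x, HasDerivAt F₀ (F₁ x) x)
    (h₁ : ∀ x, HasDerivAt F₁ (F₂ x) x) (h₂ : ∀ x, HasDerivAt F₂ (F₃ x) x)
    (h₃ : ∀ x, HasDerivAt F₃ (F₄ x) x) (h₄ : Continuous F₄)
    (hL₀ : MemLp F₀ 2 (volume.restrict (Ioi 0))) (hL₄ : MemLp F₄ 2 (volume.restrict (Ioi 0))) :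
    Tendsto (fun n : ℕ => F₀ n) atTop (𝓝 0) ∧ Tendsto (fun n : ℕ => F₁ n) atTop (𝓝 0) ∧
    Tendsto (fun n : ℕ => F₂ n) atTop (𝓝 0) ∧ Tendsto (fun n : ℕ => F₃ n) atTop (𝓝 0) := by
  have key : ∀ q : Polynomial ℂ, Tendsto (fun n : ℕ =>
      F₃ n * ((X - 1) ^ 4 * q : ℂ[X]).eval 0 -
      F₂ n * (derivative ((X - 1) ^ 4 * q : ℂ[X])).eval 0 +
      F₁ n * (derivative (derivative ((X - 1) ^ 4 * q : ℂ[X]))).eval 0 -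
      F₀ n * (derivative (derivative (derivative ((X - 1) ^ 4 * q : ℂ[X])))).eval 0)
      atTop (𝓝 0) := fun q =>
    tendsto_boundary_form h₀ h₁ h₂ h₃ h₄ hL₀ hL₄ rfl rfl rfl (by simp) (by simp [derivative_pow])
      (by simp [derivative_pow]) (by simp [derivative_pow])
  have k3 := key (X ^ 3)
  have k2 := key (X ^ 2)
  have k1 := key X
  have k0 := key 1
  simp [derivative_pow] at k3 k2 k1 k0
  have f0 : Tendsto (fun n : ℕ => F₀ n) atTop (𝓝 0) := by
    have := k3.const_mul (-(1 / 6))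
    rw [mul_zero] at this
    exact this.congr fun n => by ring
  have f1 : Tendsto (fun n : ℕ => F₁ n) atTop (𝓝 0) := by
    have := (k2.const_mul (1 / 2)).add (f0.const_mul (-12))
    rw [mul_zero, mul_zero, add_zero] at this
    exact this.congr fun n => by ring
  have f2 : Tendsto (fun n : ℕ => F₂ n) atTop (𝓝 0) := by
    have := ((k1.const_mul (-1)).add (f0.const_mul (-36))).add (f1.const_mul (-8))
    simp only [mul_zero, add_zero] at this
    exact this.congr fun n => by ring
  refine ⟨f0, f1, f2, ?_⟩
  have := ((k0.add (f0.const_mul (-24))).add (f1.const_mul (-12))).add (f2.const_mul (-4))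
  simp only [mul_zero, add_zero] at this
  exact this.congr fun n => by ring

/-- The clamped operator `∂⁴` on the half-line is symmetric. -/
theorem integral_inner_I_mul_eq_zero (h₀ : ∀ x, HasDerivAt F₀ (F₁ x) x)
    (h₁ : ∀ x, HasDerivAt F₁ (F₂ x) x) (h₂ : ∀ x, HasDerivAt F₂ (F₃ x) x)
    (h₃ : ∀ x, HasDerivAt F₃ (F₄ x) x) (h₄ : Continuous F₄)
    (hL₀ : MemLp F₀ 2 (volume.restrict (Ioi 0))) (hL₄ : MemLp F₄ 2 (volume.restrict (Ioi 0)))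
    (z₀ : F₀ 0 = 0) (z₁ : F₁ 0 = 0) :
    ∫ x in Ioi (0 : ℝ), inner ℝ (F₀ x) (Complex.I * F₄ x) = 0 := by
  have c₀ : Continuous F₀ := continuous_iff_continuousAt.2 fun x => (h₀ x).continuousAt
  obtain ⟨t0, t1, t2, t3⟩ := tendsto_derivatives_zero h₀ h₁ h₂ h₃ h₄ hL₀ hL₄
  have hi : IntegrableOn (fun x => inner ℝ (F₀ x) (Complex.I * F₄ x)) (Ioi 0) :=
    (L2.integrable_inner (𝕜 := ℝ) (hL₀.toLp F₀) ((hL₄.const_mul Complex.I).toLp _)).congr (by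
      filter_upwards [hL₀.coeFn_toLp, (hL₄.const_mul Complex.I).coeFn_toLp] with x h1 h2
      rw [h1, h2])
  have l1 := intervalIntegral_tendsto_integral_Ioi 0 hi
    (tendsto_natCast_atTop_atTop (R := ℝ))
  refine tendsto_nhds_unique l1 ?_
  have l2 : Tendsto (fun n : ℕ => inner ℝ (F₀ n) (Complex.I * F₃ n) -
      inner ℝ (F₁ n) (Complex.I * F₂ n)) atTop (𝓝 0) := by
    have := (t0.inner (𝕜 := ℝ) (t3.const_mul Complex.I)).sub
      (t1.inner (𝕜 := ℝ) (t2.const_mul Complex.I))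
    simpa using this
  refine l2.congr fun n => ?_
  have hd : ∀ x, HasDerivAt (fun x => inner ℝ (F₀ x) (Complex.I * F₃ x) -
      inner ℝ (F₁ x) (Complex.I * F₂ x)) (inner ℝ (F₀ x) (Complex.I * F₄ x)) x := fun x => by
    refine (((h₀ x).inner ℝ ((h₃ x).const_mul Complex.I)).sub
      ((h₁ x).inner ℝ ((h₂ x).const_mul Complex.I))).congr_deriv ?_
    -- Multiplication by i is skew for the real inner product; this kills the only term that two
    -- integrations by parts leave.
    have : inner ℝ (F₂ x) (Complex.I * F₂ x) = 0 := by
      simp [Complex.inner]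
      ring
    rw [this]
    ring
  rw [intervalIntegral.integral_eq_sub_of_hasDerivAt (fun x _ => hd x)
    ((c₀.inner (h₄.const_mul Complex.I)).intervalIntegrable _ _), z₀, z₁]
  simp
end

/-! ### Slices in L² and Fubini on the strip -/

noncomputable section

theorem ContinuousInSobolev.exists_continuousOn_Lp {J I : Set ℝ} {u : ℝ → ℝ → ℂ}
    (hu : ContinuousInSobolev J 0 I u) :
    ∃ U : ℝ → Lp ℂ 2 (volume.restrict I), ContinuousOn U J ∧
      ∀ a ∈ J, U a =ᵐ[volume.restrict I] u a := by
  classical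
  have hL : ∀ a ∈ J, MemLp (u a) 2 (volume.restrict I) := fun a ha =>
    memLp_of_sobolevENorm_lt_top le_rfl (hu a ha).1
  refine ⟨fun a => if h : MemLp (u a) 2 (volume.restrict I) then h.toLp (u a) else 0, ?_, ?_⟩
  · intro a ha
    rw [ContinuousWithinAt, tendsto_iff_edist_tendsto_0]
    refine tendsto_of_tendsto_of_tendsto_of_le_of_le' tendsto_const_nhds (hu a ha).2
      (Eventually.of_forall fun _ => bot_le) ?_
    filter_upwards [self_mem_nhdsWithin] with b hb
    rw [dif_pos (hL b hb), dif_pos (hL a ha), Lp.edist_toLp_toLp]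
    exact eLpNorm_restrict_le_sobolevENorm le_rfl _
  · intro a ha
    simp only [dif_pos (hL a ha)]
    exact (hL a ha).coeFn_toLp

/-- Integration against a square integrable function, as a functional on `L²`. -/
def l2Pairing {I : Set ℝ} {k : ℝ → ℂ} (hk : MemLp k 2 (volume.restrict I)) :
    Lp ℂ 2 (volume.restrict I) →L[ℂ] ℂ :=
  innerSL ℂ (hk.star.toLp (star k))

theorem l2Pairing_apply {I : Set ℝ} {k : ℝ → ℂ} (hk : MemLp k 2 (volume.restrict I))
    (f : Lp ℂ 2 (volume.restrict I)) : l2Pairing hk f = ∫ x in I, f x * k x := by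
  unfold l2Pairing
  rw [innerSL_apply_apply, L2.inner_def]
  refine integral_congr_ae ?_
  filter_upwards [hk.star.coeFn_toLp] with x hx
  rw [hx]
  simp

theorem ContinuousInSobolev.continuousOn_pairing {J I : Set ℝ} {u : ℝ → ℝ → ℂ}
    (hu : ContinuousInSobolev J 0 I u) {k : ℝ → ℂ} (hk : MemLp k 2 (volume.restrict I)) :
    ContinuousOn (fun a => ∫ y in I, u a y * k y) J := by
  obtain ⟨U, hU, hUu⟩ := hu.exists_continuousOn_Lp
  refine ((l2Pairing hk).continuous.comp_continuousOn hU).congr fun a ha => ?_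
  rw [Function.comp_apply, l2Pairing_apply]
  refine integral_congr_ae ?_
  filter_upwards [hUu a ha] with y hy
  rw [hy]

theorem sobolevENorm_neg_le (σ : ℝ) (I : Set ℝ) (g : ℝ → ℂ) :
    sobolevENorm σ I (fun y => -g y) ≤ sobolevENorm σ I g := by
  refine le_iInf₂ fun f hf => (sobolevENorm_le (-f) ?_).trans (le_of_eq ?_)
  · filter_upwards [hf, ae_restrict_of_ae (Lp.coeFn_neg f)] with x h1 h2
    rw [h2, Pi.neg_apply, h1]
  · have e : (𝓕 (-f) : Lp ℂ 2 (volume : Measure ℝ)) = -𝓕 f :=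
      map_neg (Lp.fourierTransformₗᵢ ℝ ℂ) f
    unfold sobolevLineENorm
    rw [e, ← eLpNorm_neg]
    refine eLpNorm_congr_ae ?_
    filter_upwards [Lp.coeFn_neg (𝓕 f : Lp ℂ 2 (volume : Measure ℝ))] with x hx
    rw [Pi.neg_apply, hx, Pi.neg_apply]
    ring

theorem ContinuousInSobolev.sub {σ : ℝ} {J I : Set ℝ} {u v : ℝ → ℝ → ℂ}
    (hu : ContinuousInSobolev J σ I u) (hv : ContinuousInSobolev J σ I v) :
    ContinuousInSobolev J σ I (fun a y => u a y - v a y) := by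
  have key : ∀ g g' : ℝ → ℂ, sobolevENorm σ I (fun y => g y - g' y) ≤
      sobolevENorm σ I g + sobolevENorm σ I g' := fun g g' => by
    simp_rw [sub_eq_add_neg]
    exact (sobolevENorm_add_le σ I g _).trans (add_le_add le_rfl (sobolevENorm_neg_le σ I g'))
  intro a ha
  refine ⟨(key _ _).trans_lt (ENNReal.add_lt_top.2 ⟨(hu a ha).1, (hv a ha).1⟩), ?_⟩
  have hlim := (hu a ha).2.add (hv a ha).2
  rw [add_zero] at hlim
  refine tendsto_of_tendsto_of_tendsto_of_le_of_le tendsto_const_nhds hlim (fun _ => bot_le)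
    fun b => ?_
  refine le_trans (le_of_eq ?_) (key _ _)
  congr with y
  ring

/-- By continuity in x the L²(0,T) norms of the slices are bounded on compact ranges of x, which
gives local integrability up to the boundary x = 0. -/
theorem integrableOn_box {T : ℝ} {u : ℝ → ℝ → ℂ}
    (hm : AEStronglyMeasurable (fun p : ℝ × ℝ => u p.1 p.2) (volume.restrict (halfStrip T)))
    (hc : ContinuousInSobolev (Ici 0) 0 (Ioo 0 T) u) (R : ℝ) :
    IntegrableOn (fun p : ℝ × ℝ => u p.1 p.2) (Ioo 0 R ×ˢ Ioo 0 T) := by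
  obtain ⟨U, hU, hUu⟩ := hc.exists_continuousOn_Lp
  obtain ⟨K, hK⟩ := (isCompact_Icc (a := (0 : ℝ)) (b := R)).exists_bound_of_continuousOn
    (hU.mono Icc_subset_Ici_self)
  have hsub : Ioo 0 R ×ˢ Ioo 0 T ⊆ halfStrip T := fun p hp => ⟨hp.1.1, hp.2⟩
  have hm' := hm.mono_measure (Measure.restrict_mono hsub le_rfl)
  refine ⟨hm', ?_⟩
  rw [hasFiniteIntegral_iff_enorm]
  rw [Measure.volume_eq_prod, ← Measure.prod_restrict] at hm' ⊢
  rw [lintegral_prod _ hm'.enorm]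
  have hb : ∀ x ∈ Ioo 0 R, ∫⁻ t in Ioo 0 T, ‖u x t‖ₑ ≤
      ENNReal.ofReal K * volume (Ioo 0 T) ^ (1 / 2 : ℝ) := by
    intro x hx
    have hx0 : x ∈ Ici (0 : ℝ) := le_of_lt hx.1
    have hLx : AEStronglyMeasurable (u x) (volume.restrict (Ioo 0 T)) :=
      (Lp.aestronglyMeasurable _).congr (hUu x hx0)
    rw [← eLpNorm_one_eq_lintegral_enorm]
    refine (eLpNorm_le_eLpNorm_mul_rpow_measure_univ (p := 1) (q := 2) (by norm_num) hLx).trans ?_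
    rw [← eLpNorm_congr_ae (hUu x hx0), Measure.restrict_apply_univ]
    norm_num
    gcongr
    rw [← Lp.enorm_def, ← ofReal_norm]
    exact ENNReal.ofReal_le_ofReal (hK x (Ioo_subset_Icc_self hx))
  refine (setLIntegral_mono' measurableSet_Ioo hb).trans_lt ?_
  rw [setLIntegral_const]
  refine ENNReal.mul_lt_top (ENNReal.mul_lt_top (by simp) ?_) (by simp)
  exact ENNReal.rpow_lt_top_of_nonneg (by norm_num) (by simp)

theorem integrableOn_halfStrip_mul {T : ℝ} {u : ℝ → ℝ → ℂ}
    (hloc : ∀ R, IntegrableOn (fun p : ℝ × ℝ => u p.1 p.2) (Ioo 0 R ×ˢ Ioo 0 T))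
    {ψ : ℝ × ℝ → ℂ} (hψ : Measurable ψ) {B R : ℝ} (hB : ∀ p, ‖ψ p‖ ≤ B)
    (hR : ∀ p : ℝ × ℝ, R ≤ p.1 → ψ p = 0) :
    IntegrableOn (fun p => u p.1 p.2 * ψ p) (halfStrip T) := by
  have h1 : IntegrableOn (fun p => u p.1 p.2 * ψ p) (Ioo 0 R ×ˢ Ioo 0 T) :=
    (hloc R).mul_bdd hψ.aestronglyMeasurable (Eventually.of_forall hB)
  refine h1.of_forall_sdiff_eq_zero (measurableSet_halfStrip T) fun p hp => ?_
  rw [hR p, mul_zero]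
  by_contra h
  exact hp.2 ⟨⟨hp.1.1, not_le.1 h⟩, hp.1.2⟩

/-- Fubini in both orders. The factor in t is only bounded and measurable, so that kernels supported
on (0,t) are admissible as well as test functions. -/
theorem setIntegral_halfStrip_mul {T : ℝ} {u : ℝ → ℝ → ℂ}
    (hloc : ∀ R, IntegrableOn (fun p : ℝ × ℝ => u p.1 p.2) (Ioo 0 R ×ˢ Ioo 0 T))
    {θ : ℝ → ℂ} (hθ : IsTestOn (Ioi 0) θ) {k : ℝ → ℂ} (hk : Measurable k) {B : ℝ}
    (hB : ∀ t, ‖k t‖ ≤ B) :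
    IntegrableOn (fun p : ℝ × ℝ => u p.1 p.2 * (θ p.1 * k p.2)) (halfStrip T) ∧
    IntegrableOn (fun t => (∫ x in Ioi 0, u x t * θ x) * k t) (Ioo 0 T) ∧
    ∫ p in halfStrip T, u p.1 p.2 * (θ p.1 * k p.2) =
      ∫ x in Ioi 0, (∫ t in Ioo 0 T, u x t * k t) * θ x ∧
    ∫ p in halfStrip T, u p.1 p.2 * (θ p.1 * k p.2) =
      ∫ t in Ioo 0 T, (∫ x in Ioi 0, u x t * θ x) * k t := by
  obtain ⟨M, hM⟩ := hθ.1.continuous.bounded_above_of_compact_support hθ.2.1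
  obtain ⟨R, hR⟩ := hθ.2.1.isCompact.bddAbove
  have hi : IntegrableOn (fun p : ℝ × ℝ => u p.1 p.2 * (θ p.1 * k p.2)) (halfStrip T) := by
    refine integrableOn_halfStrip_mul hloc (B := M * B) (R := R + 1)
      ((hθ.1.continuous.measurable.comp measurable_fst).mul (hk.comp measurable_snd))
      (fun p => ?_) fun p hp => ?_
    · rw [norm_mul]
      exact mul_le_mul (hM _) (hB _) (norm_nonneg _) ((norm_nonneg _).trans (hM 0))
    · rw [image_eq_zero_of_notMem_tsupport fun h => absurd (hR h) (not_le.2 (by linarith)), zero_mul]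
  have hi' := hi
  unfold IntegrableOn halfStrip at hi'
  rw [Measure.volume_eq_prod, ← Measure.prod_restrict] at hi'
  refine ⟨hi, ?_, ?_, ?_⟩
  · refine hi'.integral_prod_right.congr (Eventually.of_forall fun t => ?_)
    dsimp only
    rw [← integral_mul_const]
    congr with x
    ring
  · unfold halfStrip
    rw [Measure.volume_eq_prod, ← Measure.prod_restrict, integral_prod _ hi']
    congr with x
    rw [← integral_mul_const]
    congr with t
    ring
  · unfold halfStrip
    rw [Measure.volume_eq_prod, ← Measure.prod_restrict, integral_prod_symm _ hi']
    congr with t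
    rw [← integral_mul_const]
    congr with x
    ring
end

/-! ### Differences of solutions and their pairings with test functions -/

noncomputable section

theorem IsTestOn.mul_prod {T : ℝ} {θ η : ℝ → ℂ} (hθ : IsTestOn (Ioi 0) θ)
    (hη : IsTestOn (Ioo 0 T) η) : IsTestFunctionOn (halfStrip T) (fun p => θ p.1 * η p.2) := by
  have hsub : tsupport (fun p : ℝ × ℝ => θ p.1 * η p.2) ⊆ tsupport θ ×ˢ tsupport η := by
    refine closure_minimal (fun p hp => ?_) ((isClosed_tsupport _).prod (isClosed_tsupport _))
    exact ⟨subset_tsupport _ (left_ne_zero_of_mul hp), subset_tsupport _ (right_ne_zero_of_mul hp)⟩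
  refine ⟨(hθ.1.comp contDiff_fst).mul (hη.1.comp contDiff_snd), ?_,
    hsub.trans (prod_mono hθ.2.2 hη.2.2)⟩
  exact (hθ.2.1.isCompact.prod hη.2.1.isCompact).of_isClosed_subset (isClosed_tsupport _) hsub

theorem IsTestFunctionOn.integrableOn_mul {T : ℝ} {u : ℝ → ℝ → ℂ} {ψ : ℝ × ℝ → ℂ}
    (h : IsTestFunctionOn (halfStrip T) ψ)
    (hloc : ∀ R, IntegrableOn (fun p : ℝ × ℝ => u p.1 p.2) (Ioo 0 R ×ˢ Ioo 0 T)) :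
    IntegrableOn (fun p => u p.1 p.2 * ψ p) (halfStrip T) := by
  obtain ⟨B, hB⟩ := h.1.continuous.bounded_above_of_compact_support h.2.1
  obtain ⟨R, hR⟩ := (h.2.1.isCompact.image continuous_fst).bddAbove
  refine integrableOn_halfStrip_mul hloc h.1.continuous.measurable (R := R + 1) hB fun p hp => ?_
  refine image_eq_zero_of_notMem_tsupport fun h' => ?_
  linarith [hR (mem_image_of_mem Prod.fst h')]

theorem IsHalfLineSolution.sub {T : ℝ} {h₀ h₁ : ℝ → ℂ} {z zx w wx : ℝ → ℝ → ℂ}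
    (hw : IsHalfLineSolution T h₀ h₁ w wx) (hz : IsHalfLineSolution T h₀ h₁ z zx) :
    IsHalfLineSolution T (fun _ => 0) (fun _ => 0) (fun x t => w x t - z x t)
      (fun x t => wx x t - zx x t) := by
  have lz := integrableOn_box hz.measurable hz.continuous_space
  have lzx := integrableOn_box hz.measurable_dx hz.continuous_space_dx
  have lw := integrableOn_box hw.measurable hw.continuous_space
  have lwx := integrableOn_box hw.measurable_dx hw.continuous_space_dx
  constructor
  · exact hw.measurable.sub hz.measurable
  · exact hw.measurable_dx.sub hz.measurable_dx
  · exact hw.continuous_time.sub hz.continuous_time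
  · exact hw.continuous_space.sub hz.continuous_space
  · exact hw.continuous_space_dx.sub hz.continuous_space_dx
  · intro φ hφ
    have e1 := hw.weak_dx φ hφ
    have e2 := hz.weak_dx φ hφ
    have h1 := hφ.partialFst
    change ∫ p in halfStrip T, _ * partialFst φ p = _ at e1 e2
    change ∫ p in halfStrip T, _ * partialFst φ p = _
    simp_rw [sub_mul]
    rw [integral_sub (h1.integrableOn_mul lw) (h1.integrableOn_mul lz),
      integral_sub (hφ.integrableOn_mul lwx) (hφ.integrableOn_mul lzx), e1, e2]
    ring
  · intro φ hφ
    have e1 := hw.equation φ hφ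
    have e2 := hz.equation φ hφ
    have hψ : ∀ {u : ℝ → ℝ → ℂ},
        (∀ R, IntegrableOn (fun p : ℝ × ℝ => u p.1 p.2) (Ioo 0 R ×ˢ Ioo 0 T)) →
        IntegrableOn (fun p => u p.1 p.2 * (-Complex.I * partialSnd φ p +
          partialFst (partialFst (partialFst (partialFst φ))) p)) (halfStrip T) := fun {u} hu => by
      have i1 := (hφ.partialSnd.integrableOn_mul hu).const_mul (-Complex.I)
      have i2 := hφ.partialFst.partialFst.partialFst.partialFst.integrableOn_mul hu
      refine (i1.add i2).congr (Eventually.of_forall fun p => ?_)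
      simp only [Pi.add_apply]
      ring
    simp_rw [iteratedDeriv_four_fst φ] at e1 e2 ⊢
    simp_rw [sub_mul]
    change ∫ p in halfStrip T, _ * (-Complex.I * partialSnd φ p + _) = 0 at e1 e2
    change ∫ p in halfStrip T, (w p.1 p.2 * (-Complex.I * partialSnd φ p +
      partialFst (partialFst (partialFst (partialFst φ))) p) -
      z p.1 p.2 * (-Complex.I * partialSnd φ p +
      partialFst (partialFst (partialFst (partialFst φ))) p)) = 0
    rw [integral_sub (hψ lw) (hψ lz), e1, e2, sub_zero]
  · filter_upwards [hw.initial, hz.initial] with x h1 h2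
    rw [h1, h2, sub_zero]
  · filter_upwards [hw.dirichlet, hz.dirichlet] with t h1 h2
    rw [h1, h2, sub_self]
  · filter_upwards [hw.neumann, hz.neumann] with t h1 h2
    rw [h1, h2, sub_self]

variable {T : ℝ} {W Wx : ℝ → ℝ → ℂ} {θ : ℝ → ℂ}

/-- The weak `x`-derivative commutes with integration in time against a bounded kernel. -/
theorem IsHalfLineSolution.weak_dx_kernel {h₀ h₁ : ℝ → ℂ} (hW : IsHalfLineSolution T h₀ h₁ W Wx)
    (hθ : IsTestOn (Ioi 0) θ) {k : ℝ → ℂ} (hk : Measurable k) {B : ℝ} (hB : ∀ t, ‖k t‖ ≤ B) :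
    ∫ x in Ioi 0, (∫ t in Ioo 0 T, W x t * k t) * deriv θ x =
      ∫ x in Ioi 0, -(∫ t in Ioo 0 T, Wx x t * k t) * θ x := by
  have l := integrableOn_box hW.measurable hW.continuous_space
  have lx := integrableOn_box hW.measurable_dx hW.continuous_space_dx
  have hθ' := hθ.isTestOn_deriv
  -- The kernel k need not be smooth, so product test functions are first used to obtain the
  -- identity at almost every t, which is then integrated against k.
  have h1 : (fun t => ∫ x in Ioi 0, W x t * deriv θ x) =ᵐ[volume.restrict (Ioo 0 T)]
      fun t => -∫ x in Ioi 0, Wx x t * θ x := by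
    have hone : ∀ t : ℝ, ‖(fun _ => 1 : ℝ → ℂ) t‖ ≤ 1 := fun t => by simp
    have i1 := (setIntegral_halfStrip_mul l hθ' measurable_const hone).2.1
    have i2 := (setIntegral_halfStrip_mul lx hθ measurable_const hone).2.1
    simp only [mul_one] at i1 i2
    refine ae_eq_of_integral_isTestOn_eq isOpen_Ioo i1.locallyIntegrableOn
      i2.neg.locallyIntegrableOn fun η hη => ?_
    obtain ⟨M, hM⟩ := hη.1.continuous.bounded_above_of_compact_support hη.2.1
    have hηm := hη.1.continuous.measurable
    have e := hW.weak_dx _ (hθ.mul_prod hη)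
    have hd : ∀ p : ℝ × ℝ, deriv (fun y => θ y * η p.2) p.1 = deriv θ p.1 * η p.2 := fun p =>
      deriv_mul_const_field _
    simp only [hd] at e
    rw [(setIntegral_halfStrip_mul l hθ' hηm hM).2.2.2,
      (setIntegral_halfStrip_mul lx hθ hηm hM).2.2.2, ← integral_neg] at e
    rw [e]
    congr with t
    ring
  obtain ⟨-, -, a1, a2⟩ := setIntegral_halfStrip_mul l hθ' hk hB
  obtain ⟨-, -, b1, b2⟩ := setIntegral_halfStrip_mul lx hθ hk hB
  simp_rw [neg_mul]
  rw [integral_neg, ← a1, ← b1, a2, b2, ← integral_neg]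
  refine integral_congr_ae ?_
  filter_upwards [h1] with t ht
  rw [ht]
  ring

theorem IsTestOn.memLp {I J : Set ℝ} (hθ : IsTestOn I θ) : MemLp θ 2 (volume.restrict J) :=
  (hθ.1.continuous.memLp_of_hasCompactSupport hθ.2.1).restrict J

/-- Pairings of a solution with test functions of `x` satisfy the equation classically in time. -/
theorem IsHalfLineSolution.exists_time_pairing (hT : 0 < T) {h₀ h₁ : ℝ → ℂ}
    (hW : IsHalfLineSolution T h₀ h₁ W Wx) (hθ : IsTestOn (Ioi 0) θ) :
    ∃ v v' : ℝ → ℂ, Continuous v' ∧ (∀ t, HasDerivAt v (v' t) t) ∧ v 0 = 0 ∧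
      (∀ t ∈ Ioo 0 T, v t = ∫ x in Ioi 0, W x t * θ x) ∧
      ∀ t ∈ Ioo 0 T, v' t = Complex.I * ∫ x in Ioi 0, W x t * iteratedDeriv 4 θ x := by
  have l := integrableOn_box hW.measurable hW.continuous_space
  have hθ4 := hθ.isTestOn_iteratedDeriv 4
  set m : ℝ → ℂ := fun t => ∫ x in Ioi 0, W x t * θ x with hm
  set m4 : ℝ → ℂ := fun t => ∫ x in Ioi 0, W x t * iteratedDeriv 4 θ x with hm4
  have hmc : ContinuousOn m (Icc 0 T) := hW.continuous_time.continuousOn_pairing hθ.memLp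
  have hm4c : ContinuousOn m4 (Icc 0 T) := hW.continuous_time.continuousOn_pairing hθ4.memLp
  -- The du Bois-Reymond lemma asks for a right side continuous on the whole line; the constant
  -- extension beyond [0,T] provides it.
  set u : ℝ → ℂ := IccExtend hT.le ((Icc 0 T).domRestrict m4) with hu
  have huc : Continuous u := (continuousOn_iff_continuous_domRestrict.1 hm4c).Icc_extend'
  have hue : ∀ t ∈ Icc 0 T, u t = m4 t := fun t ht => IccExtend_of_mem hT.le _ ht
  obtain ⟨v, hv, hvm⟩ := exists_integral_iteratedDeriv_eq (isOpen_Ioo (a := 0) (b := T))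
    ordConnected_Ioo (nonempty_Ioo.2 hT) (hmc.mono Ioo_subset_Icc_self)
    (u := fun t => -(Complex.I * u t)) (huc.const_mul Complex.I).neg 0 fun η hη => by
    obtain ⟨M, hM⟩ := hη.1.continuous.bounded_above_of_compact_support hη.2.1
    obtain ⟨M', hM'⟩ :=
      hη.isTestOn_deriv.1.continuous.bounded_above_of_compact_support hη.isTestOn_deriv.2.1
    obtain ⟨a0, -, -, a2⟩ := setIntegral_halfStrip_mul l hθ
      hη.isTestOn_deriv.1.continuous.measurable hM'
    obtain ⟨b0, -, -, b2⟩ := setIntegral_halfStrip_mul l hθ4 hη.1.continuous.measurable hM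
    have e := hW.equation _ (hθ.mul_prod hη)
    have hd : ∀ p : ℝ × ℝ, deriv (fun τ => θ p.1 * η τ) p.2 = θ p.1 * deriv η p.2 := fun p =>
      deriv_const_mul_field _
    have hd4 : ∀ p : ℝ × ℝ, iteratedDeriv 4 (fun y => θ y * η p.2) p.1 =
        iteratedDeriv 4 θ p.1 * η p.2 := fun p => by
      rw [show (fun y => θ y * η p.2) = fun y => η p.2 * θ y from funext fun y => mul_comm _ _,
        iteratedDeriv_const_mul_field, mul_comm]
    simp only [hd, hd4] at e
    have e' : ∀ p : ℝ × ℝ, W p.1 p.2 * (-Complex.I * (θ p.1 * deriv η p.2) +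
        iteratedDeriv 4 θ p.1 * η p.2) = -Complex.I * (W p.1 p.2 * (θ p.1 * deriv η p.2)) +
        W p.1 p.2 * (iteratedDeriv 4 θ p.1 * η p.2) := fun p => by ring
    simp_rw [e'] at e
    rw [integral_add (a0.const_mul _) b0, integral_const_mul, a2, b2] at e
    simp only [zero_add, iteratedDeriv_one]
    have e3 : ∫ t in Ioo 0 T, -(Complex.I * u t) * η t =
        -Complex.I * ∫ t in Ioo 0 T, m4 t * η t := by
      rw [← integral_const_mul]
      refine setIntegral_congr_fun measurableSet_Ioo fun t ht => ?_
      rw [hue t (Ioo_subset_Icc_self ht)]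
      ring
    rw [e3]
    linear_combination Complex.I * e + (∫ t in Ioo 0 T, m t * deriv η t) * Complex.I_sq
  have hvc : Continuous v := continuous_iff_continuousAt.2 fun x => (hv x).continuousAt
  have heq : EqOn m v (Ioo 0 T) := eqOn_of_integral_isTestOn_eq isOpen_Ioo
    (hmc.mono Ioo_subset_Icc_self) hvc.continuousOn fun η hη => by simpa using hvm η hη
  refine ⟨v, fun t => Complex.I * u t, huc.const_mul _, fun t => by simpa using hv t, ?_,
    fun t ht => (heq ht).symm, fun t ht => by
      dsimp only
      rw [hue t (Ioo_subset_Icc_self ht)]⟩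
  have hm0 : m 0 = 0 := by
    refine (integral_congr_ae (g := fun _ => (0 : ℂ)) ?_).trans (by simp)
    filter_upwards [hW.initial] with x hx
    rw [hx, zero_mul]
  -- The pairing is continuous up to t = 0, so the C¹ function inherits the zero initial value.
  have hcl := heq.of_subset_closure hmc hvc.continuousOn Ioo_subset_Icc_self
    (closure_Ioo hT.ne).ge
  rw [← hcl (left_mem_Icc.2 hT.le), hm0]
end

/-! ### Antiderivatives in time -/

noncomputable section

/-- The kernel `1_{(0,t)}` of the first antiderivative at time `t`. -/
def primitiveKernel (t : ℝ) : ℝ → ℂ := (Ioo 0 t).indicator fun _ => 1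

/-- The kernel `(t - τ) 1_{(0,t)}(τ)` of the second antiderivative at time `t`. -/
def secondPrimitiveKernel (t : ℝ) : ℝ → ℂ := (Ioo 0 t).indicator fun τ => ((t - τ : ℝ) : ℂ)

theorem measurable_primitiveKernel (t : ℝ) : Measurable (primitiveKernel t) :=
  measurable_const.indicator measurableSet_Ioo

theorem measurable_secondPrimitiveKernel (t : ℝ) : Measurable (secondPrimitiveKernel t) :=
  Measurable.indicator (by fun_prop) measurableSet_Ioo

theorem norm_primitiveKernel_le (t τ : ℝ) : ‖primitiveKernel t τ‖ ≤ 1 := by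
  unfold primitiveKernel
  by_cases h : τ ∈ Ioo 0 t
  · simp [indicator_of_mem h]
  · simp [indicator_of_notMem h]

theorem norm_secondPrimitiveKernel_le (t τ : ℝ) : ‖secondPrimitiveKernel t τ‖ ≤ |t| := by
  unfold secondPrimitiveKernel
  by_cases h : τ ∈ Ioo 0 t
  · rw [indicator_of_mem h, Complex.norm_real, Real.norm_eq_abs, abs_of_pos (by linarith [h.2])]
    linarith [h.1, le_abs_self t]
  · simp [indicator_of_notMem h]

theorem memLp_of_norm_le_Ioo {T : ℝ} {k : ℝ → ℂ} (hk : Measurable k) {B : ℝ} (hB : ∀ t, ‖k t‖ ≤ B) :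
    MemLp k 2 (volume.restrict (Ioo 0 T)) :=
  MemLp.of_bound hk.aestronglyMeasurable B (Eventually.of_forall hB)

theorem setIntegral_indicator_smul {E : Type*} [NormedAddCommGroup E] [NormedSpace ℝ E]
    [Module ℂ E] {T t : ℝ}
    (ht : t ∈ Icc 0 T) (c : ℝ → ℂ) (f : ℝ → E) :
    ∫ τ in Ioo 0 T, (Ioo 0 t).indicator c τ • f τ = ∫ τ in (0 : ℝ)..t, c τ • f τ := by
  rw [intervalIntegral.integral_of_le ht.1, integral_Ioc_eq_integral_Ioo]
  have : ∀ τ, (Ioo 0 t).indicator c τ • f τ = (Ioo 0 t).indicator (fun τ => c τ • f τ) τ := fun τ => by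
    by_cases h : τ ∈ Ioo 0 t
    · rw [indicator_of_mem h, indicator_of_mem h]
    · rw [indicator_of_notMem h, indicator_of_notMem h, zero_smul]
  simp_rw [this]
  rw [setIntegral_indicator measurableSet_Ioo, inter_eq_self_of_subset_right
    (Ioo_subset_Ioo_right ht.2)]

variable {T : ℝ} {W Wx : ℝ → ℝ → ℂ} {h₀ h₁ : ℝ → ℂ}

/-- The weak form of V_xxxx = -iU, with U and V the first and second antiderivatives. It is an
integration by parts of (t-τ)v'(τ): the end terms vanish because v(0) = 0 and t - τ = 0 at τ = t. -/
theorem IsHalfLineSolution.integral_secondPrimitive (hT : 0 < T)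
    (hW : IsHalfLineSolution T h₀ h₁ W Wx) {t : ℝ} (ht : t ∈ Icc 0 T) {θ : ℝ → ℂ}
    (hθ : IsTestOn (Ioi 0) θ) :
    ∫ x in Ioi 0, (∫ τ in Ioo 0 T, W x τ * secondPrimitiveKernel t τ) * iteratedDeriv 4 θ x =
      ∫ x in Ioi 0, (-Complex.I * ∫ τ in Ioo 0 T, W x τ * primitiveKernel t τ) * θ x := by
  have l := integrableOn_box hW.measurable hW.continuous_space
  obtain ⟨v, v', hv'c, hv, hv0, hvm, hvm'⟩ := hW.exists_time_pairing hT hθ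
  have hvc : Continuous v := continuous_iff_continuousAt.2 fun x => (hv x).continuousAt
  obtain ⟨-, -, a1, a2⟩ := setIntegral_halfStrip_mul l (hθ.isTestOn_iteratedDeriv 4)
    (measurable_secondPrimitiveKernel t) (norm_secondPrimitiveKernel_le t)
  obtain ⟨-, -, b1, b2⟩ := setIntegral_halfStrip_mul l hθ
    (measurable_primitiveKernel t) (norm_primitiveKernel_le t)
  simp_rw [mul_assoc (-Complex.I)]
  rw [integral_const_mul, ← a1, ← b1, a2, b2]
  have e1 : ∫ τ in Ioo 0 T, (∫ x in Ioi 0, W x τ * iteratedDeriv 4 θ x) *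
      secondPrimitiveKernel t τ = ∫ τ in (0 : ℝ)..t, ((t - τ : ℝ) : ℂ) • (-Complex.I * v' τ) := by
    rw [← setIntegral_indicator_smul ht]
    refine setIntegral_congr_fun measurableSet_Ioo fun τ hτ => ?_
    rw [hvm' τ hτ, smul_eq_mul, mul_comm]
    unfold secondPrimitiveKernel
    linear_combination (Ioo 0 t).indicator (fun τ => ((t - τ : ℝ) : ℂ)) τ *
      (∫ x in Ioi 0, W x τ * iteratedDeriv 4 θ x) * Complex.I_sq
  have e2 : ∫ τ in Ioo 0 T, (∫ x in Ioi 0, W x τ * θ x) * primitiveKernel t τ =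
      ∫ τ in (0 : ℝ)..t, (1 : ℂ) • v τ := by
    rw [← setIntegral_indicator_smul ht]
    refine setIntegral_congr_fun measurableSet_Ioo fun τ hτ => ?_
    rw [hvm τ hτ, smul_eq_mul, mul_comm]
    rfl
  rw [e1, e2]
  have hd : ∀ τ : ℝ, HasDerivAt (fun τ : ℝ => ((t - τ : ℝ) : ℂ) * v τ)
      (((t - τ : ℝ) : ℂ) * v' τ - v τ) τ := fun τ => by
    have h1 : HasDerivAt (fun τ : ℝ => ((t - τ : ℝ) : ℂ)) ((-1 : ℝ) : ℂ) τ :=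
      HasDerivAt.ofReal_comp ((hasDerivAt_id τ).const_sub t)
    refine (h1.fun_mul (hv τ)).congr_deriv ?_
    push_cast
    ring
  have c1 : Continuous fun τ : ℝ => ((t - τ : ℝ) : ℂ) * v' τ := by fun_prop
  have hint := intervalIntegral.integral_eq_sub_of_hasDerivAt (a := 0) (b := t)
    (fun τ _ => hd τ) ((c1.sub hvc).intervalIntegrable _ _)
  rw [intervalIntegral.integral_sub (c1.intervalIntegrable _ _) (hvc.intervalIntegrable _ _), hv0] at hint
  simp only [sub_self, Complex.ofReal_zero, zero_mul, mul_zero] at hint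
  simp only [smul_eq_mul, one_mul, mul_left_comm _ (-Complex.I), intervalIntegral.integral_const_mul]
  rw [sub_eq_zero.1 hint]

theorem IsHalfLineSolution.continuousOn_kernel (hW : IsHalfLineSolution T h₀ h₁ W Wx) {k : ℝ → ℂ}
    (hk : Measurable k) {B : ℝ} (hB : ∀ t, ‖k t‖ ≤ B) :
    ContinuousOn (fun x => ∫ τ in Ioo 0 T, W x τ * k τ) (Ici 0) :=
  hW.continuous_space.continuousOn_pairing (memLp_of_norm_le_Ioo hk hB)

theorem exists_continuous_extension {f : ℝ → ℂ} (hf : ContinuousOn f (Ici 0)) :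
    ∃ g : ℝ → ℂ, Continuous g ∧ EqOn g f (Ici 0) := by
  refine ⟨fun x => f (max x 0), ?_, fun x hx => by simp only [max_eq_left (mem_Ici.1 hx)]⟩
  rw [← continuousOn_univ]
  exact hf.comp (by fun_prop) fun x _ => mem_Ici.2 (le_max_right _ _)

/-- The second antiderivative in time of a solution with vanishing data is a classical solution of
a fourth order equation in `x`, clamped at the boundary. -/
theorem IsHalfLineSolution.exists_clamped (hT : 0 < T)
    (hW : IsHalfLineSolution T (fun _ => 0) (fun _ => 0) W Wx) {t : ℝ} (ht : t ∈ Icc 0 T) :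
    ∃ F₀ F₁ F₂ F₃ F₄ : ℝ → ℂ, (∀ x, HasDerivAt F₀ (F₁ x) x) ∧ (∀ x, HasDerivAt F₁ (F₂ x) x) ∧
      (∀ x, HasDerivAt F₂ (F₃ x) x) ∧ (∀ x, HasDerivAt F₃ (F₄ x) x) ∧ Continuous F₄ ∧
      F₀ 0 = 0 ∧ F₁ 0 = 0 ∧
      (∀ x ∈ Ioi 0, F₀ x = ∫ τ in Ioo 0 T, W x τ * secondPrimitiveKernel t τ) ∧
      ∀ x ∈ Ioi 0, F₄ x = -Complex.I * ∫ τ in Ioo 0 T, W x τ * primitiveKernel t τ := by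
  have mk := measurable_primitiveKernel t
  have bk := norm_primitiveKernel_le t
  have mK := measurable_secondPrimitiveKernel t
  have bK := norm_secondPrimitiveKernel_le t
  have cv := hW.continuousOn_kernel mK bK
  have cv' := cv.mono Ioi_subset_Ici_self
  have cvx : ContinuousOn (fun x => ∫ τ in Ioo 0 T, Wx x τ * secondPrimitiveKernel t τ) (Ici 0) :=
    hW.continuous_space_dx.continuousOn_pairing (memLp_of_norm_le_Ioo mK bK)
  obtain ⟨g₀, cg₀, eg₀⟩ := exists_continuous_extension
    ((hW.continuousOn_kernel mk bk).const_mul (-Complex.I))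
  obtain ⟨gx, cgx, egx⟩ := exists_continuous_extension cvx.neg
  -- Since U at fixed t is continuous in x, four uses of the du Bois-Reymond lemma make V
  -- classically C⁴.
  have step := fun (k : ℕ) (u : ℝ → ℂ) (hu : Continuous u) =>
    exists_integral_iteratedDeriv_eq isOpen_Ioi ordConnected_Ioi nonempty_Ioi cv' hu k
  have hcont : ∀ {g g' : ℝ → ℂ}, (∀ x, HasDerivAt g (g' x) x) → Continuous g := fun h =>
    continuous_iff_continuousAt.2 fun x => (h x).continuousAt
  obtain ⟨g₁, d₁, i₁⟩ := step 3 g₀ cg₀ fun θ hθ => by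
    rw [hW.integral_secondPrimitive hT ht hθ]
    refine setIntegral_congr_fun measurableSet_Ioi fun x hx => ?_
    rw [eg₀ (Ioi_subset_Ici_self hx)]
  obtain ⟨g₂, d₂, i₂⟩ := step 2 g₁ (hcont d₁) i₁
  obtain ⟨g₃, d₃, i₃⟩ := step 1 g₂ (hcont d₂) i₂
  obtain ⟨g₄, d₄, i₄⟩ := step 0 g₃ (hcont d₃) i₃
  -- A second route to V_x, through the weak derivative `Wx`, identifies the classical derivative
  -- with the time integral of `Wx` and so brings in the Neumann condition at x = 0.
  obtain ⟨w, dw, iw⟩ := step 0 gx cgx fun θ hθ => by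
    simp only [zero_add, iteratedDeriv_one]
    rw [hW.weak_dx_kernel hθ mK bK]
    refine setIntegral_congr_fun measurableSet_Ioi fun x hx => ?_
    rw [egx (Ioi_subset_Ici_self hx)]
    rfl
  have E₄ : EqOn _ g₄ (Ioi 0) := eqOn_of_integral_isTestOn_eq isOpen_Ioi cv' (hcont d₄).continuousOn
    fun θ hθ => by simpa using i₄ θ hθ
  have Ew : EqOn _ w (Ioi 0) := eqOn_of_integral_isTestOn_eq isOpen_Ioi cv' (hcont dw).continuousOn
    fun θ hθ => by simpa using iw θ hθ
  have E₄' := E₄.of_subset_closure cv (hcont d₄).continuousOn Ioi_subset_Ici_self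
    (closure_Ioi (0 : ℝ)).ge
  have Ed : EqOn g₃ gx (Ioi 0) := fun x hx => by
    have h1 : g₄ =ᶠ[𝓝 x] w := by
      filter_upwards [isOpen_Ioi.mem_nhds hx] with y hy
      rw [← E₄ hy, ← Ew hy]
    exact neg_injective ((d₄ x).unique ((dw x).congr_of_eventuallyEq h1))
  have Ed' := Ed.of_subset_closure (hcont d₃).continuousOn cgx.continuousOn Ioi_subset_Ici_self
    (closure_Ioi (0 : ℝ)).ge
  -- Each use of the lemma gives v' = -u, hence the alternating signs.
  refine ⟨g₄, fun x => -g₃ x, g₂, fun x => -g₁ x, g₀, d₄, fun x => ?_, d₂, fun x => ?_, cg₀, ?_, ?_,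
    fun x hx => (E₄ hx).symm, fun x hx => eg₀ (Ioi_subset_Ici_self hx)⟩
  · simpa using (d₃ x).fun_neg
  · simpa using (d₁ x).fun_neg
  · rw [← E₄' self_mem_Ici]
    refine (integral_congr_ae (g := fun _ => (0 : ℂ)) ?_).trans (by simp)
    filter_upwards [hW.dirichlet] with τ hτ
    rw [hτ, zero_mul]
  · change -g₃ 0 = 0
    rw [Ed' self_mem_Ici, egx self_mem_Ici, Pi.neg_apply, neg_neg]
    refine (integral_congr_ae (g := fun _ => (0 : ℂ)) ?_).trans (by simp)
    filter_upwards [hW.neumann] with τ hτ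
    rw [hτ, zero_mul]

/-- The energy argument integrates in time with values in L²(ℝ₊), Green's formula needs time
integrals at each fixed x. Testing against functions of x shows that the two agree. -/
theorem IsHalfLineSolution.integral_smul_ae_eq (hW : IsHalfLineSolution T h₀ h₁ W Wx)
    {U : ℝ → Lp ℂ 2 (volume.restrict (Ioi (0 : ℝ)))} (hU : Continuous U)
    (hUW : ∀ τ ∈ Icc 0 T, U τ =ᵐ[volume.restrict (Ioi 0)] fun x => W x τ) {k : ℝ → ℂ}
    (hk : Measurable k) {B : ℝ} (hB : ∀ t, ‖k t‖ ≤ B) :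
    (∫ τ in Ioo 0 T, k τ • U τ : Lp ℂ 2 (volume.restrict (Ioi (0 : ℝ)))) =ᵐ[volume.restrict (Ioi 0)]
      fun x => ∫ τ in Ioo 0 T, W x τ * k τ := by
  have l := integrableOn_box hW.measurable hW.continuous_space
  have hUi : IntegrableOn U (Ioo 0 T) :=
    (hU.continuousOn.integrableOn_compact isCompact_Icc).mono_set Ioo_subset_Icc_self
  have hi : IntegrableOn (fun τ => k τ • U τ) (Ioo 0 T) :=
    hUi.bdd_smul B hk.aestronglyMeasurable (Eventually.of_forall hB)
  refine ae_eq_of_integral_isTestOn_eq isOpen_Ioi ?_ ?_ fun θ hθ => ?_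
  · have := (Lp.memLp (∫ τ in Ioo 0 T, k τ • U τ : Lp ℂ 2 (volume.restrict (Ioi (0 : ℝ)))))
    exact locallyIntegrableOn_of_locallyIntegrable_restrict (this.locallyIntegrable (by norm_num))
  · exact ((hW.continuousOn_kernel hk hB).mono Ioi_subset_Ici_self).locallyIntegrableOn
      measurableSet_Ioi
  · obtain ⟨-, -, a1, a2⟩ := setIntegral_halfStrip_mul l hθ hk hB
    rw [← a1, a2, ← l2Pairing_apply hθ.memLp, ← ContinuousLinearMap.integral_comp_comm _ hi]
    refine setIntegral_congr_fun measurableSet_Ioo fun τ hτ => ?_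
    rw [map_smul, l2Pairing_apply, smul_eq_mul, mul_comm]
    congr 1
    refine integral_congr_ae ?_
    filter_upwards [hUW τ (Ioo_subset_Icc_self hτ)] with x hx
    rw [hx]
end

/-! ### Uniqueness by conservation of the norm -/

noncomputable section

theorem ae_halfStrip_eq_zero {T : ℝ} {W : ℝ → ℝ → ℂ}
    (hm : AEStronglyMeasurable (fun p : ℝ × ℝ => W p.1 p.2) (volume.restrict (halfStrip T)))
    (h : ∀ t ∈ Ioo 0 T, (fun x => W x t) =ᵐ[volume.restrict (Ioi 0)] 0) :
    (fun p : ℝ × ℝ => W p.1 p.2) =ᵐ[volume.restrict (halfStrip T)] 0 := by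
  have e : (volume.restrict (halfStrip T) : Measure (ℝ × ℝ)) =
      (volume.restrict (Ioi 0)).prod (volume.restrict (Ioo 0 T)) := by
    rw [Measure.prod_restrict, ← Measure.volume_eq_prod]
    rfl
  have h0 : ∫⁻ p in halfStrip T, ‖W p.1 p.2‖ₑ = 0 := by
    rw [e] at hm ⊢
    rw [lintegral_prod_symm _ hm.enorm]
    refine (setLIntegral_congr_fun measurableSet_Ioo fun t ht => ?_).trans (lintegral_zero (μ := volume.restrict (Ioo 0 T)))
    refine (lintegral_congr_ae ?_).trans lintegral_zero
    filter_upwards [h t ht] with x hx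
    have : W x t = 0 := hx
    simp [this]
  filter_upwards [(lintegral_eq_zero_iff' hm.enorm).1 h0] with p hp
  simpa using hp

/-- With V' = U = iV_xxxx and V clamped at x = 0, the derivative of ‖V‖² is 2 Re⟨V, iV_xxxx⟩ = 0. As
V(0) = 0, V vanishes on [0,T], and two differentiations in time give W = 0. -/
theorem IsHalfLineSolution.ae_eq_zero {T : ℝ} (hT : 0 < T) {W Wx : ℝ → ℝ → ℂ}
    (hW : IsHalfLineSolution T (fun _ => 0) (fun _ => 0) W Wx) :
    (fun p : ℝ × ℝ => W p.1 p.2) =ᵐ[volume.restrict (halfStrip T)] 0 := by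
  obtain ⟨w₀, hw₀c, hw₀⟩ := hW.continuous_time.exists_continuousOn_Lp
  set w : ℝ → Lp ℂ 2 (volume.restrict (Ioi (0 : ℝ))) :=
    IccExtend hT.le ((Icc 0 T).domRestrict w₀) with hw
  have hwc : Continuous w := (continuousOn_iff_continuous_domRestrict.1 hw₀c).Icc_extend'
  have hwW : ∀ t ∈ Icc 0 T, w t =ᵐ[volume.restrict (Ioi 0)] fun x => W x t := fun t ht => by
    rw [hw, IccExtend_of_mem hT.le _ ht]
    exact hw₀ t ht
  set U : ℝ → Lp ℂ 2 (volume.restrict (Ioi (0 : ℝ))) := fun t => ∫ τ in (0 : ℝ)..t, w τ with hU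
  -- This is the integral of (t-τ)w(τ), written so that its derivative follows from the product
  -- rule.
  set V : ℝ → Lp ℂ 2 (volume.restrict (Ioi (0 : ℝ))) := fun t =>
    (t : ℂ) • U t - ∫ τ in (0 : ℝ)..t, (τ : ℂ) • w τ with hV
  have hτw : Continuous fun τ : ℝ => (τ : ℂ) • w τ := Complex.continuous_ofReal.smul hwc
  have dU : ∀ t, HasDerivAt U (w t) t := fun t => (hwc.integral_hasStrictDerivAt 0 t).hasDerivAt
  have dV : ∀ t, HasDerivAt V (U t) t := fun t => by
    have h1 : HasDerivAt (fun t : ℝ => (t : ℂ)) 1 t := by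
      simpa using HasDerivAt.ofReal_comp (hasDerivAt_id t)
    refine ((h1.fun_smul (dU t)).fun_sub (hτw.integral_hasStrictDerivAt 0 t).hasDerivAt).congr_deriv ?_
    simp
  have horth : ∀ t ∈ Icc 0 T, inner ℝ (V t) (U t) = 0 := fun t ht => by
    obtain ⟨F₀, F₁, F₂, F₃, F₄, d₀, d₁, d₂, d₃, c₄, z₀, z₁, e₀, e₄⟩ := hW.exists_clamped hT ht
    have hUt : U t = ∫ τ in Ioo 0 T, primitiveKernel t τ • w τ := by
      refine Eq.trans ?_ (setIntegral_indicator_smul ht (fun _ => (1 : ℂ)) w).symm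
      simp only [one_smul, hU]
    have hVt : V t = ∫ τ in Ioo 0 T, secondPrimitiveKernel t τ • w τ := by
      refine Eq.trans ?_ (setIntegral_indicator_smul ht (fun τ => ((t - τ : ℝ) : ℂ)) w).symm
      simp only [Complex.ofReal_sub, sub_smul]
      have hc : Continuous fun τ => (t : ℂ) • w τ :=
        (continuous_const (y := (t : ℂ))).smul hwc
      rw [intervalIntegral.integral_sub (hc.intervalIntegrable _ _)
        (hτw.intervalIntegrable _ _), intervalIntegral.integral_smul]
    have aU := hW.integral_smul_ae_eq hwc hwW (measurable_primitiveKernel t)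
      (norm_primitiveKernel_le t)
    have aV := hW.integral_smul_ae_eq hwc hwW (measurable_secondPrimitiveKernel t)
      (norm_secondPrimitiveKernel_le t)
    rw [← hUt] at aU
    rw [← hVt] at aV
    have aV' : V t =ᵐ[volume.restrict (Ioi 0)] F₀ := by
      filter_upwards [aV, ae_restrict_mem measurableSet_Ioi] with x hx hx0
      rw [hx, e₀ x hx0]
    have aU' : U t =ᵐ[volume.restrict (Ioi 0)] fun x => Complex.I * F₄ x := by
      filter_upwards [aU, ae_restrict_mem measurableSet_Ioi] with x hx hx0
      rw [hx, e₄ x hx0, ← mul_assoc, mul_neg, Complex.I_mul_I, neg_neg, one_mul]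
    have L₀ : MemLp F₀ 2 (volume.restrict (Ioi 0)) := (memLp_congr_ae aV').1 (Lp.memLp _)
    have L₄ : MemLp F₄ 2 (volume.restrict (Ioi 0)) := by
      have := ((memLp_congr_ae aU').1 (Lp.memLp _)).const_mul (-Complex.I)
      refine (memLp_congr_ae (Eventually.of_forall fun x => ?_)).1 this
      rw [← mul_assoc, neg_mul, Complex.I_mul_I, neg_neg, one_mul]
    rw [L2.inner_def]
    refine (integral_congr_ae ?_).trans
      (integral_inner_I_mul_eq_zero d₀ d₁ d₂ d₃ c₄ L₀ L₄ z₀ z₁)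
    filter_upwards [aV', aU'] with x h1 h2
    rw [h1, h2]
  have hnorm : ∀ t ∈ Icc 0 T, ‖V t‖ ^ 2 = ‖V 0‖ ^ 2 := by
    refine constant_of_has_deriv_right_zero ?_ fun t ht => ?_
    · exact (continuous_iff_continuousAt.2 fun t => (dV t).norm_sq.continuousAt).continuousOn
    · have := (dV t).norm_sq
      rw [horth t (Ico_subset_Icc_self ht), mul_zero] at this
      exact this.hasDerivWithinAt
  have hV0 : ∀ t ∈ Icc 0 T, V t = 0 := fun t ht => by
    have h1 := hnorm t ht
    have h2 : V 0 = 0 := by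
      simp only [hV, intervalIntegral.integral_same, sub_zero, Complex.ofReal_zero]
      exact zero_smul ℂ _
    rw [h2, norm_zero] at h1
    simpa using h1
  have hU0 : ∀ t ∈ Ioo 0 T, U t = 0 := fun t ht => by
    refine (dV t).unique ((hasDerivAt_const t 0).congr_of_eventuallyEq ?_)
    filter_upwards [isOpen_Ioo.mem_nhds ht] with t' ht'
    exact hV0 t' (Ioo_subset_Icc_self ht')
  have hw0 : ∀ t ∈ Ioo 0 T, w t = 0 := fun t ht => by
    refine (dU t).unique ((hasDerivAt_const t 0).congr_of_eventuallyEq ?_)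
    filter_upwards [isOpen_Ioo.mem_nhds ht] with t' ht'
    exact hU0 t' ht'
  refine ae_halfStrip_eq_zero hW.measurable fun t ht => ?_
  have h1 := hwW t (Ioo_subset_Icc_self ht)
  rw [hw0 t ht] at h1
  exact h1.symm.trans (Lp.coeFn_zero _ _ _)

/-- Uniqueness of the solution with given boundary data. -/
theorem IsHalfLineSolution.unique {T : ℝ} (hT : 0 < T) {h₀ h₁ : ℝ → ℂ} {z zx w wx : ℝ → ℝ → ℂ}
    (hz : IsHalfLineSolution T h₀ h₁ z zx) (hw : IsHalfLineSolution T h₀ h₁ w wx) :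
    (fun p : ℝ × ℝ => w p.1 p.2) =ᵐ[volume.restrict (halfStrip T)]
      (fun p : ℝ × ℝ => z p.1 p.2) := by
  filter_upwards [(hw.sub hz).ae_eq_zero hT] with p hp
  exact sub_eq_zero.1 hp
end

theorem mainTheorem3 (s : ℝ) (hs : 0 ≤ s)
    (hs' : ∀ j : ℕ, s ≠ 4 * (j : ℝ) + 1 / 2 ∧ s ≠ 4 * (j : ℝ) + 3 / 2) :
    ∃ C : ℝ≥0, ∀ (T : ℝ) (_ : 0 < T) (h₀ h₁ : ℝ → ℂ)
      (_ : sobolevENorm ((2 * s + 3) / 8) univ h₀ < ⊤)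
      (_ : sobolevENorm ((2 * s + 1) / 8) univ h₁ < ⊤)
      (_ : ∀ᵐ t : ℝ, t ∉ Ioo 0 T → h₀ t = 0)
      (_ : ∀ᵐ t : ℝ, t ∉ Ioo 0 T → h₁ t = 0)
      (_ : CornerCompatible s h₀ h₁),
      ∃ z zx : ℝ → ℝ → ℂ,
        IsHalfLineSolution T h₀ h₁ z zx ∧
        (∀ w wx : ℝ → ℝ → ℂ, IsHalfLineSolution T h₀ h₁ w wx →
          (fun p : ℝ × ℝ => w p.1 p.2) =ᵐ[volume.restrict (halfStrip T)]
            (fun p : ℝ × ℝ => z p.1 p.2)) ∧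
        ContinuousInSobolev (Icc 0 T) s (Ioi 0) (fun t x => z x t) ∧
        ContinuousInSobolev (Ici 0) ((2 * s + 3) / 8) (Ioo 0 T) z ∧
        ContinuousInSobolev (Ici 0) ((2 * s + 1) / 8) (Ioo 0 T) zx ∧
        (⨆ t ∈ Icc (0 : ℝ) T, sobolevENorm s (Ioi 0) (fun x => z x t)) +
            (⨆ x ∈ Ici (0 : ℝ), sobolevENorm ((2 * s + 3) / 8) (Ioo 0 T) (z x)) ≤
          C * (sobolevENorm ((2 * s + 3) / 8) univ h₀ +
            ENNReal.ofReal (1 + T ^ (1 / 2 : ℝ)) *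
              sobolevENorm ((2 * s + 1) / 8) univ h₁) := by
  obtain ⟨C, hC⟩ := exists_isHalfLineSolution hs
  refine ⟨C, fun T hT h₀ h₁ hfin₀ hfin₁ hv₀ hv₁ _ => ?_⟩
  obtain ⟨z, zx, hz, hrest⟩ := hC T hT h₀ h₁ hfin₀ hfin₁ hv₀ hv₁
  exact ⟨z, zx, hz, fun w wx hw => hz.unique hT hw, hrest⟩
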